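/- \textbf{Crystals.} Let $P=\bigoplus_{a\in\mathbb Z\setminus\{0\}}\mathbb Z\epsilon_a\oplus\mathbb Z\Lambda_0$. The simple roots of $\mathfrak{gl}_\infty$ are $\alpha_i=\epsilon_i-\epsilon_{i+1}$, $\alpha_{-i}=\epsilon_{-i-1}-\epsilon_{-i}$ $(i>0)$ and $\alpha_0=\epsilon_{-1}-\epsilon_1$. The simple coroots $h_i$ $(i\in\mathbb Z)$ are defined by the same formulas with $E_{aa}$ in place of $\epsilon_a$; thus $\langle\epsilon_a,E_{bb}\rangle=\delta_{ab}$ and $\langle\Lambda_0,h_i\rangle=\delta_{i0}$. A $\mathfrak{gl}_\infty$-crystal is a set $B$ with maps $\mathrm{wt}:B\to P$, $\varepsilon_i,\varphi_i:B\to\mathbb Z\cup\{-\infty\}$ and $\tilde e_i,\tilde f_i:B\to B\cup\{\mathbf 0\}$ $(i\in\mathbb Z)$ such that $\varphi_i(b)=\langle\mathrm{wt}(b),h_i\rangle+\varepsilon_i(b)$; if $\tilde e_ib\ne\mathbf 0$, then $\varepsilon_i,\varphi_i,\mathrm{wt}$ change by $-1,+1,+\alpha_i$ under $\tilde e_i$;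 if $\tilde f_ib\neq\mathbf 0$, they change by $+1,-1,-\alpha_i$ under $\tilde f_i$; $\tilde f_ib=b'\iff b=\tilde e_ib'$; and $\tilde e_ib=\tilde f_ib=\mathbf 0$ if $\varphi_i(b)=-\infty$. An isomorphism of crystals is a bijection preserving $\mathrm{wt},\varepsilon_i,\varphi_i$ and commuting with all $\tilde e_i,\tilde f_i$ (where $\mathbf 0\mapsto\mathbf 0$). \textbf{Words.} Let $\mathbf B_{>0}=\{1<2<\cdots\}$ with $\mathrm{wt}(k)=\epsilon_k$ and arrows $k\xrightarrow{k}k+1$. Let $\mathbf B_{<0}^\vee=\{-1^\vee<-2^\vee<\cdots\}$ with $\mathrm{wt}(-k^\vee)=-\epsilon_{-k}$ and arrows $-k^\vee\xrightarrow{-k}-(k+1)^\vee$. An arrow $b\xrightarrow{i}b'$ means $b'=\tilde f_ib$; $\varepsilon_i(b)$ and $\varphi_i(b)$ are the numbers of $i$-arrows into and out of $b$. The operators with $i>0$ (resp. $i<0$) act on words $w_1\cdots w_r=w_1\otimes\cdots\otimes w_r$ in $\mathbf B_{>0}$ (resp. $\mathbf B_{<0}^\vee$) by the tensor product rule: $\mathrm{wt}$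 is additive, $\varepsilon_i(b_1\otimes b_2)=\max(\varepsilon_i(b_1),\varepsilon_i(b_2)-\langle\mathrm{wt}(b_1),h_i\rangle)$, $\varphi_i(b_1\otimes b_2)=\max(\varphi_i(b_1)+\langle\mathrm{wt}(b_2),h_i\rangle,\varphi_i(b_2))$; $\tilde e_i$ acts on $b_1$ if $\varphi_i(b_1)\ge\varepsilon_i(b_2)$ and on $b_2$ otherwise; $\tilde f_i$ acts on $b_1$ if $\varphi_i(b_1)>\varepsilon_i(b_2)$ and on $b_2$ otherwise. On the empty word $\mathrm{wt}=\varepsilon_i=\varphi_i=0$ and $\tilde e_i,\tilde f_i$ give $\mathbf 0$. \textbf{Matrices.} Let $\mathcal M$ be the set of matrices $A=(a_{-i^\vee,j})_{i,j\ge1}$ of finite support with entries in $\mathbb Z_{\ge0}$. List the positions $(-i^\vee,j)$ of $A$, each repeated $a_{-i^\vee,j}$ times, by increasing $j$ and, for equal $j$, by decreasing $-i^\vee$, as $(i_1,j_1),\dots,(i_r,j_r)$, and put $\mathbf i=i_1\cdots i_r$. List them by increasing $-i^\vee$ and, for equal $-i^\vee$, by decreasing $j$, as $(k_1,l_1),\dots,(k_r,l_r)$,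 and put $\mathbf l=l_1\cdots l_r$. For $i<0$, let $\varepsilon_i(A),\varphi_i(A)$ be those of $\mathbf i$, and let $\tilde e_i,\tilde f_i$ act on $A$ by acting on $\mathbf i$, keeping $j_1\cdots j_r$. For $i>0$, use $\mathbf l$ in the same way, keeping $k_1\cdots k_r$. Put $\mathrm{wt}(A)=\sum a_{-i^\vee,j}(-\epsilon_{-i}+\epsilon_j)$, $\varepsilon_0(A)=a_{-1^\vee,1}$, $\varphi_0(A)=\langle\mathrm{wt}(A),h_0\rangle+\varepsilon_0(A)$. Let $\tilde f_0A=A+E_{-1^\vee,1}$, and let $\tilde e_0A=A-E_{-1^\vee,1}$ if $a_{-1^\vee,1}\ne0$ and $\tilde e_0A=\mathbf 0$ otherwise. \textbf{Bitableaux.} An anti-normal shape is a Young diagram rotated by $180^\circ$. A tableau of such a shape is semistandard if rows increase weakly from left to right and columns increase strictly from top to bottom. Let $\mathcal T$ be the set of pairs $(S,T)$ of semistandard tableaux of the same anti-normal shape, $S$ with entries in $\mathbf B_{<0}^\vee$ and $T$ with entries in $\mathbf B_{>0}$. Let $w(S)$ be the word read row by row from top to bottom, each row from right to left, and likewise $w(T)$.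 For $i<0$ the data $\varepsilon_i,\varphi_i,\tilde e_i,\tilde f_i$ are those of $w(S)$, the operators changing $S$ within its shape and keeping $T$; for $i>0$ those of $w(T)$, with $S$ kept. Put $\mathrm{wt}(S,T)=\mathrm{wt}(w(S))+\mathrm{wt}(w(T))$. Number the columns from right to left, continuing with infinitely many empty ones. Let $\sigma_k=+$ if the $k$th column is empty, or if the smallest entries $s_k,t_k$ of the $k$th columns of $S,T$ satisfy $s_k>-1^\vee$ and $t_k>1$; $\sigma_k=-$ if $s_k=-1^\vee$ and $t_k=1$; and $\sigma_k=\cdot$ otherwise. In $(\dots,\sigma_2,\sigma_1)$ replace pairs $(-,+)$, with $-$ to the left of $+$ and only $\cdot$ in between, by $(\cdot,\cdot)$ as long as possible; the result is the $0$-signature. If it has a $-$, then $\tilde e_0(S,T)$ is obtained by removing $-1^\vee$ and $1$ from the columns of its left-most $-$; otherwise $\tilde e_0(S,T)=\mathbf 0$. Further, $\tilde f_0(S,T)$ is obtained by adding $-1^\vee$ and $1$ on top of the columns of its right-most $+$. Let $\varepsilon_0(S,T)$ be the number of $-$ in the $0$-signature and $\varphi_0(S,T)=\langle\mathrm{wt}(S,T),h_0\rangle+\varepsilon_0(S,T)$.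 \textbf{The RSK map.} For a tableau $T$ of anti-normal shape and a letter $a$, $T\leftarrow a$ is defined as follows: let $a'$ be the largest entry $\le a$ in the right-most column; if there is none, put $a$ on top of that column and stop; otherwise replace $a'$ by $a$ and repeat with $a'$ in the next column to the left. Put $\mathbf P(w_1\cdots w_r)=(\cdots(w_1\leftarrow w_2)\cdots)\leftarrow w_r$ and $\kappa(A)=(\mathbf P(i_r\cdots i_1),\mathbf P(l_r\cdots l_1))$ for $A\in\mathcal M$. \textbf{Theorem.} With these structures $\mathcal M$ and $\mathcal T$ are $\mathfrak{gl}_\infty$-crystals, and $\kappa$ is a well-defined isomorphism of $\mathfrak{gl}_\infty$-crystals $\kappa:\mathcal M\to\mathcal T$. -/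

import Mathlib

namespace GlInf

/-! ### The weight lattice and simple roots of `gl_∞` -/

/-- The index set `ℤ \ {0}` of the rows and columns of the matrices in `gl_∞`. -/
abbrev ZStar : Type := {n : ℤ // n ≠ 0}

/-- The weight lattice `P = (⨁_{a ≠ 0} ℤ ε_a) ⊕ ℤ Λ₀`; `(c, n)` stands for
`∑ c_a ε_a + n Λ₀`. -/
abbrev Weight : Type := (ZStar →₀ ℤ) × ℤ

/-- The weight `ε_a`. -/
noncomputable def eps (a : ZStar) : Weight := (Finsupp.single a 1, 0)

/-- The index `l(i)` such that `α_i = ε_{l(i)} - ε_{r(i)}` and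
`h_i = E_{l(i),l(i)} - E_{r(i),r(i)}`; it is `i` for `i > 0` and `i - 1` for `i ≤ 0`. -/
def leftIdx (i : ℤ) : ZStar :=
  if h : 0 < i then ⟨i, by omega⟩ else ⟨i - 1, by omega⟩

/-- The index `r(i)`; it is `i + 1` for `i ≥ 0` and `i` for `i < 0`. -/
def rightIdx (i : ℤ) : ZStar :=
  if h : i < 0 then ⟨i, by omega⟩ else ⟨i + 1, by omega⟩

/-- The simple root `α_i`, `i ∈ ℤ`:
`α_i = ε_i - ε_{i+1}`, `α_0 = ε_{-1} - ε_1`, `α_{-i} = ε_{-i-1} - ε_{-i}` (`i > 0`). -/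
noncomputable def simpleRoot (i : ℤ) : Weight := eps (leftIdx i) - eps (rightIdx i)

/-- The pairing `⟨μ, h_i⟩` with the simple coroot
`h_i = E_{l(i),l(i)} - E_{r(i),r(i)}`. The fundamental weight `Λ₀`
takes the value `1/2` on `E_{-a,-a}` and `-1/2` on `E_{a,a}` (`a > 0`), so that
`⟨Λ₀, h_i⟩ = δ_{i,0}`. -/
def pairing (μ : Weight) (i : ℤ) : ℤ :=
  μ.1 (leftIdx i) - μ.1 (rightIdx i) + if i = 0 then μ.2 else 0

/-! ### Crystals -/

/-- The maps `wt`, `ε_i`, `φ_i`, `ẽ_i`, `f̃_i` of a crystal on the set `B`. The value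
`none : Option B` is the formal symbol `0`, and `⊥ : WithBot ℤ` is `-∞`. These are the bare maps;
the axioms are in `IsCrystal`. -/
structure CrystalData (B : Type*) where
  wt : B → Weight
  ε : ℤ → B → WithBot ℤ
  φ : ℤ → B → WithBot ℤ
  e : ℤ → B → Option B
  f : ℤ → B → Option B

/-- The axioms of a `gl_∞`-crystal. -/
structure IsCrystal {B : Type*} (C : CrystalData B) : Prop where
  phi_eq : ∀ i b, C.φ i b = ((pairing (C.wt b) i : ℤ) : WithBot ℤ) + C.ε i b
  e_spec : ∀ i b b', C.e i b = some b' →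
    C.ε i b' = C.ε i b + ((-1 : ℤ) : WithBot ℤ) ∧
    C.φ i b' = C.φ i b + ((1 : ℤ) : WithBot ℤ) ∧
    C.wt b' = C.wt b + simpleRoot i
  f_spec : ∀ i b b', C.f i b = some b' →
    C.ε i b' = C.ε i b + ((1 : ℤ) : WithBot ℤ) ∧
    C.φ i b' = C.φ i b + ((-1 : ℤ) : WithBot ℤ) ∧
    C.wt b' = C.wt b - simpleRoot i
  f_iff_e : ∀ i b b', C.f i b = some b' ↔ C.e i b' = some b
  bot : ∀ i b, C.φ i b = ⊥ → C.e i b = none ∧ C.f i b = none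

/-- A morphism of `gl_∞`-crystals, as a map `ψ : B₁ ∪ {0} → B₂ ∪ {0}`. -/
structure IsMorphism {B₁ B₂ : Type*} (C₁ : CrystalData B₁) (C₂ : CrystalData B₂)
    (ψ : Option B₁ → Option B₂) : Prop where
  map_zero : ψ none = none
  map_data : ∀ b b', ψ (some b) = some b' →
    C₂.wt b' = C₁.wt b ∧ ∀ i, C₂.ε i b' = C₁.ε i b ∧ C₂.φ i b' = C₁.φ i b
  map_e : ∀ i b, ψ (some b) ≠ none → ψ (C₁.e i b) ≠ none →
    ψ (C₁.e i b) = (ψ (some b)).bind (C₂.e i)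
  map_f : ∀ i b, ψ (some b) ≠ none → ψ (C₁.f i b) ≠ none →
    ψ (C₁.f i b) = (ψ (some b)).bind (C₂.f i)

/-- `ψ : B₁ ∪ {0} → B₂ ∪ {0}` commutes with all `ẽ_i`, `f̃_i`, where `ẽ_i 0 = f̃_i 0 = 0`. -/
def IsStrict {B₁ B₂ : Type*} (C₁ : CrystalData B₁) (C₂ : CrystalData B₂)
    (ψ : Option B₁ → Option B₂) : Prop :=
  ∀ (i : ℤ) (x : Option B₁),
    ψ (x.bind (C₁.e i)) = (ψ x).bind (C₂.e i) ∧ ψ (x.bind (C₁.f i)) = (ψ x).bind (C₂.f i)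

/-- An isomorphism of `gl_∞`-crystals: a bijective strict morphism. -/
structure IsIsomorphism {B₁ B₂ : Type*} (C₁ : CrystalData B₁) (C₂ : CrystalData B₂)
    (ψ : Option B₁ → Option B₂) : Prop where
  morphism : IsMorphism C₁ C₂ ψ
  strict : IsStrict C₁ C₂ ψ
  bijective : Function.Bijective ψ

/-- Transport of a partial operator along an injection `j : X → Y` whose image together with `0`
is stable under the operator. -/
noncomputable def induced {X Y : Type*} (j : X → Y) (op : Y → Option Y) (x : X) : Option X :=
  open Classical in
  if h : ∃ x', op (j x) = some (j x') then some h.choose else none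

/-! ### Letters and words

The letters `1 < 2 < 3 < ⋯` of `𝐁_{>0}` and the letters `-1^∨ < -2^∨ < -3^∨ < ⋯` of `𝐁_{<0}^∨`
are both represented by positive integers; the letter `-k^∨` is represented by `k`. -/

/-- The `gl_{>0}`-crystal `𝐁_{>0}`: `1 →(1) 2 →(2) 3 →(3) ⋯`, with `wt k = ε_k`. Only the operators
with index `i > 0` are meaningful. -/
noncomputable def posLetter : CrystalData ℕ+ where
  wt k := eps ⟨(k : ℤ), by have := k.pos; omega⟩
  ε i k := if 0 < i ∧ (k : ℤ) = i + 1 then 1 else 0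
  φ i k := if (k : ℤ) = i then 1 else 0
  e i k := if 0 < i ∧ (k : ℤ) = i + 1 then some (k - 1) else none
  f i k := if (k : ℤ) = i then some (k + 1) else none

/-- The `gl_{<0}`-crystal `𝐁_{<0}^∨`: `-1^∨ →(-1) -2^∨ →(-2) -3^∨ →(-3) ⋯`, with
`wt (-k^∨) = -ε_{-k}`. Only the operators with index `i < 0` are meaningful. -/
noncomputable def negLetter : CrystalData ℕ+ where
  wt k := -eps ⟨-(k : ℤ), by have := k.pos; omega⟩
  ε i k := if i < 0 ∧ (k : ℤ) = -i + 1 then 1 else 0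
  φ i k := if (k : ℤ) = -i then 1 else 0
  e i k := if i < 0 ∧ (k : ℤ) = -i + 1 then some (k - 1) else none
  f i k := if (k : ℤ) = -i then some (k + 1) else none

section Words

variable {L : Type*} (C : CrystalData L)

/-- The weight of a word `w₁ ⋯ w_r`, viewed as `w₁ ⊗ ⋯ ⊗ w_r`. -/
noncomputable def wordWt (w : List L) : Weight := (w.map C.wt).sum

/-- `ε_i(b₁ ⊗ b₂) = max (ε_i(b₁), ε_i(b₂) - ⟨wt b₁, h_i⟩)`, iterated. -/
noncomputable def wordEps (i : ℤ) : List L → WithBot ℤ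
  | [] => 0
  | a :: w => max (C.ε i a) (wordEps i w + ((-pairing (C.wt a) i : ℤ) : WithBot ℤ))

/-- `φ_i(b₁ ⊗ b₂) = max (φ_i(b₁) + ⟨wt b₂, h_i⟩, φ_i(b₂))`, iterated. -/
noncomputable def wordPhi (i : ℤ) : List L → WithBot ℤ
  | [] => 0
  | a :: w => max (C.φ i a + ((pairing (wordWt C w) i : ℤ) : WithBot ℤ)) (wordPhi i w)

/-- `ẽ_i(b₁ ⊗ b₂)` is `ẽ_i b₁ ⊗ b₂` if `φ_i(b₁) ≥ ε_i(b₂)` and `b₁ ⊗ ẽ_i b₂` otherwise. -/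
noncomputable def wordE (i : ℤ) : List L → Option (List L)
  | [] => none
  | a :: w =>
    if wordEps C i w ≤ C.φ i a then (C.e i a).map (fun a' => a' :: w)
    else (wordE i w).map (fun w' => a :: w')

/-- `f̃_i(b₁ ⊗ b₂)` is `f̃_i b₁ ⊗ b₂` if `φ_i(b₁) > ε_i(b₂)` and `b₁ ⊗ f̃_i b₂` otherwise. -/
noncomputable def wordF (i : ℤ) : List L → Option (List L)
  | [] => none
  | a :: w =>
    if wordEps C i w < C.φ i a then (C.f i a).map (fun a' => a' :: w)
    else (wordF i w).map (fun w' => a :: w')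

end Words

/-! ### The crystal of matrices -/

/-- The set `ℳ` of `ℕ × ℕ` matrices `A = (a_{-i^∨, j})_{i, j ≥ 1}` of finite support with
non-negative integer entries; `A (i, j)` is `a_{-i^∨, j}`. -/
abbrev Mat : Type := ℕ+ × ℕ+ →₀ ℕ

/-- The order on `𝐁_{<0}^∨ × 𝐁_{>0}` used for `Ω`: `(i, j) < (k, l)` iff `j < l`, or `j = l` and
`i > k`. -/
def leΩ (p q : ℕ+ × ℕ+) : Prop := p.2 < q.2 ∨ (p.2 = q.2 ∧ q.1 ≤ p.1)

/-- The order on `𝐁_{<0}^∨ × 𝐁_{>0}` used for `Ω'`: `(i, j) <' (k, l)` iff `i < k`, or `i = k` and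
`j > l`. -/
def leΩ' (p q : ℕ+ × ℕ+) : Prop := p.1 < q.1 ∨ (p.1 = q.1 ∧ q.2 ≤ p.2)

instance : DecidableRel leΩ := fun p q => by unfold leΩ; infer_instance
instance : DecidableRel leΩ' := fun p q => by unfold leΩ'; infer_instance

instance : IsTrans (ℕ+ × ℕ+) leΩ := ⟨fun a b c => by unfold leΩ; grind⟩
instance : Std.Antisymm leΩ := ⟨fun a b => by unfold leΩ; grind⟩
instance : Std.Total leΩ := ⟨fun a b => by unfold leΩ; grind⟩
instance : IsTrans (ℕ+ × ℕ+) leΩ' := ⟨fun a b c => by unfold leΩ'; grind⟩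
instance : Std.Antisymm leΩ' := ⟨fun a b => by unfold leΩ'; grind⟩
instance : Std.Total leΩ' := ⟨fun a b => by unfold leΩ'; grind⟩

/-- The unique `(𝐢, 𝐣) ∈ Ω` with `A = A(𝐢, 𝐣)`, as the list of pairs `(i₁, j₁), …, (i_r, j_r)`. -/
noncomputable def seqΩ (A : Mat) : List (ℕ+ × ℕ+) := (Finsupp.toMultiset A).sort leΩ

/-- The unique `(𝐤, 𝐥) ∈ Ω'` with `A = A(𝐤, 𝐥)`, as a list of pairs. -/
noncomputable def seqΩ' (A : Mat) : List (ℕ+ × ℕ+) := (Finsupp.toMultiset A).sort leΩ'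

/-- The matrix `A(𝐢, 𝐣)` of a pair of words of the same length: its entry at `(-i^∨, j)` is the
number of `k` such that `(i_k, j_k) = (-i^∨, j)`. -/
noncomputable def matOf (u v : List ℕ+) : Mat :=
  Multiset.toFinsupp (List.zip u v : Multiset (ℕ+ × ℕ+))

/-- The word `𝐢` of `A`, for `(𝐢, 𝐣) ∈ Ω`. -/
noncomputable def wordI (A : Mat) : List ℕ+ := (seqΩ A).map Prod.fst
/-- The word `𝐣` of `A`, for `(𝐢, 𝐣) ∈ Ω`. -/
noncomputable def wordJ (A : Mat) : List ℕ+ := (seqΩ A).map Prod.snd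
/-- The word `𝐤` of `A`, for `(𝐤, 𝐥) ∈ Ω'`. -/
noncomputable def wordK (A : Mat) : List ℕ+ := (seqΩ' A).map Prod.fst
/-- The word `𝐥` of `A`, for `(𝐤, 𝐥) ∈ Ω'`. -/
noncomputable def wordL (A : Mat) : List ℕ+ := (seqΩ' A).map Prod.snd

/-- `wt(A) = ∑ a_{-i^∨, j} (-ε_{-i} + ε_j)`. -/
noncomputable def matWt (A : Mat) : Weight :=
  A.sum fun p a => a • (negLetter.wt p.1 + posLetter.wt p.2)

/-- The `gl_∞`-crystal structure on `ℳ`: for `i < 0`, the operators act on the word `𝐢` of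
`(𝐢, 𝐣) ∈ Ω`; for `i > 0`, on the word `𝐥` of `(𝐤, 𝐥) ∈ Ω'`; and `ẽ_0`, `f̃_0` decrease and
increase the entry `a_{-1^∨, 1}` by one. -/
noncomputable def matCrystal : CrystalData Mat where
  wt := matWt
  ε i A :=
    if i < 0 then wordEps negLetter i (wordI A)
    else if i = 0 then ((A (1, 1) : ℤ) : WithBot ℤ)
    else wordEps posLetter i (wordL A)
  φ i A :=
    if i < 0 then wordPhi negLetter i (wordI A)
    else if i = 0 then ((pairing (matWt A) 0 + (A (1, 1) : ℤ) : ℤ) : WithBot ℤ)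
    else wordPhi posLetter i (wordL A)
  e i A :=
    if i < 0 then (wordE negLetter i (wordI A)).map fun u => matOf u (wordJ A)
    else if i = 0 then
      if A (1, 1) ≠ 0 then some (A - Finsupp.single (1, 1) 1) else none
    else (wordE posLetter i (wordL A)).map fun v => matOf (wordK A) v
  f i A :=
    if i < 0 then (wordF negLetter i (wordI A)).map fun u => matOf u (wordJ A)
    else if i = 0 then some (A + Finsupp.single (1, 1) 1)
    else (wordF posLetter i (wordL A)).map fun v => matOf (wordK A) v

/-! ### Tableaux of anti-normal shape and insertion -/

section Tableaux

variable {𝒜 : Type*} [LinearOrder 𝒜]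

/-- `T` is a semistandard tableau of anti-normal shape `ν^π` (a Young diagram rotated by `180°`).
`T` is the list of its columns enumerated from right to left, each column being the list of its
entries from top to bottom. All columns of `ν^π` end at the same bottom row, so the entries of two
columns in the same row are those at the same position counted from the bottom. -/
structure IsAntiSST (T : List (List 𝒜)) : Prop where
  /-- only the non-empty columns are listed -/
  nonempty : ∀ c ∈ T, c ≠ []
  /-- entries strictly increase down each column -/
  column : ∀ c ∈ T, c.Pairwise (· < ·)
  /-- columns do not get longer towards the left -/
  shape : ∀ (k : ℕ) (c d : List 𝒜), T[k]? = some c → T[k + 1]? = some d → d.length ≤ c.length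
  /-- entries weakly increase from left to right in each row -/
  row : ∀ (k : ℕ) (c d : List 𝒜), T[k]? = some c → T[k + 1]? = some d →
    ∀ (j : ℕ) (x y : 𝒜), c.reverse[j]? = some x → d.reverse[j]? = some y → y ≤ x

/-- The shape `ν^π` of a tableau, recorded as the list of its column lengths from right to left,
that is, as the conjugate partition `ν'`. -/
def shape (T : List (List 𝒜)) : List ℕ := T.map List.length

/-- The word `w(T)`: the entries of `T` row by row from top to bottom, from right to left in each
row. -/
def readingWord (T : List (List 𝒜)) : List 𝒜 :=
  (List.range (T.headD []).length).reverse.flatMap fun j => T.filterMap fun c => c.reverse[j]?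

/-- The insertion `T ← a`: let `a'` be the largest entry `≤ a` of the right-most column. If there is
none, put `a` on top of the column and stop; otherwise replace `a'` by `a` and insert `a'` into the
next column (to the left) in the same way. -/
def insertLetter (a : 𝒜) : List (List 𝒜) → List (List 𝒜)
  | [] => [[a]]
  | c :: T =>
    match (c.filter (fun x => x ≤ a)).max? with
    | none => (a :: c) :: T
    | some a' => c.replace a' a :: insertLetter a' T

/-- `𝐏(w) = (⋯((w₁ ← w₂) ← w₃) ⋯) ← w_r`. -/
def insertionTableau (w : List 𝒜) : List (List 𝒜) := w.foldl (fun T a => insertLetter a T) []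

end Tableaux

/-- `𝒯`: the pairs `(S, T)` of semistandard tableaux of the same anti-normal shape, `S` with letters
in `𝐁_{<0}^∨` and `T` with letters in `𝐁_{>0}`. -/
abbrev Bitableau : Type :=
  {p : List (List ℕ+) × List (List ℕ+) //
    IsAntiSST p.1 ∧ IsAntiSST p.2 ∧ shape p.1 = shape p.2}

/-- `𝐏(A) = 𝐏(𝐢_rev)`. -/
noncomputable def tabP (A : Mat) : List (List ℕ+) := insertionTableau (wordI A).reverse

/-- `𝐐(A) = 𝐏(𝐥_rev)`. -/
noncomputable def tabQ (A : Mat) : List (List ℕ+) := insertionTableau (wordL A).reverse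

/-! ### The `0`-signature of a bitableau -/

/-- The signs `+`, `-`, `·`. -/
inductive Sgn
  | plus | minus | dot
  deriving DecidableEq

/-- The sign of a pair of columns. The smallest entry of a column is its top entry. -/
def columnSign (s t : List ℕ+) : Sgn :=
  match s.head?, t.head? with
  | some a, some b =>
    if 1 < a ∧ 1 < b then .plus else if a = 1 ∧ b = 1 then .minus else .dot
  | _, _ => .plus

/-- The signs `σ₁, σ₂, …, σ_{n+1}` of the columns, enumerated from right to left, where `n` is the
number of non-empty columns. All later signs in the infinite sequence `(…, σ₂, σ₁)` are `+`;
having no `-` to their left, they and `σ_{n+1}` are never cancelled. -/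
def signs (p : List (List ℕ+) × List (List ℕ+)) : List Sgn :=
  (List.range (p.1.length + 1)).map fun k => columnSign (p.1.getD k []) (p.2.getD k [])

/-- Cancellation of pairs `(-, +)` with `-` to the left of `+` and only `·` in between, in a sequence
of signs written from left to right, as far as possible. A new `-` on the left of an already
reduced sequence is cancelled with the left-most remaining `+`, if there is one. -/
def cancel : List Sgn → List Sgn
  | [] => []
  | .minus :: σ =>
    if Sgn.plus ∈ cancel σ then .dot :: (cancel σ).replace .plus .dot else .minus :: cancel σ
  | s :: σ => s :: cancel σ

/-- The `0`-signature, enumerated from right to left (as the columns are). -/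
def zeroSignature (p : List (List ℕ+) × List (List ℕ+)) : List Sgn :=
  (cancel (signs p).reverse).reverse

/-- The `0`-good `-` sign: the (0-based, counted from the right) number of the column of the
left-most `-` in the `0`-signature. -/
def goodMinus (p : List (List ℕ+) × List (List ℕ+)) : Option ℕ :=
  ((List.range (p.1.length + 1)).filter fun k => (zeroSignature p)[k]? = some .minus).getLast?

/-- The `0`-good `+` sign: the (0-based, counted from the right) number of the column of the
right-most `+` in the `0`-signature. -/
def goodPlus (p : List (List ℕ+) × List (List ℕ+)) : Option ℕ :=
  ((List.range (p.1.length + 1)).filter fun k => (zeroSignature p)[k]? = some .plus).head?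

/-- Remove the top entry of column `k`. -/
def removeTop (k : ℕ) (T : List (List ℕ+)) : List (List ℕ+) :=
  (T.modify k List.tail).filter (fun c => c ≠ [])

/-- Add the smallest letter on top of column `k`, where `k` may be the first empty column. -/
def addTop (k : ℕ) (T : List (List ℕ+)) : List (List ℕ+) :=
  if k < T.length then T.modify k (fun c => 1 :: c) else T ++ [[1]]

/-- `ẽ_0 (S, T)`: remove `-1^∨` and `1` from the columns of the `0`-good `-` sign. -/
def zeroE (p : List (List ℕ+) × List (List ℕ+)) :
    Option (List (List ℕ+) × List (List ℕ+)) :=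
  (goodMinus p).map fun k => (removeTop k p.1, removeTop k p.2)

/-- `f̃_0 (S, T)`: add `-1^∨` and `1` on top of the columns of the `0`-good `+` sign. -/
def zeroF (p : List (List ℕ+) × List (List ℕ+)) :
    Option (List (List ℕ+) × List (List ℕ+)) :=
  (goodPlus p).map fun k => (addTop k p.1, addTop k p.2)

/-! ### The crystal of bitableaux -/

/-- `(S, T) ↦ (sh S, w(S), w(T))`, an injection. -/
def readings (p : Bitableau) : List ℕ × List ℕ+ × List ℕ+ :=
  (shape p.1.1, readingWord p.1.1, readingWord p.1.2)

/-- `wt (S, T) = wt S + wt T`. -/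
noncomputable def bitabWt (p : Bitableau) : Weight :=
  wordWt negLetter (readingWord p.1.1) + wordWt posLetter (readingWord p.1.2)

/-- The number of `-` signs in the `0`-signature, which is the number of times that `ẽ_0` can be
applied. -/
def bitabEps0 (p : Bitableau) : ℤ := ((zeroSignature p.1).count Sgn.minus : ℤ)

/-- The `gl_∞`-crystal structure on `𝒯`: for `i < 0` the operators act on `S` through the word `w(S)`,
for `i > 0` on `T` through the word `w(T)`, keeping the shape; `ẽ_0` and `f̃_0` are given by the
`0`-signature. -/
noncomputable def bitabCrystal : CrystalData Bitableau where
  wt := bitabWt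
  ε i p :=
    if i < 0 then wordEps negLetter i (readingWord p.1.1)
    else if i = 0 then ((bitabEps0 p : ℤ) : WithBot ℤ)
    else wordEps posLetter i (readingWord p.1.2)
  φ i p :=
    if i < 0 then wordPhi negLetter i (readingWord p.1.1)
    else if i = 0 then ((pairing (bitabWt p) 0 + bitabEps0 p : ℤ) : WithBot ℤ)
    else wordPhi posLetter i (readingWord p.1.2)
  e i :=
    if i < 0 then
      induced readings fun x => (wordE negLetter i x.2.1).map fun u => (x.1, u, x.2.2)
    else if i = 0 then induced Subtype.val zeroE
    else induced readings fun x => (wordE posLetter i x.2.2).map fun v => (x.1, x.2.1, v)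
  f i :=
    if i < 0 then
      induced readings fun x => (wordF negLetter i x.2.1).map fun u => (x.1, u, x.2.2)
    else if i = 0 then induced Subtype.val zeroF
    else induced readings fun x => (wordF posLetter i x.2.2).map fun v => (x.1, x.2.1, v)

end GlInf

namespace GlInf

/-! ### The word crystal over the positive integers -/

/-! Since `-k^∨` is encoded by `k`, the index `-n` acts on letters exactly as the index `n` does
(`isLetter_neg`, `isLetter_pos`), and transposing a matrix exchanges the words 𝐢 and 𝐥. So every
statement for negative indices is the one for positive indices applied to `matT A`, and κ sends `A`
to the pair `tabOf (wordL (matT A))`, `tabOf (wordL A)`.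

Non-zero indices, tableaux. If inserting `a` into a column `c` leaves `c'` and bumps `a'`, then the
words `a c` and `c' a'` have the same ε and φ, and the lowering operators correspond (`Bump.ep_eq`,
`Bump.fstep`). Column by column this makes a word equivalent to the column word of its tableau, with
lowering preserving the shape (`FStep.tabOf`). Conversely the reading word of a tableau inserts to
that tableau (`IsAntiSST.tabOf_readingWord`), and lowering a reading word gives a reading word of
the same shape (`IsAntiSST.fstep_readingWord`).

Non-zero indices, matrices. Operators on rows and on columns interact only inside a 2×2 block of
entries, where a direct computation shows that they commute (`MStep.comm`) and do not see each
other's ε (`MStep.ep_wordL`). A tableau of highest weight has columns `1, …, l`, so it is determined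
by its content as well as by its shape. Raising to highest weight therefore shows that column
operators leave the tableau of `wordL` unchanged (`MStep.tabOf_wordL`). Every matrix is reached from
one that is of highest weight for both families (`step_induction`), and such a matrix is diagonal.
This reduces equality of shapes, injectivity and surjectivity of κ to diagonal matrices.

Index 0. Let `S₀` be the first tableau of `A` with its first column deleted. The first tableau `S`
of `A` arises from `S₀` by inserting an increasing word with `A (1, 1)` letters 1, and adding a unit
at `(1, 1)` puts one further 1 in front of that word. Follow the inserted word through the columns
from right to left: a sign `-` means that one 1 is left behind, a `+` that one more 1 is carried on
or, when none is carried, that an extra 1 would come to rest there. Hence the extra 1 settles in the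
column of the right-most uncancelled `+` (`insertWord_one_cons`). Deleting the letters 1 from the
second tableau `T` gives the second tableau of the reduced matrix (`removesOne_tabOf`). By equality
of shapes, a column of `T` contains a 1 exactly when that column of `S` is longer than in `S₀`. This
identifies the signs with those of the 0-signature and puts the new 1 of `T` in the same column
(`zero_operators`).

The crystal axioms are checked on matrices only and carried to bitableaux along the bijection κ
(`isCrystal_of_bijective`). -/

/-- The value `ε` of the index `n` on a word of positive integers. -/
def ep (n : ℕ+) : List ℕ+ → ℕ
  | [] => 0
  | a :: w => (if a = n + 1 then 1 else 0) + (ep n w - if a = n then 1 else 0)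

/-- The value `φ` of the index `n` on a word of positive integers. -/
def ph (n : ℕ+) : List ℕ+ → ℕ
  | [] => 0
  | a :: w => ph n w + ((if a = n then 1 else 0) - ep n w)

/-- The lowering operator of index `n` changes the word `w` to `w'`. -/
def FStep (n : ℕ+) (w w' : List ℕ+) : Prop :=
  ∃ u v, w = u ++ n :: v ∧ w' = u ++ (n + 1) :: v ∧ ep n v = 0 ∧ ph n u = 0

@[simp] lemma ep_nil (n : ℕ+) : ep n [] = 0 := rfl
@[simp] lemma ph_nil (n : ℕ+) : ph n [] = 0 := rfl
lemma ep_cons (n a : ℕ+) (w : List ℕ+) :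
    ep n (a :: w) = (if a = n + 1 then 1 else 0) + (ep n w - if a = n then 1 else 0) := rfl
lemma ph_cons (n a : ℕ+) (w : List ℕ+) :
    ph n (a :: w) = ph n w + ((if a = n then 1 else 0) - ep n w) := rfl

@[simp] lemma pnat_ne_add_one (n : ℕ+) : n ≠ n + 1 := by
  intro h
  have := congrArg PNat.val h
  simp at this

@[simp] lemma pnat_add_one_ne (n : ℕ+) : n + 1 ≠ n := (pnat_ne_add_one n).symm

/-- The relation φ - ε = ⟨wt, h⟩, written additively so that it stays in ℕ. -/
lemma ph_add_count (n : ℕ+) (w : List ℕ+) :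
    ph n w + w.count (n + 1) = ep n w + w.count n := by
  induction w with
  | nil => simp
  | cons a w ih =>
    have := pnat_ne_add_one n
    rw [ep_cons, ph_cons, List.count_cons, List.count_cons]
    by_cases h1 : a = n
    · subst h1; simp [this]; omega
    · by_cases h2 : a = n + 1
      · subst h2; simp [this.symm]; omega
      · simp [h1, h2]; omega

/-- Bracketing rule: each letter `n` cancels a letter `n + 1` to its right, so the uncancelled `n`
of `u` absorb uncancelled `n + 1` of `v`. The truncated subtraction plays the role of the maximum in
the tensor product rule. -/
lemma ep_append (n : ℕ+) (u v : List ℕ+) : ep n (u ++ v) = ep n u + (ep n v - ph n u) := by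
  induction u with
  | nil => simp
  | cons a u ih => rw [List.cons_append, ep_cons, ep_cons, ph_cons, ih]; omega

lemma ph_append (n : ℕ+) (u v : List ℕ+) : ph n (u ++ v) = ph n v + (ph n u - ep n v) := by
  induction u with
  | nil => simp
  | cons a u ih => rw [List.cons_append, ph_cons, ph_cons, ep_append, ih]; omega

lemma ep_le_count (n : ℕ+) (w : List ℕ+) : ep n w ≤ w.count (n + 1) := by
  induction w with
  | nil => simp
  | cons a u ih => rw [ep_cons, List.count_cons]; simp; split_ifs <;> omega

lemma ph_le_count (n : ℕ+) (w : List ℕ+) : ph n w ≤ w.count n := by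
  have := ph_add_count n w; have := ep_le_count n w; omega

lemma ep_singleton (n a : ℕ+) : ep n [a] = if a = n + 1 then 1 else 0 := by simp [ep_cons]
lemma ph_singleton (n a : ℕ+) : ph n [a] = if a = n then 1 else 0 := by simp [ph_cons]

/-! ### Lowering steps on words: tensor rule, determinism, injectivity, existence. -/

namespace FStep

variable {n : ℕ+} {u v w w' w'' u' v' : List ℕ+}

lemma length_eq (h : FStep n w w') : w'.length = w.length := by
  obtain ⟨u, v, rfl, rfl, -, -⟩ := h; simp

lemma ep_eq (h : FStep n w w') : ep n w' = ep n w + 1 := by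
  obtain ⟨u, v, rfl, rfl, h1, h2⟩ := h
  rw [ep_append, ep_append, ep_cons, ep_cons, h1, h2]; simp [pnat_ne_add_one]

lemma ph_eq (h : FStep n w w') : ph n w = ph n w' + 1 := by
  obtain ⟨u, v, rfl, rfl, h1, h2⟩ := h
  rw [ph_append, ph_append, ph_cons, ph_cons, h1, h2]; simp [pnat_add_one_ne]

lemma left (h : FStep n u u') (hv : ep n v < ph n u) : FStep n (u ++ v) (u' ++ v) := by
  obtain ⟨a, b, rfl, rfl, h1, h2⟩ := h
  refine ⟨a, b ++ v, by simp, by simp, ?_, h2⟩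
  rw [ph_append, ph_cons, h1, h2] at hv
  simp at hv
  rw [ep_append]; omega

lemma right (h : FStep n v v') (hu : ph n u ≤ ep n v) : FStep n (u ++ v) (u ++ v') := by
  obtain ⟨a, b, rfl, rfl, h1, h2⟩ := h
  refine ⟨u ++ a, b, by simp, by simp, h1, ?_⟩
  rw [ep_append, ep_cons, h1] at hu
  simp at hu
  rw [ph_append]; omega

/-- The two cases of the tensor product rule for `f̃`, read off from the position of the changed
letter. -/
lemma append_cases (h : FStep n (u ++ v) w) :
    (∃ u', w = u' ++ v ∧ FStep n u u' ∧ ep n v < ph n u) ∨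
    (∃ v', w = u ++ v' ∧ FStep n v v' ∧ ph n u ≤ ep n v) := by
  obtain ⟨a, b, h, rfl, h1, h2⟩ := h
  rcases List.append_eq_append_iff.1 h with ⟨c, rfl, h3⟩ | ⟨c, rfl, h3⟩
  · right
    subst h3
    refine ⟨c ++ (n + 1) :: b, by simp, ⟨c, b, rfl, rfl, h1, ?_⟩, ?_⟩
    · rw [ph_append] at h2; omega
    · rw [ph_append] at h2
      rw [ep_append]; omega
  · rcases List.cons_eq_append_iff.1 h3 with ⟨rfl, rfl⟩ | ⟨d, rfl, rfl⟩
    · right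
      refine ⟨(n + 1) :: b, by simp, ⟨[], b, rfl, rfl, h1, rfl⟩, ?_⟩
      simp [h2]
    · left
      rw [ep_append] at h1
      refine ⟨a ++ (n + 1) :: d, by simp, ⟨a, d, rfl, rfl, by omega, h2⟩, ?_⟩
      rw [ph_append, ph_cons, h2]; simp; omega

lemma unique (h : FStep n w w') (h' : FStep n w w'') : w' = w'' := by
  induction w generalizing w' w'' with
  | nil => obtain ⟨u, v, h, -⟩ := h; simp at h
  | cons a w ih =>
    rw [← List.singleton_append] at h h'
    rcases h.append_cases with ⟨x, rfl, h1, h2⟩ | ⟨x, rfl, h1, h2⟩ <;>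
    rcases h'.append_cases with ⟨y, rfl, h3, h4⟩ | ⟨y, rfl, h3, h4⟩
    · obtain ⟨u, v, e1, rfl, -⟩ := h1
      obtain ⟨u', v', e2, rfl, -⟩ := h3
      rcases u with _ | ⟨_, _ | _⟩ <;> rcases u' with _ | ⟨_, _ | _⟩ <;> simp_all
    · omega
    · omega
    · rw [ih h1 h3]

/-- Lowering is injective: the letter created is the right-most uncancelled `n + 1` of the result,
so its position is determined. -/
lemma unique_left (h : FStep n w w'') (h' : FStep n w' w'') : w = w' := by
  induction w'' generalizing w w' with
  | nil => obtain ⟨u, v, -, h, -⟩ := h; simp at h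
  | cons a s ih =>
    obtain ⟨u, v, rfl, h1, h2, h3⟩ := h
    obtain ⟨u', v', rfl, h1', h2', h3'⟩ := h'
    rcases u with _ | ⟨b, u⟩ <;> rcases u' with _ | ⟨b', u'⟩
    · simp_all
    · simp only [List.nil_append, List.cons.injEq, List.cons_append] at h1 h1'
      obtain ⟨rfl, rfl⟩ := h1
      obtain ⟨rfl, rfl⟩ := h1'
      -- If one step acts at the head and the other further right, the letter `n + 1` created by the
      -- latter is an uncancelled letter of the tail, contradicting that the tail has ε equal to 0.
      rw [ep_append, ep_cons] at h2; simp at h2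
      rw [ph_cons] at h3'; simp at h3'
      omega
    · simp only [List.nil_append, List.cons.injEq, List.cons_append] at h1 h1'
      obtain ⟨rfl, rfl⟩ := h1
      obtain ⟨rfl, rfl⟩ := h1'
      rw [ep_append, ep_cons] at h2'; simp at h2'
      rw [ph_cons] at h3; simp at h3
      omega
    · simp only [List.cons.injEq, List.cons_append] at h1 h1' ⊢
      obtain ⟨rfl, rfl⟩ := h1
      obtain ⟨rfl, h1'⟩ := h1'
      refine ⟨rfl, ih ⟨u, v, rfl, rfl, h2, ?_⟩ ⟨u', v', rfl, h1', h2', ?_⟩⟩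
      · rw [ph_cons] at h3; omega
      · rw [ph_cons] at h3'; omega

lemma exists_of_ph_pos (h : 0 < ph n w) : ∃ w', FStep n w w' := by
  induction w with
  | nil => simp at h
  | cons a w ih =>
    by_cases hw : a = n ∧ ep n w = 0
    · obtain ⟨rfl, h2⟩ := hw
      exact ⟨(a + 1) :: w, [], w, rfl, rfl, h2, rfl⟩
    · have h1 : ph n [a] ≤ ep n w := by
        rw [ph_singleton]; split_ifs with h1 <;> [skip; omega]
        have : ep n w ≠ 0 := fun h2 => hw ⟨h1, h2⟩
        omega
      rw [ph_singleton] at h1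
      rw [ph_cons] at h
      obtain ⟨w', hw'⟩ := ih (by omega)
      exact ⟨a :: w', hw'.right (u := [a]) (by rw [ph_singleton]; omega)⟩

lemma exists_of_ep_pos (h : 0 < ep n w) : ∃ w', FStep n w' w := by
  induction w with
  | nil => simp at h
  | cons a w ih =>
    by_cases hw : ep n w ≤ if a = n then 1 else 0
    · rw [ep_cons] at h
      have ha : a = n + 1 := by by_contra hne; simp [hne] at h; omega
      subst ha
      simp [pnat_add_one_ne] at hw
      exact ⟨n :: w, [], w, rfl, rfl, hw, rfl⟩
    · obtain ⟨w', hw'⟩ := ih (by omega)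
      refine ⟨a :: w', hw'.right (u := [a]) ?_⟩
      have := hw'.ep_eq
      rw [ph_singleton]; omega

lemma sum_eq (h : FStep n w w') :
    (w'.map PNat.val).sum = (w.map PNat.val).sum + 1 := by
  obtain ⟨u, v, rfl, rfl, -, -⟩ := h
  simp; omega

end FStep

/-! ### Comparison with the tensor product rule -/

/-- The data of index `i` of the crystal `C` are those of the word crystal of index `n`. -/
structure IsLetter (C : CrystalData ℕ+) (i : ℤ) (n : ℕ+) : Prop where
  eps : ∀ a, C.ε i a = (((if a = n + 1 then 1 else 0 : ℕ) : ℤ) : WithBot ℤ)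
  phi : ∀ a, C.φ i a = (((if a = n then 1 else 0 : ℕ) : ℤ) : WithBot ℤ)
  pair : ∀ a, pairing (C.wt a) i = (if a = n then 1 else 0) - (if a = n + 1 then 1 else 0)
  e : ∀ a, C.e i a = if a = n + 1 then some n else none
  f : ∀ a, C.f i a = if a = n then some (n + 1) else none

lemma pairing_add (μ ν : Weight) (i : ℤ) : pairing (μ + ν) i = pairing μ i + pairing ν i := by
  simp only [pairing, Prod.fst_add, Prod.snd_add, Finsupp.add_apply]; split_ifs <;> ring

@[simp] lemma pairing_zero (i : ℤ) : pairing 0 i = 0 := by simp [pairing]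

lemma pnat_cast_eq_add_one (a n : ℕ+) : ((a : ℕ) : ℤ) = (n : ℕ) + 1 ↔ a = n + 1 := by
  rw [← PNat.coe_inj, PNat.add_coe, PNat.one_coe]; omega

lemma pnat_cast_eq (a n : ℕ+) : ((a : ℕ) : ℤ) = (n : ℕ) ↔ a = n := by
  rw [← PNat.coe_inj]; omega

lemma pnat_add_sub_one (n : ℕ+) : n + 1 - 1 = n := by
  apply PNat.eq; rw [PNat.sub_coe]; simp

lemma isLetter_pos (n : ℕ+) : IsLetter posLetter (n : ℕ) n where
  eps a := by simp only [posLetter, pnat_cast_eq_add_one]; split_ifs <;> simp_all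
  phi a := by simp only [posLetter, pnat_cast_eq]; split_ifs <;> simp_all
  pair a := by
    have hn := n.pos
    have h0 : ¬ ((n : ℕ) : ℤ) < 0 := by omega
    simp only [pairing, posLetter, eps, leftIdx, rightIdx, dif_neg h0, Finsupp.single_apply]
    simp [pnat_cast_eq_add_one]
  e a := by
    simp only [posLetter, pnat_cast_eq_add_one]
    split_ifs with h1 h2 h2
    · rw [h2, pnat_add_sub_one]
    · exact absurd h1.2 h2
    · exact absurd ⟨by have := n.pos; omega, h2⟩ h1
    · rfl
  f a := by
    simp only [posLetter, pnat_cast_eq]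
    split_ifs with h1
    · rw [h1]
    · rfl

lemma isLetter_neg (n : ℕ+) : IsLetter negLetter (-((n : ℕ) : ℤ)) n where
  eps a := by simp only [negLetter, neg_neg, pnat_cast_eq_add_one]; split_ifs <;> simp_all
  phi a := by simp only [negLetter, neg_neg, pnat_cast_eq]; split_ifs <;> simp_all
  pair a := by
    have hn := n.pos
    have h : ∀ a : ℕ+, -((a : ℕ) : ℤ) = -((n : ℕ) : ℤ) - 1 ↔ a = n + 1 := by
      intro a; rw [← pnat_cast_eq_add_one]; omega
    have h0 : ¬ 0 < -((n : ℕ) : ℤ) := by omega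
    have h1 : -((n : ℕ) : ℤ) < 0 := by omega
    simp only [pairing, negLetter, eps, leftIdx, rightIdx, dif_neg h0, dif_pos h1]
    simp only [Finsupp.single_apply, Prod.fst_neg, Finsupp.neg_apply, Subtype.mk.injEq, h, neg_inj,
      pnat_cast_eq]
    simp
    ring
  e a := by
    simp only [negLetter, neg_neg, pnat_cast_eq_add_one]
    split_ifs with h1 h2 h2
    · rw [h2, pnat_add_sub_one]
    · exact absurd h1.2 h2
    · exact absurd ⟨by have := n.pos; omega, h2⟩ h1
    · rfl
  f a := by
    simp only [negLetter, neg_neg, pnat_cast_eq]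
    split_ifs with h1
    · rw [h1]
    · rfl

namespace IsLetter

variable {C : CrystalData ℕ+} {i : ℤ} {n : ℕ+} (h : IsLetter C i n)
include h

/-- Truncated subtraction is a maximum with 0, and `⟨wt a, h_i⟩ = [a = n] - [a = n + 1]`; so the
recursion for `ep` is the tensor product formula, and the value `-∞` never occurs. -/
lemma wordEps_eq (w : List ℕ+) : wordEps C i w = ((ep n w : ℤ) : WithBot ℤ) := by
  induction w with
  | nil => simp [wordEps]
  | cons a w ih =>
    rw [wordEps, ih, h.eps, h.pair, ep_cons, ← WithBot.coe_add, ← WithBot.coe_max]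
    have := pnat_ne_add_one n
    congr 1
    split_ifs with h1 h2 h2 <;> [(exact absurd (h1.symm.trans h2) (by simp)); skip; skip; skip] <;> omega

lemma pairing_wordWt (w : List ℕ+) :
    pairing (wordWt C w) i = (w.count n : ℤ) - w.count (n + 1) := by
  induction w with
  | nil => simp [wordWt]
  | cons a w ih =>
    rw [wordWt, List.map_cons, List.sum_cons, pairing_add, ← wordWt, ih, h.pair,
      List.count_cons, List.count_cons]
    push_cast
    simp; ring

lemma wordPhi_eq (w : List ℕ+) : wordPhi C i w = ((ph n w : ℤ) : WithBot ℤ) := by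
  induction w with
  | nil => simp [wordPhi]
  | cons a w ih =>
    rw [wordPhi, ih, h.phi, h.pairing_wordWt, ph_cons, ← WithBot.coe_add, ← WithBot.coe_max]
    have := ph_add_count n w
    congr 1
    split_ifs <;> omega

lemma wordF_eq_some_iff (w w' : List ℕ+) : wordF C i w = some w' ↔ FStep n w w' := by
  induction w generalizing w' with
  | nil => simp [wordF, FStep]
  | cons a w ih =>
    rw [wordF, h.wordEps_eq, h.phi, h.f]
    simp only [WithBot.coe_lt_coe, Nat.cast_lt]
    constructor
    · intro hw
      by_cases hc : ep n w < if a = n then 1 else 0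
      · rw [if_pos hc] at hw
        split_ifs at hw hc with ha
        · simp at hw; subst hw ha
          exact ⟨[], w, rfl, rfl, by omega, rfl⟩
        · omega
      · rw [if_neg hc] at hw
        obtain ⟨x, hx, rfl⟩ := Option.map_eq_some_iff.1 hw
        exact ((ih x).1 hx).right (u := [a]) (by rw [ph_singleton]; omega)
    · intro hw
      rw [← List.singleton_append] at hw
      rcases hw.append_cases with ⟨x, rfl, h1, h2⟩ | ⟨x, rfl, h1, h2⟩
      · rw [ph_singleton] at h2
        rw [if_pos h2]
        obtain ⟨u, v, e1, rfl, -⟩ := h1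
        rcases u with _ | ⟨_, _ | _⟩ <;> simp_all
      · rw [ph_singleton] at h2
        rw [if_neg (by omega), (ih x).2 h1]; rfl

lemma wordE_eq_some_iff (w w' : List ℕ+) : wordE C i w = some w' ↔ FStep n w' w := by
  induction w generalizing w' with
  | nil => simp [wordE, FStep]
  | cons a w ih =>
    rw [wordE, h.wordEps_eq, h.phi, h.e]
    simp only [WithBot.coe_le_coe, Nat.cast_le]
    constructor
    · intro hw
      by_cases hc : ep n w ≤ if a = n then 1 else 0
      · rw [if_pos hc] at hw
        by_cases ha : a = n + 1
        · subst ha; simp at hw; subst hw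
          simp at hc
          exact ⟨[], w, rfl, rfl, hc, rfl⟩
        · rw [if_neg ha] at hw; simp at hw
      · rw [if_neg hc] at hw
        obtain ⟨x, hx, rfl⟩ := Option.map_eq_some_iff.1 hw
        have h1 := (ih x).1 hx
        have h3 := h1.ep_eq
        exact h1.right (u := [a]) (by rw [ph_singleton]; omega)
    · rintro ⟨u, v, rfl, h1, h2, h3⟩
      rcases u with _ | ⟨b, u⟩
      · simp at h1; obtain ⟨rfl, rfl⟩ := h1
        simp [h2]
      · simp at h1; obtain ⟨rfl, rfl⟩ := h1
        have h4 : FStep n (u ++ n :: v) (u ++ (n + 1) :: v) :=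
          ⟨u, v, rfl, rfl, h2, by rw [ph_cons] at h3; omega⟩
        rw [if_neg, (ih _).2 h4]
        · rfl
        · rw [h4.ep_eq]
          rw [ph_cons] at h3
          rw [ep_append, ep_cons]
          omega

end IsLetter

/-! ### Strictly increasing columns -/

abbrev Strict (c : List ℕ+) : Prop := c.Pairwise (· < ·)

lemma Strict.ext {c d : List ℕ+} (hc : Strict c) (hd : Strict d) (h : ∀ x, x ∈ c ↔ x ∈ d) :
    c = d :=
  List.Perm.eq_of_pairwise (le := (· < ·)) (fun _ _ _ _ h1 h2 => absurd h1 h2.asymm) hc hd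
    ((List.perm_ext_iff_of_nodup (hc.imp fun h => h.ne) (hd.imp fun h => h.ne)).2 h)

/-- In a column read downwards `n` stands before `n + 1`, so the two cancel if both occur. -/
lemma Strict.ep_eq {c : List ℕ+} (hc : Strict c) (n : ℕ+) :
    ep n c = if n + 1 ∈ c ∧ n ∉ c then 1 else 0 := by
  induction c with
  | nil => simp
  | cons a c ih =>
    have h1 := List.pairwise_cons.1 hc
    rw [ep_cons, ih h1.2]
    have h2 : a = n + 1 → n ∉ c ∧ n + 1 ∉ c := by
      rintro rfl
      exact ⟨fun h => absurd (h1.1 _ h) (by simp [le_of_lt]),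
        fun h => absurd (h1.1 _ h) (lt_irrefl _)⟩
    have := pnat_ne_add_one n
    grind

lemma Strict.ph_eq {c : List ℕ+} (hc : Strict c) (n : ℕ+) :
    ph n c = if n ∈ c ∧ n + 1 ∉ c then 1 else 0 := by
  have h1 := ph_add_count n c
  rw [hc.ep_eq, List.Nodup.count (hc.imp fun h => h.ne),
    List.Nodup.count (hc.imp fun h => h.ne)] at h1
  grind

/-- On columns, regarded as sets, lowering exchanges `n` for `n + 1`. This lemma and `FStep.strict`
allow the bumping arguments to use membership only and no positions. -/
lemma Strict.fstep {c d : List ℕ+} (hc : Strict c) (hd : Strict d) {n : ℕ+} (h1 : n ∈ c)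
    (h2 : n + 1 ∉ c) (h : ∀ x, x ∈ d ↔ x = n + 1 ∨ (x ∈ c ∧ x ≠ n)) : FStep n c d := by
  obtain ⟨u, v, rfl⟩ := List.append_of_mem h1
  have hu : ∀ x ∈ u, x < n := by simp only [Strict, List.pairwise_append] at hc; grind
  have hv : ∀ x ∈ v, n + 1 < x := by
    intro x hx
    have h3 : n < x := by simp only [Strict, List.pairwise_append, List.pairwise_cons] at hc; grind
    exact lt_of_le_of_ne (PNat.add_one_le_iff.2 h3) (by rintro rfl; simp [hx] at h2)
  have hlt : n < n + 1 := PNat.lt_add_right n 1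
  have hs : Strict (u ++ (n + 1) :: v) := by
    simp only [Strict, List.pairwise_append, List.pairwise_cons] at hc ⊢
    grind
  have : d = u ++ (n + 1) :: v := hd.ext hs (by
    intro x; rw [h]; simp only [List.mem_append, List.mem_cons]
    have := fun hx => (hu x hx).ne
    have := fun hx => (hlt.trans (hv x hx)).ne'
    grind)
  subst this
  refine ⟨u, v, rfl, rfl, ?_, ?_⟩
  · have hvs : Strict v := by
      simp only [Strict, List.pairwise_append, List.pairwise_cons] at hc; exact hc.2.1.2
    rw [hvs.ep_eq]; simp; intro hx; exact absurd (hv _ hx) (lt_irrefl _)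
  · have hus : Strict u := by
      simp only [Strict, List.pairwise_append, List.pairwise_cons] at hc; exact hc.1
    rw [hus.ph_eq]; simp; intro hx; exact absurd (hu _ hx) (lt_irrefl _)

lemma FStep.strict {c d : List ℕ+} {n : ℕ+} (h : FStep n c d) (hc : Strict c) :
    Strict d ∧ n ∈ c ∧ n + 1 ∉ c ∧ ∀ x, x ∈ d ↔ x = n + 1 ∨ (x ∈ c ∧ x ≠ n) := by
  have h0 := h.ph_eq
  rw [hc.ph_eq] at h0
  have h1 : n ∈ c ∧ n + 1 ∉ c := by by_contra hh; simp [hh] at h0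
  obtain ⟨u, v, rfl, rfl, -, -⟩ := h
  have h2 := h1.2
  have hu : ∀ x ∈ u, x < n := by simp only [Strict, List.pairwise_append] at hc; grind
  have hv : ∀ x ∈ v, n + 1 < x := by
    intro x hx
    have h3 : n < x := by simp only [Strict, List.pairwise_append, List.pairwise_cons] at hc; grind
    exact lt_of_le_of_ne (PNat.add_one_le_iff.2 h3) (by rintro rfl; simp [hx] at h2)
  have hlt : n < n + 1 := PNat.lt_add_right n 1
  refine ⟨?_, h1.1, h1.2, ?_⟩
  · simp only [Strict, List.pairwise_append, List.pairwise_cons] at hc ⊢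
    grind
  · intro x; simp only [List.mem_append, List.mem_cons]
    have := fun hx => (hu x hx).ne
    have := fun hx => (hlt.trans (hv x hx)).ne'
    grind

/-- Inserting `a` into the column `c` bumps `a'` and gives the column `c'`. -/
structure Bump (a : ℕ+) (c : List ℕ+) (a' : ℕ+) (c' : List ℕ+) : Prop where
  strict : Strict c
  strict' : Strict c'
  mem : a' ∈ c
  le : a' ≤ a
  max : ∀ x ∈ c, x ≤ a → x ≤ a'
  mem_iff : ∀ x, x ∈ c' ↔ x = a ∨ (x ∈ c ∧ x ≠ a')
  length : c'.length = c.length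

/-- The dichotomy through which all facts about insertion pass: either the letter rests on top of
the column, or there is a bump and insertion continues to the left. -/
lemma insertLetter_cons {c : List ℕ+} (hc : Strict c) (a : ℕ+) (T : List (List ℕ+)) :
    ((∀ x ∈ c, a < x) ∧ insertLetter a (c :: T) = (a :: c) :: T) ∨
    ∃ a' c', Bump a c a' c' ∧ insertLetter a (c :: T) = c' :: insertLetter a' T := by
  rw [insertLetter]
  rcases h : (c.filter (fun x => x ≤ a)).max? with _ | a'
  · left
    rw [List.max?_eq_none_iff, List.filter_eq_nil_iff] at h
    exact ⟨fun x hx => by simpa using h x hx, rfl⟩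
  · right
    rw [List.max?_eq_some_iff] at h
    simp only [List.mem_filter, decide_eq_true_eq] at h
    obtain ⟨⟨h1, h2⟩, h3⟩ := h
    refine ⟨a', c.replace a' a, ?_, rfl⟩
    obtain ⟨u, v, rfl⟩ := List.append_of_mem h1
    have hu : ∀ x ∈ u, x < a' := by simp only [Strict, List.pairwise_append] at hc; grind
    have hv' : ∀ x ∈ v, a' < x := by
      simp only [Strict, List.pairwise_append, List.pairwise_cons] at hc; grind
    have hv : ∀ x ∈ v, a < x := by
      intro x hx
      by_contra hxa
      exact absurd (hv' x hx) (not_lt.2 (h3 x ⟨by simp [hx], not_lt.1 hxa⟩))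
    have hr : (u ++ a' :: v).replace a' a = u ++ a :: v := by
      rw [List.replace_append_right, List.replace_cons_self]
      exact fun hx => absurd (hu _ hx) (lt_irrefl _)
    rw [hr]
    refine ⟨hc, ?_, h1, h2, fun x hx hxa => h3 x ⟨hx, hxa⟩, ?_, by simp⟩
    · simp only [Strict, List.pairwise_append, List.pairwise_cons] at hc ⊢
      grind
    · intro x; simp only [List.mem_append, List.mem_cons]
      have := fun hx => (hu x hx).ne
      have := fun hx => (hv' x hx).ne'
      grind

/-! ### One bump as an equivalence of words. -/

namespace Bump

variable {a a' b b' n : ℕ+} {c c' d d' : List ℕ+}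

/-- The elementary plactic relation for columns. As `a'` is the largest entry at most `a`, the only
interesting letters are those of `{n, n + 1}`, and the claim is a finite check on which of them lie
in `c`. -/
lemma ep_eq (h : Bump a c a' c') (n : ℕ+) : ep n (a :: c) = ep n (c' ++ [a']) := by
  have h1 := h.strict.ep_eq n
  have h1' := h.strict'.ep_eq n
  have h2 := h.strict'.ph_eq n
  have e1 := h.mem_iff n
  have e2 := h.mem_iff (n + 1)
  have m1 := h.max n
  have m2 := h.max (n + 1)
  have hle := h.le
  have k1 : a' = n → n ∈ c := fun e => e ▸ h.mem
  have k2 : a' = n + 1 → n + 1 ∈ c := fun e => e ▸ h.mem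
  rw [ep_cons, ep_append, ep_singleton, h1, h1', h2]
  have hn := pnat_ne_add_one n
  simp only [← PNat.coe_le_coe, ← PNat.coe_inj, PNat.add_coe, PNat.one_coe, ne_eq] at *
  by_cases i1 : n ∈ c <;> by_cases i2 : n + 1 ∈ c <;> simp only [i1, i2, e1, e2] <;> grind

lemma count_eq (h : Bump a c a' c') (x : ℕ+) : (a :: c).count x = (c' ++ [a']).count x := by
  have e1 := h.mem_iff x
  have hmem := h.mem
  have := h.le
  have := h.max a
  rw [List.count_cons, List.count_append, List.Nodup.count (h.strict.imp fun h => h.ne),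
    List.Nodup.count (h.strict'.imp fun h => h.ne), List.count_singleton]
  grind

lemma perm (h : Bump a c a' c') : (a :: c).Perm (c' ++ [a']) :=
  List.perm_iff_count.2 h.count_eq

lemma ph_eq (h : Bump a c a' c') (n : ℕ+) : ph n (a :: c) = ph n (c' ++ [a']) := by
  have h1 := ph_add_count n (a :: c)
  have h2 := ph_add_count n (c' ++ [a'])
  rw [h.ep_eq, h.count_eq, h.count_eq] at h1
  omega

lemma fstep (h : Bump a c a' c') (h' : Bump b d b' d') (hs : FStep n (a :: c) (b :: d)) :
    FStep n (c' ++ [a']) (d' ++ [b']) := by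
  have hlt : n < n + 1 := PNat.lt_add_right n 1
  have hle : ∀ x : ℕ+, x ≤ n + 1 ↔ x ≤ n ∨ x = n + 1 := by
    intro x; simp only [← PNat.coe_le_coe, ← PNat.coe_inj, PNat.add_coe, PNat.one_coe]; omega
  have hge : ∀ x : ℕ+, n < x ↔ n + 1 ≤ x := fun x => PNat.add_one_le_iff.symm
  have hmax := h.max
  have hmax' := h'.max
  have hmem := h.mem
  have hmem' := h'.mem
  have hm := h.mem_iff
  have hm' := h'.mem_iff
  have hl := h.le
  have hl' := h'.le
  rw [← List.singleton_append, ← List.singleton_append (l := d)] at hs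
  -- First possible outcome: the same letter is bumped and the change from `n` to `n + 1` stays in
  -- the column.
  have key1 : n ∈ c' → n + 1 ∉ c' → a' = b' → a' ≠ n + 1 →
      (∀ x, x ∈ d' ↔ x = n + 1 ∨ (x ∈ c' ∧ x ≠ n)) → FStep n (c' ++ [a']) (d' ++ [b']) := by
    intro i1 i2 i3 i4 i5
    rw [← i3]
    refine (h.strict'.fstep h'.strict' i1 i2 i5).left ?_
    rw [h.strict'.ph_eq, ep_singleton]; simp [i1, i2, i4]
  -- Second possible outcome: the columns agree afterwards and the change is passed on to the bumped
  -- letter.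
  have key2 : (n ∈ c' → n + 1 ∈ c') → a' = n → b' = n + 1 →
      (∀ x, x ∈ c' ↔ x ∈ d') → FStep n (c' ++ [a']) (d' ++ [b']) := by
    intro i1 i3 i4 i5
    rw [h.strict'.ext h'.strict' i5, i3, i4]
    rw [h.strict'.ext h'.strict' i5] at i1
    refine FStep.right ⟨[], [], rfl, rfl, rfl, rfl⟩ ?_
    rw [h'.strict'.ph_eq, ep_singleton]; simpa using i1
  rcases hs.append_cases with ⟨x, hx, h1, h2⟩ | ⟨x, hx, h1, h2⟩
  · obtain ⟨u, v, e1, rfl, -⟩ := h1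
    have : u = [] ∧ v = [] ∧ a = n := by rcases u with _ | ⟨_, _ | _⟩ <;> simp_all
    obtain ⟨rfl, rfl, rfl⟩ := this
    simp at hx
    obtain ⟨rfl, rfl⟩ := hx
    rw [h.strict.ep_eq, ph_singleton] at h2
    simp at h2
    by_cases i : a + 1 ∈ d
    · have i2 : a ∈ d := h2 i
      have ea : a' = a := le_antisymm hl (hmax a i2 le_rfl)
      have eb : b' = a + 1 := le_antisymm hl' (hmax' _ i le_rfl)
      refine key2 (fun _ => ?_) ea eb ?_
      · rw [hm]; right; exact ⟨i, by rw [ea]; exact hlt.ne'⟩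
      · intro x; rw [hm, hm', ea, eb]; grind
    · have hb : b' ≤ a := by
        rcases (hle b').1 hl' with h3 | h3
        · exact h3
        · exact absurd (h3 ▸ hmem') i
      have e : a' = b' := le_antisymm (hmax' _ hmem (hl.trans hlt.le)) (hmax _ hmem' hb)
      refine key1 ?_ ?_ e ?_ ?_
      · rw [hm]; simp
      · rw [hm]; simp [i]
      · rw [e]; exact (hb.trans_lt hlt).ne
      · intro x; rw [hm, hm', e]; grind
  · simp at hx
    obtain ⟨rfl, rfl⟩ := hx
    obtain ⟨-, j1, j2, j3⟩ := h1.strict h.strict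
    -- Had the inserted letter been `n`, the tensor rule would have changed it rather than the
    -- column, since a column with `n` but without `n + 1` has ε equal to 0.
    have hbn : b ≠ n := by
      rintro rfl
      rw [h.strict.ep_eq, ph_singleton] at h2
      simp [j2] at h2
    rcases lt_or_gt_of_ne hbn with hb | hb
    · have e : a' = b' := by
        apply le_antisymm
        · exact hmax' _ ((j3 a').2 (Or.inr ⟨hmem, (hl.trans_lt hb).ne⟩)) hl
        · rcases (j3 b').1 hmem' with h3 | h3
          · exact absurd (h3 ▸ hl') (not_le.2 (hb.trans hlt))
          · exact hmax _ h3.1 hl'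
      refine key1 ?_ ?_ e ?_ ?_
      · rw [hm]; exact Or.inr ⟨j1, (hl.trans_lt hb).ne'⟩
      · rw [hm]; simp [j2]; exact (hb.trans hlt).ne'
      · exact ((hl.trans_lt hb).trans hlt).ne
      · intro x; rw [hm, hm', j3, e]
        have := (hl'.trans_lt hb)
        grind
    · have hb1 := (hge b).1 hb
      have h3 : n ≤ a' := hmax n j1 hb.le
      have h4 : n + 1 ≤ b' := hmax' (n + 1) ((j3 _).2 (Or.inl rfl)) hb1
      rcases eq_or_lt_of_le h3 with h3 | h3
      · subst h3
        have eb : b' = n + 1 := by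
          rcases (j3 b').1 hmem' with h5 | h5
          · exact h5
          · exact absurd (hmax _ h5.1 hl') (not_le.2 (hlt.trans_le h4))
        refine key2 ?_ rfl eb ?_
        · rw [hm]; intro h6; grind
        · intro x; rw [hm, hm', j3, eb]; grind
      · have h5 : n + 1 < a' := lt_of_le_of_ne ((hge _).1 h3) (fun h => j2 (h ▸ hmem))
        have e : a' = b' := by
          apply le_antisymm
          · exact hmax' _ ((j3 a').2 (Or.inr ⟨hmem, h3.ne'⟩)) hl
          · rcases (j3 b').1 hmem' with h3 | h3
            · rw [h3]; exact h5.le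
            · exact hmax _ h3.1 hl'
        refine key1 ?_ ?_ e h5.ne' ?_
        · rw [hm]; exact Or.inr ⟨j1, h3.ne⟩
        · rw [hm]; simp [j2]; exact (h5.trans_le hl).ne
        · intro x; rw [hm, hm', j3, e]; grind

end Bump

/-- Lowering does not affect whether a column grows or bumps; this keeps the shapes equal. -/
lemma bump_exists_iff_of_fstep {a b n : ℕ+} {c d : List ℕ+} (hc : Strict c)
    (hs : FStep n (a :: c) (b :: d)) : Strict d ∧ ((∀ x ∈ c, a < x) ↔ ∀ x ∈ d, b < x) := by
  have hlt : n < n + 1 := PNat.lt_add_right n 1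
  have hge : ∀ x : ℕ+, n < x ↔ n + 1 ≤ x := fun x => PNat.add_one_le_iff.symm
  rw [← List.singleton_append, ← List.singleton_append (l := d)] at hs
  rcases hs.append_cases with ⟨x, hx, h1, h2⟩ | ⟨x, hx, h1, h2⟩
  · obtain ⟨u, v, e1, rfl, -⟩ := h1
    have : u = [] ∧ v = [] ∧ a = n := by rcases u with _ | ⟨_, _ | _⟩ <;> simp_all
    obtain ⟨rfl, rfl, rfl⟩ := this
    simp at hx
    obtain ⟨rfl, rfl⟩ := hx
    refine ⟨hc, ?_⟩
    rw [hc.ep_eq, ph_singleton] at h2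
    simp at h2
    constructor
    · intro h x hx
      refine lt_of_le_of_ne ((hge x).1 (h x hx)) ?_
      rintro rfl
      exact absurd (h a (h2 hx)) (lt_irrefl _)
    · exact fun h x hx => hlt.trans (h x hx)
  · simp at hx
    obtain ⟨rfl, rfl⟩ := hx
    obtain ⟨hd, j1, j2, j3⟩ := h1.strict hc
    refine ⟨hd, ?_⟩
    have hbn : b ≠ n := by
      rintro rfl
      rw [hc.ep_eq, ph_singleton] at h2
      simp [j2] at h2
    constructor
    · intro h x hx
      rcases (j3 x).1 hx with rfl | h3
      · exact (h n j1).trans hlt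
      · exact h x h3.1
    · intro h x hx
      by_cases hxn : x = n
      · subst hxn
        refine lt_of_le_of_ne ?_ hbn
        have := h (x + 1) ((j3 _).2 (Or.inl rfl))
        exact PNat.lt_add_one_iff.1 this
      · exact h x ((j3 x).2 (Or.inr ⟨hx, hxn⟩))

/-! ### Insertion as a map of crystals -/

abbrev StrictCols (T : List (List ℕ+)) : Prop := ∀ c ∈ T, Strict c

lemma StrictCols.insertLetter {T : List (List ℕ+)} (hT : StrictCols T) (a : ℕ+) :
    StrictCols (insertLetter a T) := by
  induction T generalizing a with
  | nil => intro c hc; simp [GlInf.insertLetter] at hc; simp [hc, Strict]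
  | cons c T ih =>
    have hc := hT c (by simp)
    have hT' : StrictCols T := fun d hd => hT d (by simp [hd])
    rcases insertLetter_cons hc a T with ⟨h1, h2⟩ | ⟨a', c', h1, h2⟩ <;> rw [h2]
    · intro d hd
      rcases List.mem_cons.1 hd with rfl | hd
      · exact List.pairwise_cons.2 ⟨h1, hc⟩
      · exact hT' d hd
    · intro d hd
      rcases List.mem_cons.1 hd with rfl | hd
      · exact h1.strict'
      · exact ih hT' a' d hd

lemma insertLetter_perm {T : List (List ℕ+)} (hT : StrictCols T) (a : ℕ+) :
    (a :: T.flatten).Perm (insertLetter a T).flatten := by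
  induction T generalizing a with
  | nil => simp [insertLetter]
  | cons c T ih =>
    have hT' : StrictCols T := fun d hd => hT d (by simp [hd])
    rcases insertLetter_cons (hT c (by simp)) a T with ⟨h1, h2⟩ | ⟨a', c', h1, h2⟩ <;> rw [h2]
    · simp
    · have h3 := h1.perm.append_right T.flatten
      simp only [List.flatten_cons, List.cons_append, List.append_assoc, List.nil_append] at h3 ⊢
      exact h3.trans ((ih hT' a').append_left c')

lemma ep_append_congr {n : ℕ+} {u u' v v' : List ℕ+} (h1 : ep n u = ep n u') (h2 : ph n u = ph n u')
    (h3 : ep n v = ep n v') : ep n (u ++ v) = ep n (u' ++ v') := by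
  rw [ep_append, ep_append, h1, h2, h3]

lemma ep_insertLetter {T : List (List ℕ+)} (hT : StrictCols T) (a n : ℕ+) :
    ep n (insertLetter a T).flatten = ep n (a :: T.flatten) := by
  induction T generalizing a with
  | nil => simp [insertLetter]
  | cons c T ih =>
    have hT' : StrictCols T := fun d hd => hT d (by simp [hd])
    rcases insertLetter_cons (hT c (by simp)) a T with ⟨h1, h2⟩ | ⟨a', c', h1, h2⟩ <;> rw [h2]
    · simp
    · rw [List.flatten_cons, List.flatten_cons, ep_append_congr rfl rfl (ih hT' a'),
        ← List.cons_append, ep_append_congr (h1.ep_eq n) (h1.ph_eq n) rfl]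
      simp

lemma ph_eq_of_ep_eq_of_perm {n : ℕ+} {u v : List ℕ+} (h : ep n u = ep n v) (hp : u.Perm v) :
    ph n u = ph n v := by
  have h1 := ph_add_count n u
  have h2 := ph_add_count n v
  rw [hp.count_eq, hp.count_eq, h] at h1
  omega

lemma FStep.append_cases_of_length {n : ℕ+} {u v u' v' : List ℕ+} (hl : u.length = u'.length)
    (h : FStep n (u ++ v) (u' ++ v')) :
    (v' = v ∧ FStep n u u' ∧ ep n v < ph n u) ∨ (u' = u ∧ FStep n v v' ∧ ph n u ≤ ep n v) := by
  rcases h.append_cases with ⟨x, hx, h1, h2⟩ | ⟨x, hx, h1, h2⟩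
  · obtain ⟨rfl, rfl⟩ := List.append_inj hx (by rw [h1.length_eq, hl])
    exact Or.inl ⟨rfl, h1, h2⟩
  · obtain ⟨rfl, rfl⟩ := List.append_inj hx hl.symm
    exact Or.inr ⟨rfl, h1, h2⟩

/-- Go through the columns. If the changed letter is `a` or lies in the first column, `Bump.fstep`
leaves the change in the new column or moves it to the bumped letter, and in the latter case the
argument repeats one column further left. If it lies further left, the first column is bumped
identically. The side conditions of the tensor rule persist because insertion does not alter ε of
the remaining columns. -/
lemma FStep.insertLetter {n a b : ℕ+} {T U : List (List ℕ+)} (hT : StrictCols T)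
    (hU : StrictCols U) (hs : shape T = shape U) (h : FStep n (a :: T.flatten) (b :: U.flatten)) :
    FStep n (insertLetter a T).flatten (insertLetter b U).flatten ∧
      shape (GlInf.insertLetter a T) = shape (GlInf.insertLetter b U) := by
  induction T generalizing a b U with
  | nil =>
    obtain rfl : U = [] := by simpa [shape] using hs.symm
    exact ⟨by simpa [GlInf.insertLetter] using h, by simp [GlInf.insertLetter, shape]⟩
  | cons c T ih =>
    rcases U with _ | ⟨d, U⟩
    · simp [shape] at hs
    simp only [shape, List.map_cons, List.cons.injEq] at hs
    obtain ⟨hl, hs⟩ := hs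
    have hc : Strict c := hT c (by simp)
    have hd : Strict d := hU d (by simp)
    have hT' : StrictCols T := fun d hd => hT d (by simp [hd])
    have hU' : StrictCols U := fun d hd => hU d (by simp [hd])
    rw [List.flatten_cons, List.flatten_cons, ← List.cons_append, ← List.cons_append] at h
    have hcase := h.append_cases_of_length (by simp [hl])
    have hiff : (∀ x ∈ c, a < x) ↔ ∀ x ∈ d, b < x := by
      rcases hcase with ⟨-, h1, -⟩ | ⟨h1, -⟩
      · exact (bump_exists_iff_of_fstep hc h1).2
      · simp only [List.cons.injEq] at h1; rw [h1.1, h1.2]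
    rcases insertLetter_cons hc a T with ⟨h1, h2⟩ | ⟨a', c', h1, h2⟩ <;>
    rcases insertLetter_cons hd b U with ⟨h3, h4⟩ | ⟨b', d', h3, h4⟩ <;> rw [h2, h4]
    · exact ⟨by simpa using h, by simp [shape, hs, hl]⟩
    · exact absurd (hiff.1 h1 b' h3.mem) (not_lt.2 h3.le)
    · exact absurd (hiff.2 h3 a' h1.mem) (not_lt.2 h1.le)
    · have hl' : c'.length = d'.length := by rw [h1.length, h3.length, hl]
      have hmid : FStep n (c' ++ ([a'] ++ T.flatten)) (d' ++ ([b'] ++ U.flatten)) := by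
        rw [← List.append_assoc, ← List.append_assoc]
        rcases hcase with ⟨e, h5, h6⟩ | ⟨e, h5, h6⟩
        · rw [e]
          exact (h1.fstep h3 h5).left (by rwa [← h1.ph_eq])
        · simp only [List.cons.injEq] at e
          obtain ⟨rfl, rfl⟩ := e
          have e1 : b' = a' := le_antisymm (h1.max _ h3.mem h3.le) (h3.max _ h1.mem h1.le)
          subst e1
          have e2 : c' = d' := h1.strict'.ext h3.strict' (fun x => by rw [h1.mem_iff, h3.mem_iff])
          subst e2
          exact h5.right (by rwa [← h1.ph_eq])
      simp only [List.flatten_cons]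
      rcases hmid.append_cases_of_length hl' with ⟨e, h5, h6⟩ | ⟨e, h5, h6⟩
      · simp only [List.singleton_append, List.cons.injEq] at e
        obtain ⟨rfl, e⟩ := e
        have hTU : U = T := by
          refine List.eq_iff_flatten_eq.2 ⟨e, hs.symm⟩
        subst hTU
        refine ⟨h5.left ?_, by simp [shape, hl']⟩
        rwa [ep_insertLetter hT']
      · subst e
        obtain ⟨h7, h8⟩ := ih hT' hU' hs h5
        refine ⟨h7.right ?_, ?_⟩
        · rwa [ep_insertLetter hT']
        · simp only [shape, List.map_cons, List.cons.injEq, true_and] at h8 ⊢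
          exact h8

/-- The tableau obtained by inserting the letters of a word from right to left. -/
def tabOf (w : List ℕ+) : List (List ℕ+) := w.foldr insertLetter []

@[simp] lemma tabOf_nil : tabOf [] = [] := rfl
@[simp] lemma tabOf_cons (a : ℕ+) (w : List ℕ+) : tabOf (a :: w) = insertLetter a (tabOf w) := rfl
lemma insertionTableau_reverse (w : List ℕ+) : insertionTableau w.reverse = tabOf w := by
  simp [insertionTableau, tabOf]

lemma strictCols_tabOf (w : List ℕ+) : StrictCols (tabOf w) := by
  induction w with
  | nil => simp [StrictCols]
  | cons a w ih => exact ih.insertLetter a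

lemma tabOf_perm (w : List ℕ+) : w.Perm (tabOf w).flatten := by
  induction w with
  | nil => simp
  | cons a w ih => exact (ih.cons a).trans (insertLetter_perm (strictCols_tabOf w) a)

lemma ep_tabOf (n : ℕ+) (w : List ℕ+) : ep n (tabOf w).flatten = ep n w := by
  induction w with
  | nil => simp
  | cons a w ih => rw [tabOf_cons, ep_insertLetter (strictCols_tabOf w), ep_cons, ih, ep_cons]

lemma ph_tabOf (n : ℕ+) (w : List ℕ+) : ph n (tabOf w).flatten = ph n w :=
  ph_eq_of_ep_eq_of_perm (ep_tabOf n w) (tabOf_perm w).symm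

/-- Insertion is a crystal map from words to column words of tableaux, constant in shape along
lowering. -/
lemma FStep.tabOf {n : ℕ+} {w w' : List ℕ+} (h : FStep n w w') :
    FStep n (tabOf w).flatten (tabOf w').flatten ∧ shape (tabOf w) = shape (GlInf.tabOf w') := by
  induction w generalizing w' with
  | nil => obtain ⟨u, v, h, -⟩ := h; simp at h
  | cons a w ih =>
    have hl := h.length_eq
    rcases w' with _ | ⟨b, w'⟩
    · simp at hl
    rw [tabOf_cons, tabOf_cons]
    rw [← List.singleton_append, ← List.singleton_append (l := w')] at h
    rcases h.append_cases_of_length (u := [a]) (u' := [b]) (by simp) with ⟨rfl, h1, h2⟩ | ⟨e, h1, h2⟩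
    · refine FStep.insertLetter (strictCols_tabOf _) (strictCols_tabOf _) rfl ?_
      rw [← List.singleton_append, ← List.singleton_append (x := b)]
      exact h1.left (by rwa [ep_tabOf])
    · obtain rfl : b = a := by simpa using e
      obtain ⟨h3, h4⟩ := ih h1
      refine FStep.insertLetter (strictCols_tabOf _) (strictCols_tabOf _) h4 ?_
      rw [← List.singleton_append, ← List.singleton_append (x := b)]
      exact h3.right (by rwa [ep_tabOf])

/-! ### Semistandardness -/

/-- The number of entries `≥ x`. -/
abbrev cnt (x : ℕ+) (c : List ℕ+) : ℕ := c.countP (x ≤ ·)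

/-- `d` may stand to the left of `c` in a tableau of anti-normal shape. -/
def Dom (c d : List ℕ+) : Prop := ∀ x, cnt x d ≤ cnt x c

lemma cnt_reverse (x : ℕ+) (c : List ℕ+) : cnt x c.reverse = cnt x c := by simp [cnt]

lemma cnt_one (c : List ℕ+) : cnt 1 c = c.length := by simp [cnt]

/-- For weakly decreasing sequences, entrywise comparison is comparison of the numbers of entries
above each threshold. This turns the row condition into inequalities of counts, which behave well
under bumping. -/
lemma cnt_le_iff_getElem {p q : List ℕ+} (hp : p.Pairwise (· ≥ ·)) (hq : q.Pairwise (· ≥ ·)) :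
    (∀ x, cnt x q ≤ cnt x p) ↔ q.length ≤ p.length ∧
      ∀ (j : ℕ) (x y : ℕ+), p[j]? = some x → q[j]? = some y → y ≤ x := by
  induction q generalizing p with
  | nil => simp
  | cons y q ih =>
    rcases p with _ | ⟨x, p⟩
    · constructor
      · intro h; have := h 1; simp [cnt] at this
      · simp
    obtain ⟨hp1, hp⟩ := List.pairwise_cons.1 hp
    obtain ⟨hq1, hq⟩ := List.pairwise_cons.1 hq
    have ih := ih hp hq
    constructor
    · intro h
      have hyx : y ≤ x := by
        by_contra hlt
        have h0 : cnt y p = 0 := by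
          simp only [cnt, List.countP_eq_zero, decide_eq_true_eq]
          intro z hz h1
          exact hlt (h1.trans (hp1 z hz))
        have h1 := h y
        have h2 : cnt y (y :: q) = cnt y q + 1 := by simp [cnt]
        have h3 : cnt y (x :: p) = cnt y p := by simp [cnt, hlt]
        omega
      have h2 : ∀ z, cnt z q ≤ cnt z p := by
        intro z
        have h3 := h z
        by_cases hz : z ≤ y
        · simpa [cnt, hz, hz.trans hyx] using h3
        · have h0 : cnt z q = 0 := by
            simp only [cnt, List.countP_eq_zero, decide_eq_true_eq]
            intro t ht h1
            exact hz (h1.trans (hq1 t ht))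
          omega
      obtain ⟨h3, h4⟩ := ih.1 h2
      refine ⟨by simpa using h3, ?_⟩
      rintro (_ | j) s t hs ht
      · simp at hs ht; subst hs ht; exact hyx
      · exact h4 j s t (by simpa using hs) (by simpa using ht)
    · rintro ⟨h1, h2⟩ z
      have h3 := ih.2 ⟨by simpa using h1, fun j s t hs ht => h2 (j + 1) s t (by simpa) (by simpa)⟩ z
      have h4 := h2 0 x y (by simp) (by simp)
      simp only [cnt, List.countP_cons, decide_eq_true_eq] at *
      by_cases hz : z ≤ y
      · simp [hz, hz.trans h4]; exact h3
      · simp [hz]; omega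

lemma Strict.reverse {c : List ℕ+} (hc : Strict c) : c.reverse.Pairwise (· ≥ ·) := by
  rw [List.pairwise_reverse]; exact hc.imp fun h => h.le

lemma dom_iff {c d : List ℕ+} (hc : Strict c) (hd : Strict d) :
    Dom c d ↔ d.length ≤ c.length ∧
      ∀ (j : ℕ) (x y : ℕ+), c.reverse[j]? = some x → d.reverse[j]? = some y → y ≤ x := by
  have := cnt_le_iff_getElem hc.reverse hd.reverse
  simp only [cnt_reverse, List.length_reverse] at this
  exact this

/-- The shape and row conditions together are `Dom` between neighbouring columns (threshold 1
compares lengths), and `Dom` is transitive. -/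
lemma isAntiSST_iff (T : List (List ℕ+)) :
    IsAntiSST T ↔ (∀ c ∈ T, c ≠ []) ∧ StrictCols T ∧ T.IsChain Dom := by
  rw [List.isChain_iff_getElem]
  constructor
  · intro h
    refine ⟨h.nonempty, h.column, fun k hk => ?_⟩
    have h1 : T[k]? = some T[k] := List.getElem?_eq_getElem _
    have h2 : T[k + 1]? = some T[k + 1] := List.getElem?_eq_getElem _
    rw [dom_iff (h.column _ (by simp)) (h.column _ (by simp))]
    exact ⟨h.shape k _ _ h1 h2, h.row k _ _ h1 h2⟩
  · rintro ⟨h1, h2, h3⟩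
    have key : ∀ (k : ℕ) (c d : List ℕ+), T[k]? = some c → T[k + 1]? = some d →
        d.length ≤ c.length ∧
      ∀ (j : ℕ) (x y : ℕ+), c.reverse[j]? = some x → d.reverse[j]? = some y → y ≤ x := by
      intro k c d hc hd
      obtain ⟨hk, rfl⟩ := List.getElem?_eq_some_iff.1 hc
      obtain ⟨hk', rfl⟩ := List.getElem?_eq_some_iff.1 hd
      rw [← dom_iff (h2 _ (by simp)) (h2 _ (by simp))]
      exact h3 k hk'
    exact ⟨h1, h2, fun k c d hc hd => (key k c d hc hd).1, fun k c d hc hd => (key k c d hc hd).2⟩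

lemma Bump.cnt_eq {a a' : ℕ+} {c c' : List ℕ+} (h : Bump a c a' c') (x : ℕ+) :
    cnt x c' + (if x ≤ a' then 1 else 0) = cnt x c + (if x ≤ a then 1 else 0) := by
  have := h.perm.countP_eq (p := (x ≤ ·))
  simp [List.countP_cons] at this
  simp [cnt, this]

lemma cnt_succ_lt {a x : ℕ+} {c : List ℕ+} (h : a ∈ c) (hx : x ≤ a) :
    cnt (a + 1) c + 1 ≤ cnt x c := by
  obtain ⟨u, v, rfl⟩ := List.append_of_mem h
  have h1 : ∀ w : List ℕ+, cnt (a + 1) w ≤ cnt x w := fun w =>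
    List.countP_mono_left fun y _ hy => by
      simp only [decide_eq_true_eq] at hy ⊢
      exact (hx.trans (PNat.lt_add_right a 1).le).trans hy
  have h2 := h1 u
  have h3 := h1 v
  have h4 : ¬ a + 1 ≤ a := not_le.2 (PNat.lt_add_right a 1)
  simp only [cnt, List.countP_append, List.countP_cons, decide_eq_true_eq, if_pos hx, if_neg h4] at *
  omega

lemma cnt_eq_of_gap {a x : ℕ+} {d : List ℕ+} (hx : x ≤ a) (h : ∀ y ∈ d, x ≤ y → a < y) :
    cnt x d = cnt (a + 1) d := by
  apply List.countP_congr
  intro y hy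
  simp only [decide_eq_true_eq]
  exact ⟨fun h1 => PNat.add_one_le_iff.2 (h y hy h1),
    fun h1 => (hx.trans (PNat.lt_add_right a 1).le).trans h1⟩

/-- The next column `d` gains at a threshold `x` only if `x ≤ a'` while no entry of `d` lies between
`x` and `a'`. Then its old count at `x` equals its count at `a' + 1`, which is at most that of `c`
at `a' + 1`, and `c` has at least one entry more at `x`, namely `a'` itself. So there is room for
the gain. -/
lemma Bump.dom_insertLetter {a a' : ℕ+} {c c' : List ℕ+} (h : Bump a c a' c')
    {T : List (List ℕ+)} (hT : StrictCols T) (hd : ∀ d ∈ T.head?, Dom c d) :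
    ∀ d ∈ (insertLetter a' T).head?, Dom c' d := by
  have h1 : ∀ x, cnt x c ≤ cnt x c' := by
    intro x
    have := h.cnt_eq x
    have := h.le
    by_cases hx : x ≤ a'
    · simp [hx, hx.trans this] at *; omega
    · simp [hx] at *; omega
  rcases T with _ | ⟨d, T⟩
  · intro d hd x
    simp [insertLetter] at hd
    subst hd
    refine le_trans ?_ (h1 x)
    by_cases hx : x ≤ a'
    · have := cnt_succ_lt h.mem hx
      have h2 : cnt x [a'] ≤ 1 := by simpa using List.countP_le_length (p := (x ≤ ·)) (l := [a'])
      omega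
    · simp [cnt, hx]
  · have hd := hd d (by simp)
    rcases insertLetter_cons (hT d (by simp)) a' T with ⟨h2, h3⟩ | ⟨a'', d', h2, h3⟩ <;> rw [h3]
    · simp only [List.head?_cons, Option.mem_def, Option.some.injEq, forall_eq']
      intro x
      refine le_trans ?_ (h1 x)
      have hdx := hd x
      by_cases hx : x ≤ a'
      · have e1 := cnt_eq_of_gap hx (d := d) (fun y hy _ => h2 y hy)
        have e2 := cnt_succ_lt h.mem hx
        have e3 := hd (a' + 1)
        simp only [cnt, List.countP_cons, decide_eq_true_eq] at *
        simp [hx]; omega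
      · simp only [cnt, List.countP_cons, decide_eq_true_eq] at *
        simp [hx]; omega
    · simp only [List.head?_cons, Option.mem_def, Option.some.injEq, forall_eq']
      intro x
      refine le_trans ?_ (h1 x)
      have hdx := hd x
      have e0 := h2.cnt_eq x
      by_cases hx : x ≤ a'
      · by_cases hx' : x ≤ a''
        · simp [hx, hx'] at e0; omega
        · have e1 := cnt_eq_of_gap hx (d := d) (fun y hy hxy => by
            by_contra hn
            exact hx' (hxy.trans (h2.max y hy (not_lt.1 hn))))
          have e2 := cnt_succ_lt h.mem hx
          have e3 := hd (a' + 1)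
          simp [hx, hx'] at e0; omega
      · have hx' : ¬ x ≤ a'' := fun hh => hx (hh.trans h2.le)
        simp [hx, hx'] at e0; omega

lemma IsAntiSST.insertLetter {T : List (List ℕ+)} (hT : IsAntiSST T) (a : ℕ+) :
    IsAntiSST (insertLetter a T) := by
  rw [isAntiSST_iff] at *
  induction T generalizing a with
  | nil => simp [GlInf.insertLetter, StrictCols]
  | cons c T ih =>
    obtain ⟨h1, h2, h3⟩ := hT
    have hc : Strict c := h2 c (by simp)
    have hT' : StrictCols T := fun d hd => h2 d (by simp [hd])
    have h4 := List.isChain_cons.1 h3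
    have ih := ih ⟨fun d hd => h1 d (by simp [hd]), hT', h4.2⟩
    refine ⟨?_, h2.insertLetter a, ?_⟩
    all_goals rcases insertLetter_cons hc a T with ⟨h5, h6⟩ | ⟨a', c', h5, h6⟩ <;> rw [h6]
    · intro d hd
      rcases List.mem_cons.1 hd with rfl | hd
      · simp
      · exact h1 d (by simp [hd])
    · intro d hd
      rcases List.mem_cons.1 hd with rfl | hd
      · exact List.ne_nil_of_mem ((h5.mem_iff a).2 (Or.inl rfl))
      · exact (ih a').1 d hd
    · rw [List.isChain_cons]
      refine ⟨fun d hd x => (h4.1 d hd x).trans ?_, h4.2⟩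
      simp [cnt, List.countP_cons]
    · rw [List.isChain_cons]
      exact ⟨h5.dom_insertLetter hT' h4.1, (ih a').2.2⟩

lemma isAntiSST_tabOf (w : List ℕ+) : IsAntiSST (tabOf w) := by
  induction w with
  | nil => rw [isAntiSST_iff]; simp [StrictCols]
  | cons a w ih => exact ih.insertLetter a

/-! ### Rows of tableaux and the reading word -/

/-- The row of height `j` (counted from the bottom), from right to left. -/
def rowAt (j : ℕ) (T : List (List ℕ+)) : List ℕ+ := T.filterMap fun c => c.reverse[j]?

/-- The reading word of the lowest `j` rows. -/
def lowRows (T : List (List ℕ+)) : ℕ → List ℕ+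
  | 0 => []
  | j + 1 => rowAt j T ++ lowRows T j

lemma readingWord_eq (T : List (List ℕ+)) : readingWord T = lowRows T (T.headD []).length := by
  rw [readingWord]
  induction (T.headD []).length with
  | zero => rfl
  | succ j ih => rw [List.range_succ, List.reverse_append, List.reverse_singleton,
      List.singleton_append, List.flatMap_cons, ih]; rfl

/-- Put the letters of `r` on top of the columns of `T`, from right to left. -/
def addRow : List ℕ+ → List (List ℕ+) → List (List ℕ+)
  | [], T => T
  | y :: r, [] => [y] :: addRow r []
  | y :: r, c :: T => (y :: c) :: addRow r T

/-- The letters of `r` are smaller than the entries of the columns of `T` below them. -/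
def Below : List ℕ+ → List (List ℕ+) → Prop
  | y :: r, c :: T => (∀ x ∈ c, y < x) ∧ Below r T
  | _, _ => True

lemma Below.tail {y : ℕ+} {r : List ℕ+} {T : List (List ℕ+)} (hs : (y :: r).Pairwise (· ≥ ·))
    (h : Below (y :: r) T) : Below r T := by
  induction r generalizing y T with
  | nil => simp [Below]
  | cons z r ih =>
    rcases T with _ | ⟨c, T⟩
    · simp [Below]
    · obtain ⟨h1, h2⟩ := h
      have h3 := List.pairwise_cons.1 hs
      exact ⟨fun x hx => (h3.1 z (by simp)).trans_lt (h1 x hx), ih h3.2 h2⟩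

/-- In a column with top `z ≤ y` whose other entries exceed `y`, the letter bumped by `y` is `z`. So
inserting `y` shifts the whole top row one column to the left and puts `y` at its right end. -/
lemma insertLetter_addRow {y : ℕ+} {r : List ℕ+} {T : List (List ℕ+)}
    (hs : (y :: r).Pairwise (· ≥ ·)) (h : Below (y :: r) T) (hT : StrictCols T) :
    insertLetter y (addRow r T) = addRow (y :: r) T := by
  have aux : ∀ {y z : ℕ+} {c : List ℕ+} (U : List (List ℕ+)), z ≤ y → Strict c →
      (∀ x ∈ c, y < x) → insertLetter y ((z :: c) :: U) = (y :: c) :: insertLetter z U := by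
    intro y z c U hzy hc hy
    have hzc : Strict (z :: c) := List.pairwise_cons.2 ⟨fun x hx => hzy.trans_lt (hy x hx), hc⟩
    rcases insertLetter_cons hzc y U with ⟨h1, h2⟩ | ⟨a', c', h1, h2⟩ <;> rw [h2]
    · exact absurd (h1 z (by simp)) (not_lt.2 hzy)
    · have ha : a' = z := by
        rcases List.mem_cons.1 h1.mem with h3 | h3
        · exact h3
        · exact absurd (hy _ h3) (not_lt.2 h1.le)
      subst ha
      congr 1
      refine h1.strict'.ext (List.pairwise_cons.2 ⟨hy, hc⟩) fun x => ?_
      rw [h1.mem_iff]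
      have := (List.pairwise_cons.1 hzc).1 x
      constructor
      · grind
      · intro hx
        rcases List.mem_cons.1 hx with rfl | hx
        · simp
        · exact Or.inr ⟨by simp [hx], (this hx).ne'⟩
  induction r generalizing y T with
  | nil =>
    rcases T with _ | ⟨c, T⟩
    · simp [addRow, insertLetter]
    · simp only [addRow]
      rcases insertLetter_cons (hT c (by simp)) y T with ⟨h1, h2⟩ | ⟨a', c', h1, h2⟩
      · exact h2
      · exact absurd (h.1 _ h1.mem) (not_lt.2 h1.le)
  | cons z r ih =>
    have h3 := List.pairwise_cons.1 hs
    rcases T with _ | ⟨c, T⟩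
    · rw [addRow, aux _ (h3.1 z (by simp)) (by simp [Strict]) (by simp),
        ih h3.2 (by simp [Below]) (by simp [StrictCols])]
      rfl
    · rw [addRow, aux _ (h3.1 z (by simp)) (hT c (by simp)) h.1,
        ih h3.2 h.2 fun d hd => hT d (by simp [hd])]
      rfl

lemma tabOf_append {r w : List ℕ+} (hr : r.Pairwise (· ≥ ·)) (h : Below r (tabOf w)) :
    tabOf (r ++ w) = addRow r (tabOf w) := by
  induction r with
  | nil => rfl
  | cons y r ih =>
    rw [List.cons_append, tabOf_cons, ih (List.pairwise_cons.1 hr).2 (h.tail hr),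
      insertLetter_addRow hr h (strictCols_tabOf w)]

instance : Trans Dom Dom Dom := ⟨fun h1 h2 x => (h2 x).trans (h1 x)⟩

namespace IsAntiSST

variable {T : List (List ℕ+)} (hT : IsAntiSST T)
include hT

lemma pairwise_dom : T.Pairwise Dom := List.isChain_iff_pairwise.1 ((isAntiSST_iff T).1 hT).2.2

lemma strictCols : StrictCols T := hT.column

lemma pairwise_length : T.Pairwise (fun c d => d.length ≤ c.length) :=
  hT.pairwise_dom.imp fun h => by simpa [cnt_one] using h 1

lemma rowAt_sorted (j : ℕ) : (rowAt j T).Pairwise (· ≥ ·) := by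
  rw [rowAt, List.pairwise_filterMap]
  refine List.Pairwise.imp_of_mem (fun {c d} hc hd h x hx y hy => ?_) hT.pairwise_dom
  exact ((dom_iff (hT.column c hc) (hT.column d hd)).1 h).2 j x y hx hy

end IsAntiSST

/-- The lowest `j` entries of a column. -/
def lowCol (j : ℕ) (c : List ℕ+) : List ℕ+ := (c.reverse.take j).reverse

lemma lowCol_of_length_le {j : ℕ} {c : List ℕ+} (h : c.length ≤ j) : lowCol j c = c := by
  rw [lowCol, List.take_of_length_le (by simpa), List.reverse_reverse]

lemma lowCol_succ {j : ℕ} {c : List ℕ+} {x : ℕ+} (h : c.reverse[j]? = some x) :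
    lowCol (j + 1) c = x :: lowCol j c := by
  rw [lowCol, List.take_add_one, h, lowCol]; simp

lemma rowAt_eq_nil {j : ℕ} {T : List (List ℕ+)} (h : ∀ c ∈ T, c.length ≤ j) : rowAt j T = [] := by
  rw [rowAt, List.filterMap_eq_nil_iff]
  intro c hc
  simpa using h c hc

lemma addRow_rowAt {T : List (List ℕ+)} (hT : T.Pairwise (fun c d => d.length ≤ c.length)) (j : ℕ) :
    addRow (rowAt j T) (T.map (lowCol j)) = T.map (lowCol (j + 1)) := by
  induction T with
  | nil => simp [rowAt, addRow]
  | cons c T ih =>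
    obtain ⟨h1, h2⟩ := List.pairwise_cons.1 hT
    rcases h : c.reverse[j]? with _ | x
    · have hj : c.length ≤ j := by simpa using h
      have hall : ∀ d ∈ c :: T, d.length ≤ j := by
        intro d hd
        rcases List.mem_cons.1 hd with rfl | hd
        · exact hj
        · exact (h1 d hd).trans hj
      rw [rowAt_eq_nil hall, addRow]
      refine List.map_congr_left fun d hd => ?_
      rw [lowCol_of_length_le (hall d hd), lowCol_of_length_le ((hall d hd).trans j.le_succ)]
    · have e : rowAt j (c :: T) = x :: rowAt j T := by simp [rowAt, h]
      rw [e, List.map_cons, addRow, ih h2, List.map_cons, lowCol_succ h]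

/-- The bottom row needs its own statement: the truncation of `T` to height 0 is a list of empty
columns, whereas insertion starts from the empty list. -/
lemma addRow_nil {T : List (List ℕ+)} (hT : ∀ c ∈ T, c ≠ []) :
    addRow (rowAt 0 T) [] = T.map (lowCol 1) := by
  induction T with
  | nil => simp [rowAt, addRow]
  | cons c T ih =>
    rcases h : c.reverse[0]? with _ | x
    · exact absurd (by simpa using h) (hT c (by simp))
    · have e : rowAt 0 (c :: T) = x :: rowAt 0 T := by simp [rowAt] at h ⊢; simp [h]
      rw [e, addRow, ih fun d hd => hT d (by simp [hd]), List.map_cons, lowCol_succ h]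
      simp [lowCol]

lemma below_rowAt {T : List (List ℕ+)} (hT : StrictCols T)
    (hl : T.Pairwise (fun c d => d.length ≤ c.length)) (j : ℕ) :
    Below (rowAt j T) (T.map (lowCol j)) := by
  induction T with
  | nil => simp [rowAt, Below]
  | cons c T ih =>
    obtain ⟨h1, h2⟩ := List.pairwise_cons.1 hl
    rcases h : c.reverse[j]? with _ | x
    · have hj : c.length ≤ j := by simpa using h
      rw [rowAt_eq_nil (by simp; exact ⟨hj, fun d hd => (h1 d hd).trans hj⟩)]
      simp [Below]
    · have e : rowAt j (c :: T) = x :: rowAt j T := by simp [rowAt, h]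
      rw [e, List.map_cons]
      refine ⟨?_, ih (fun d hd => hT d (by simp [hd])) h2⟩
      have hc : Strict (lowCol (j + 1) c) := by
        rw [Strict, lowCol, List.pairwise_reverse]
        refine List.Pairwise.sublist (List.take_sublist _ _) ?_
        rw [List.pairwise_reverse]
        exact hT c (by simp)
      rw [lowCol_succ h] at hc
      exact (List.pairwise_cons.1 hc).1

lemma IsAntiSST.tabOf_lowRows {T : List (List ℕ+)} (hT : IsAntiSST T) (j : ℕ) :
    tabOf (lowRows T (j + 1)) = T.map (lowCol (j + 1)) := by
  induction j with
  | zero =>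
    rw [lowRows, lowRows, tabOf_append (hT.rowAt_sorted 0) (by rw [tabOf_nil]; cases rowAt 0 T <;> simp [Below]),
      tabOf_nil, addRow_nil hT.nonempty]
  | succ j ih =>
    rw [lowRows, tabOf_append (hT.rowAt_sorted _), ih, addRow_rowAt hT.pairwise_length]
    rw [ih]
    exact below_rowAt hT.strictCols hT.pairwise_length _

/-- Insertion proceeds from the end of the word, that is, from the bottom row upwards, and each row
lands on top of the columns built so far. Hence a tableau is determined by its reading word, which
moreover has the same ε and φ as its column word. -/
lemma IsAntiSST.tabOf_readingWord {T : List (List ℕ+)} (hT : IsAntiSST T) :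
    tabOf (readingWord T) = T := by
  rw [readingWord_eq]
  rcases T with _ | ⟨c, T⟩
  · rfl
  · rcases h : c.length with _ | j
    · exact absurd (List.length_eq_zero_iff.1 h) (hT.nonempty c (by simp))
    · rw [List.headD_cons, h, hT.tabOf_lowRows]
      refine (List.map_congr_left fun d hd => ?_).trans (List.map_id _)
      rw [lowCol_of_length_le, id]
      rw [← h]
      rcases List.mem_cons.1 hd with rfl | hd
      · exact le_rfl
      · exact (List.pairwise_cons.1 hT.pairwise_length).1 d hd

lemma IsAntiSST.readingWord_perm {T : List (List ℕ+)} (hT : IsAntiSST T) :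
    (readingWord T).Perm T.flatten := by
  simpa [hT.tabOf_readingWord] using tabOf_perm (readingWord T)

lemma IsAntiSST.ep_readingWord {T : List (List ℕ+)} (hT : IsAntiSST T) (n : ℕ+) :
    ep n (readingWord T) = ep n T.flatten := by
  rw [← ep_tabOf, hT.tabOf_readingWord]

lemma IsAntiSST.ph_readingWord {T : List (List ℕ+)} (hT : IsAntiSST T) (n : ℕ+) :
    ph n (readingWord T) = ph n T.flatten := by
  rw [← ph_tabOf, hT.tabOf_readingWord]

/-! ### Lowering operators on reading words -/

/-- Locates a letter of the reading word in a row `j`. The last clause says that altering this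
single entry of the tableau alters the reading word in this single place. -/
lemma lowRows_split {T : List (List ℕ+)} {N : ℕ} {u v : List ℕ+} {n : ℕ+}
    (h : lowRows T N = u ++ n :: v) :
    ∃ j < N, ∃ x y u', rowAt j T = x ++ n :: y ∧ v = y ++ lowRows T j ∧ u = u' ++ x ∧
      ∀ T' m, (∀ i, i ≠ j → rowAt i T' = rowAt i T) → rowAt j T' = x ++ m :: y →
        lowRows T' N = u ++ m :: v := by
  induction N generalizing u with
  | zero => simp [lowRows] at h
  | succ N ih =>
    rw [lowRows] at h
    have main : ∀ w, u = rowAt N T ++ w → lowRows T N = w ++ n :: v → ∃ j < N + 1, ∃ x y u',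
      rowAt j T = x ++ n :: y ∧ v = y ++ lowRows T j ∧ u = u' ++ x ∧
      ∀ T' m, (∀ i, i ≠ j → rowAt i T' = rowAt i T) → rowAt j T' = x ++ m :: y →
        lowRows T' (N + 1) = u ++ m :: v := by
      rintro w rfl h2
      obtain ⟨j, hj, x, y, u', h3, h4, h5, h6⟩ := ih h2
      refine ⟨j, by omega, x, y, rowAt N T ++ u', h3, h4, by simp [h5], fun T' m i1 i2 => ?_⟩
      rw [lowRows, h6 T' m i1 i2, i1 N (by omega), List.append_assoc]
    rcases List.append_eq_append_iff.1 h with ⟨w, h1, h2⟩ | ⟨w, h1, h2⟩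
    · exact main w h1 h2
    · rcases List.cons_eq_append_iff.1 h2 with ⟨rfl, h3⟩ | ⟨y, rfl, h3⟩
      · exact main [] (by simpa using h1.symm) (by simpa using h3)
      · refine ⟨N, by omega, u, y, [], h1, h3, rfl, fun T' m i1 i2 => ?_⟩
        have : ∀ k ≤ N, lowRows T' k = lowRows T k := by
          intro k hk
          induction k with
          | zero => rfl
          | succ k ihk => rw [lowRows, lowRows, ihk (by omega), i1 k (by omega)]
        rw [lowRows, i2, this N le_rfl, h3]; simp

/-- In a weakly decreasing word every `n + 1` precedes every `n`, so nothing cancels. -/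
lemma ep_eq_count_of_sorted {r : List ℕ+} (hr : r.Pairwise (· ≥ ·)) (n : ℕ+) :
    ep n r = r.count (n + 1) := by
  induction r with
  | nil => simp
  | cons a r ih =>
    obtain ⟨h1, h2⟩ := List.pairwise_cons.1 hr
    rw [ep_cons, ih h2, List.count_cons]
    by_cases ha : a = n
    · subst ha
      have : r.count (a + 1) = 0 := by
        rw [List.count_eq_zero]
        intro h
        exact absurd (h1 _ h) (not_le.2 (PNat.lt_add_right a 1))
      simp [this]
    · simp [ha, add_comm]

lemma count_rowAt_le {T : List (List ℕ+)} {m n : ℕ+} {i j : ℕ}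
    (h : ∀ c ∈ T, c.reverse[j]? = some n → c.reverse[i]? = some m) :
    (rowAt j T).count n ≤ (rowAt i T).count m := by
  induction T with
  | nil => simp [rowAt]
  | cons c T ih =>
    have h1 := h c (by simp)
    have h2 := ih fun d hd => h d (by simp [hd])
    have e : ∀ k, rowAt k (c :: T) = c.reverse[k]?.toList ++ rowAt k T := by
      intro k
      rw [rowAt, List.filterMap_cons]
      rcases c.reverse[k]? with _ | x <;> rfl
    rw [e, e, List.count_append, List.count_append]
    refine Nat.add_le_add ?_ h2
    rcases hx : c.reverse[j]? with _ | x
    · simp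
    · by_cases hxn : x = n
      · subst hxn; rw [h1 hx]; simp
      · simp [hxn]

lemma rowAt_append (j : ℕ) (T U : List (List ℕ+)) : rowAt j (T ++ U) = rowAt j T ++ rowAt j U :=
  List.filterMap_append

/-- Changing the entry `n` to `n + 1` could only break the conditions at an `n + 1` directly below
it or at an `n` directly to its right. The first would leave an uncancelled `n + 1` later in the
reading word, the second an uncancelled `n` earlier; both contradict the choice of the letter. -/
lemma IsAntiSST.fstep_readingWord {T : List (List ℕ+)} (hT : IsAntiSST T) {n : ℕ+} {w : List ℕ+}
    (h : FStep n (readingWord T) w) :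
    ∃ T', IsAntiSST T' ∧ GlInf.shape T' = GlInf.shape T ∧ readingWord T' = w := by
  obtain ⟨u, v, h1, rfl, hv, hu⟩ := h
  rw [readingWord_eq] at h1
  obtain ⟨j, hj, x, y, u', hrow, rfl, rfl, hnew⟩ := lowRows_split h1
  obtain ⟨T₁, c, T₂, rfl, hx', hc, hy⟩ : ∃ T₁ c T₂, T = T₁ ++ c :: T₂ ∧ rowAt j T₁ = x ∧
      c.reverse[j]? = some n ∧ rowAt j T₂ = y := by
    obtain ⟨T₁, T₂', rfl, hx, h3⟩ := List.filterMap_eq_append_iff.1 hrow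
    obtain ⟨A, c, T₂, rfl, hA, hc, hy⟩ := List.filterMap_eq_cons_iff.1 h3
    refine ⟨T₁ ++ A, c, T₂, by simp, ?_, hc, hy⟩
    rw [rowAt_append, show rowAt j A = [] from List.filterMap_eq_nil_iff.2 hA, List.append_nil]
    exact hx
  obtain ⟨hne, hst, hch⟩ := (isAntiSST_iff _).1 hT
  have hcs : Strict c := hst c (by simp)
  have hpw := List.pairwise_append.1 hT.pairwise_dom
  obtain ⟨hjl, hcj⟩ := List.getElem?_eq_some_iff.1 hc
  have hsplit : c.reverse = c.reverse.take j ++ n :: c.reverse.drop (j + 1) := by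
    rw [← hcj, List.cons_getElem_drop_succ, List.take_append_drop]
  have hpl : (c.reverse.take j).length = j := by simp at hjl ⊢; omega
  generalize c.reverse.take j = p at hsplit hpl
  generalize c.reverse.drop (j + 1) = q at hsplit
  have hcpq : c = q.reverse ++ n :: p.reverse := by
    have := congrArg List.reverse hsplit; simpa using this
  have hs' := hcs
  rw [Strict, hcpq, List.pairwise_append, List.pairwise_cons] at hs'
  have hpn : ∀ z ∈ p, n < z := fun z hz => hs'.2.1.1 z (by simpa using hz)
  -- If `n + 1` stood directly below, then every `n` further left in the row would also have an `n +
  -- 1` below it. The lower row would thus hold more letters `n + 1` than there are letters `n` in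
  -- `y` to cancel them, against `hv`.
  have hkey : n + 1 ∉ p := by
    intro hmem
    have hp' : p.Pairwise (· > ·) := by
      have := hs'.2.1.2; rwa [List.pairwise_reverse] at this
    obtain ⟨p0, p1, rfl⟩ := List.append_of_mem hmem
    have hp1 : p1 = [] := by
      rw [List.eq_nil_iff_forall_not_mem]
      intro z hz
      have h5 : z < n + 1 := (List.pairwise_cons.1 (List.pairwise_append.1 hp').2.1).1 z hz
      exact absurd (hpn z (by simp [hz])) (not_lt.2 (PNat.lt_add_one_iff.1 h5))
    subst hp1
    obtain ⟨i, rfl⟩ : ∃ i, j = i + 1 := ⟨p0.length, by simp at hpl; exact hpl.symm⟩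
    have hp0 : p0.length = i := by simpa using hpl
    have hci : c.reverse[i]? = some (n + 1) := by
      rw [hsplit, ← hp0]; simp
    have hle : y.count n ≤ (rowAt i T₂).count (n + 1) := by
      rw [← hy]
      refine count_rowAt_le fun d hd hdn => ?_
      have hds : Strict d := hst d (by simp [hd])
      have hcd : Dom c d := (List.pairwise_cons.1 hpw.2.1).1 d hd
      obtain ⟨hil, hi⟩ := List.getElem?_eq_some_iff.1 hdn
      have hlt : i < d.reverse.length := by omega
      have h6 : d.reverse[i]? = some d.reverse[i] := List.getElem?_eq_getElem hlt
      rw [h6]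
      have h7 := ((dom_iff hcs hds).1 hcd).2 i _ _ hci h6
      have h8 : n < d.reverse[i] := by
        have : d.reverse.Pairwise (· > ·) := by rw [List.pairwise_reverse]; exact hds
        rw [← hi]
        exact List.pairwise_iff_getElem.1 this i (i + 1) hlt hil (by omega)
      exact congrArg some (le_antisymm h7 (PNat.add_one_le_iff.2 h8))
    have hrs := hT.rowAt_sorted i
    have e1 := ep_eq_count_of_sorted hrs n
    have e2 : (rowAt i (T₁ ++ c :: T₂)).count (n + 1) ≥ (rowAt i T₂).count (n + 1) + 1 := by
      rw [rowAt_append, List.count_append, rowAt, rowAt, List.filterMap_cons, hci]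
      simp [rowAt]
    rw [ep_append, lowRows, ep_append] at hv
    have := ph_le_count n y
    omega
  set c' := q.reverse ++ (n + 1) :: p.reverse with hc'
  have hc's : Strict c' := by
    rw [Strict, hc', List.pairwise_append, List.pairwise_cons]
    refine ⟨hs'.1, ⟨fun z hz => ?_, hs'.2.1.2⟩, fun a ha b hb => ?_⟩
    · have hz : z ∈ p := by simpa using hz
      exact lt_of_le_of_ne (PNat.add_one_le_iff.2 (hpn z hz)) fun e => hkey (e ▸ hz)
    · rcases List.mem_cons.1 hb with rfl | hb
      · exact (hs'.2.2 a ha n (by simp)).trans (PNat.lt_add_right n 1)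
      · exact hs'.2.2 a ha b (by simp [hb])
  have hrev : c'.reverse = p ++ (n + 1) :: q := by simp [hc']
  have hlen : c'.length = c.length := by rw [hcpq, hc']; simp
  have hget : ∀ i, i ≠ j → c'.reverse[i]? = c.reverse[i]? := by
    intro i hi
    rw [hrev, hsplit]
    rcases lt_or_gt_of_ne hi with h5 | h5
    · rw [List.getElem?_append_left (by omega), List.getElem?_append_left (by omega)]
    · rw [List.getElem?_append_right (by omega), List.getElem?_append_right (by omega), hpl]
      obtain ⟨k, hk⟩ : ∃ k, i - j = k + 1 := ⟨i - j - 1, by omega⟩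
      simp [hk]
  have hgetj : c'.reverse[j]? = some (n + 1) := by rw [hrev, ← hpl]; simp
  have hshape : GlInf.shape (T₁ ++ c' :: T₂) = GlInf.shape (T₁ ++ c :: T₂) := by
    simp [GlInf.shape, hlen]
  refine ⟨T₁ ++ c' :: T₂, ?_, hshape, ?_⟩
  · rw [isAntiSST_iff]
    refine ⟨?_, ?_, ?_⟩
    · intro d hd
      rcases List.mem_append.1 hd with hd | hd
      · exact hne d (by simp [hd])
      · rcases List.mem_cons.1 hd with rfl | hd
        · simp [hc']
        · exact hne d (by simp [hd])
    · intro d hd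
      rcases List.mem_append.1 hd with hd | hd
      · exact hst d (by simp [hd])
      · rcases List.mem_cons.1 hd with rfl | hd
        · exact hc's
        · exact hst d (by simp [hd])
    · rw [List.isChain_append, List.isChain_cons] at hch ⊢
      refine ⟨hch.1, ⟨fun d hd z => (hch.2.1.1 d hd z).trans ?_, hch.2.1.2⟩, ?_⟩
      · rw [hcpq, hc']
        simp only [cnt, List.countP_append, List.countP_cons, decide_eq_true_eq]
        by_cases hz : z ≤ n
        · simp [hz, hz.trans (PNat.lt_add_right n 1).le]
        · simp [hz]
      · intro e he d hd
        simp only [List.head?_cons, Option.mem_def, Option.some.injEq] at hd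
        subst hd
        have heT : e ∈ T₁ := List.mem_of_getLast? he
        have hes : Strict e := hst e (by simp [heT])
        have hec := (dom_iff hes hcs).1 (hch.2.2 e he c (by simp))
        rw [dom_iff hes hc's, hlen]
        refine ⟨hec.1, fun i a b ha hb => ?_⟩
        by_cases hi : i = j
        · subst hi
          rw [hgetj] at hb
          obtain rfl : n + 1 = b := by simpa using hb
          -- The entry to the right in the same row is at least `n`. Were it equal to `n`, it would
          -- be the letter read just before, hence an uncancelled `n` in the left part, against
          -- `hu`.
          have h5 := hec.2 i a n ha hc
          refine PNat.add_one_le_iff.2 (lt_of_le_of_ne h5 ?_)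
          rintro rfl
          obtain ⟨T₀, rfl⟩ := List.getLast?_eq_some_iff.1 he
          rw [← hx', rowAt_append] at hu
          have : rowAt i [e] = [n] := by simp only [rowAt, List.filterMap_cons, ha]; rfl
          rw [this, ← List.append_assoc, ph_append] at hu
          simp [ph_singleton] at hu
        · rw [hget i hi] at hb
          exact hec.2 i a b ha hb
  · rw [readingWord_eq]
    have e : ((T₁ ++ c' :: T₂).headD []).length = ((T₁ ++ c :: T₂).headD []).length := by
      rcases T₁ with _ | ⟨d, T₁⟩
      · simp [hlen]
      · simp
    rw [e]
    apply hnew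
    · intro i hi
      rw [rowAt_append, rowAt_append]
      simp only [rowAt, List.filterMap_cons, hget i hi]
    · rw [rowAt_append, hx', rowAt, List.filterMap_cons, hgetj]
      simp only
      rw [← hy, rowAt]

/-- Lowering the reading word of a tableau lowers its column word in the same way. -/
lemma eq_of_fstep_flatten {n : ℕ+} {T U U' : List (List ℕ+)} (h : FStep n T.flatten U.flatten)
    (h' : FStep n T.flatten U'.flatten) (hs : shape U = shape U') : U = U' :=
  List.eq_iff_flatten_eq.2 ⟨h.unique h', hs⟩

/-- The reading word of `tabOf w` can be lowered, with a reading word of some tableau of the same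
shape as result. Inserting again shows that this tableau and `tabOf w'` both lower the column word
of `tabOf w`, so they coincide. -/
lemma FStep.readingWord_tabOf {n : ℕ+} {w w' : List ℕ+} (h : FStep n w w') :
    FStep n (readingWord (GlInf.tabOf w)) (readingWord (GlInf.tabOf w')) := by
  have hT := isAntiSST_tabOf w
  obtain ⟨h1, h2⟩ := h.tabOf
  have hpos : 0 < ph n (readingWord (GlInf.tabOf w)) := by
    rw [hT.ph_readingWord, ph_tabOf, h.ph_eq]; omega
  obtain ⟨w₁, hw₁⟩ := FStep.exists_of_ph_pos hpos
  obtain ⟨T', hT', hs, rfl⟩ := hT.fstep_readingWord hw₁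
  have h3 := hw₁.tabOf.1
  rw [hT.tabOf_readingWord, hT'.tabOf_readingWord] at h3
  rwa [← eq_of_fstep_flatten h3 h1 (by rw [hs, h2])]

/-! ### Tableaux of highest weight -/

/-- The column consists of the letters `1, …, l`. -/
def Full (c : List ℕ+) : Prop := ∀ n, n + 1 ∈ c → n ∈ c

lemma Full.mem_of_le {c : List ℕ+} (hc : Full c) {x y : ℕ+} (hx : x ∈ c) (hy : y ≤ x) : y ∈ c := by
  induction x using PNat.recOn with
  | one => rwa [le_antisymm hy one_le]
  | succ n ih =>
    rcases eq_or_lt_of_le hy with rfl | hlt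
    · exact hx
    · exact ih (hc n hx) (PNat.lt_add_one_iff.1 hlt)

lemma Full.mem_of_dom {c d : List ℕ+} (hc : Full c) (h : Dom c d) {x : ℕ+} (hx : x ∈ d) : x ∈ c := by
  have h1 : 0 < cnt x c := (List.countP_pos_iff.2 ⟨x, hx, by simp⟩).trans_le (h x)
  obtain ⟨y, hy, hxy⟩ := List.countP_pos_iff.1 h1
  exact hc.mem_of_le hy (by simpa using hxy)

lemma Full.eq_of_length_eq {c d : List ℕ+} (hc : Full c) (hd : Full d) (hcs : Strict c)
    (hds : Strict d) (h : c.length = d.length) : c = d := by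
  have key : ∀ {c d : List ℕ+}, Full c → Full d → Strict d → c.length = d.length →
      ∀ x, x ∈ c → x ∈ d := by
    intro c d hc hd hds h x hx
    by_contra hxd
    have hsub : x :: d ⊆ c := by
      intro y hy
      rcases List.mem_cons.1 hy with rfl | hy
      · exact hx
      · refine hc.mem_of_le hx ?_
        by_contra hlt
        exact hxd (hd.mem_of_le hy (not_le.1 hlt).le)
    have hnd : (x :: d).Nodup := List.nodup_cons.2 ⟨hxd, hds.imp fun h => h.ne⟩
    have := (List.subperm_of_subset hnd hsub).length_le
    simp at this; omega
  exact hcs.ext hds fun x => ⟨key hc hd hds h x, key hd hc hcs h.symm x⟩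

lemma IsAntiSST.tail {c : List ℕ+} {T : List (List ℕ+)} (h : IsAntiSST (c :: T)) : IsAntiSST T := by
  rw [isAntiSST_iff, List.isChain_cons] at h
  rw [isAntiSST_iff]
  exact ⟨fun d hd => h.1 d (by simp [hd]), fun d hd => h.2.1 d (by simp [hd]), h.2.2.2⟩

lemma ph_flatten_eq_zero {n : ℕ+} {T : List (List ℕ+)} (h : ∀ c ∈ T, ph n c = 0) :
    ph n T.flatten = 0 := by
  induction T with
  | nil => simp
  | cons c T ih =>
    rw [List.flatten_cons, ph_append, h c (by simp), ih fun d hd => h d (by simp [hd])]; simp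

/-- Induct on the columns from right to left. If `n + 1` lies in the new left-most column without
`n`, it can only be cancelled by an `n` of an earlier column. But an earlier column dominates it and
is full, so it contains `n + 1` too and has no uncancelled `n`. -/
lemma IsAntiSST.full {T : List (List ℕ+)} (hT : IsAntiSST T) (h : ∀ n, ep n T.flatten = 0) :
    ∀ c ∈ T, Full c := by
  have hd := hT.pairwise_dom
  have hs := hT.strictCols
  clear hT
  induction T using List.reverseRecOn with
  | nil => simp
  | append_singleton T d ih =>
    simp only [List.flatten_append, List.flatten_singleton, ep_append] at h
    rw [List.pairwise_append] at hd
    have ih := ih (fun n => by have := h n; omega) hd.1 fun c hc => hs c (by simp [hc])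
    intro c hc
    rcases List.mem_append.1 hc with hc | hc
    · exact ih c hc
    · obtain rfl : c = d := by simpa using hc
      intro n hn
      by_contra hn'
      have h1 := h n
      rw [(hs c (by simp)).ep_eq, ph_flatten_eq_zero] at h1
      · simp [hn, hn'] at h1
      · intro e he
        rw [(hs e (by simp [he])).ph_eq]
        have := (ih e he).mem_of_dom (hd.2.2 e he c (by simp)) hn
        simp [this]

lemma eq_of_full_of_shape {T U : List (List ℕ+)} (hT : StrictCols T) (hU : StrictCols U)
    (hTf : ∀ c ∈ T, Full c) (hUf : ∀ c ∈ U, Full c) (h : shape T = shape U) : T = U := by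
  induction T generalizing U with
  | nil => simpa [shape] using h.symm
  | cons c T ih =>
    rcases U with _ | ⟨d, U⟩
    · simp [shape] at h
    simp only [shape, List.map_cons, List.cons.injEq] at h
    rw [(hTf c (by simp)).eq_of_length_eq (hUf d (by simp)) (hT c (by simp)) (hU d (by simp)) h.1,
      ih (fun e he => hT e (by simp [he])) (fun e he => hU e (by simp [he]))
        (fun e he => hTf e (by simp [he])) (fun e he => hUf e (by simp [he])) h.2]

/-- The right-most column dominates the others and is full, so its letters are exactly the letters
occurring in the tableau. Remove it and repeat. -/
lemma eq_of_full_of_perm {T U : List (List ℕ+)} (hT : IsAntiSST T) (hU : IsAntiSST U)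
    (hTf : ∀ c ∈ T, Full c) (hUf : ∀ c ∈ U, Full c) (h : T.flatten.Perm U.flatten) : T = U := by
  have key : ∀ {c : List ℕ+} {T : List (List ℕ+)}, IsAntiSST (c :: T) → Full c →
      ∀ x, x ∈ (c :: T).flatten ↔ x ∈ c := by
    intro c T hT hc x
    rw [List.flatten_cons, List.mem_append, or_iff_left_iff_imp, List.mem_flatten]
    rintro ⟨d, hd, hx⟩
    exact hc.mem_of_dom ((List.pairwise_cons.1 hT.pairwise_dom).1 d hd) hx
  induction T generalizing U with
  | nil =>
    rcases U with _ | ⟨d, U⟩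
    · rfl
    · simp at h; exact absurd h.1 (hU.nonempty d (by simp))
  | cons c T ih =>
    rcases U with _ | ⟨d, U⟩
    · simp at h; exact absurd h.1 (hT.nonempty c (by simp))
    have hcd : c = d := Strict.ext (hT.column c (by simp)) (hU.column d (by simp)) fun x => by
      rw [← key hT (hTf c (by simp)), h.mem_iff, key hU (hUf d (by simp))]
    subst hcd
    rw [List.flatten_cons, List.flatten_cons, List.perm_append_left_iff] at h
    rw [ih hT.tail hU.tail (fun e he => hTf e (by simp [he])) (fun e he => hUf e (by simp [he])) h]

/-! ### Matrices and their words -/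

/-- The transposed matrix. -/
noncomputable def matT (A : Mat) : Mat := Multiset.toFinsupp ((Finsupp.toMultiset A).map Prod.swap)

@[simp] lemma matT_apply (A : Mat) (i j : ℕ+) : matT A (i, j) = A (j, i) := by
  rw [matT, Multiset.toFinsupp_apply, show (i, j) = Prod.swap (j, i) from rfl,
    Multiset.count_map_eq_count' _ _ Prod.swap_injective, Finsupp.count_toMultiset]

lemma mat_ext {A B : Mat} (h : ∀ i j, A (i, j) = B (i, j)) : A = B :=
  Finsupp.ext fun p => h p.1 p.2

@[simp] lemma matT_matT (A : Mat) : matT (matT A) = A := mat_ext (by simp)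

lemma matT_injective : Function.Injective matT := Function.LeftInverse.injective matT_matT

lemma seqΩ'_sorted (A : Mat) : (seqΩ' A).Pairwise leΩ' := Multiset.pairwise_sort _ _

lemma coe_seqΩ' (A : Mat) : (seqΩ' A : Multiset (ℕ+ × ℕ+)) = Finsupp.toMultiset A :=
  Multiset.sort_eq _ _

lemma count_seqΩ' (A : Mat) (p : ℕ+ × ℕ+) : (seqΩ' A).count p = A p := by
  rw [← Finsupp.count_toMultiset, ← coe_seqΩ', Multiset.coe_count]
  congr!

lemma mem_seqΩ' {A : Mat} {p : ℕ+ × ℕ+} : p ∈ seqΩ' A ↔ A p ≠ 0 := by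
  rw [← count_seqΩ', ← List.count_pos_iff]; omega

lemma seqΩ'_eq {A : Mat} {s : List (ℕ+ × ℕ+)} (hs : s.Pairwise leΩ') (h : ∀ p, s.count p = A p) :
    seqΩ' A = s :=
  List.Perm.eq_of_pairwise (le := leΩ') (fun a b _ _ h1 h2 => Std.Antisymm.antisymm a b h1 h2)
    (seqΩ'_sorted A) hs (List.perm_iff_count.2 fun p => by rw [count_seqΩ', h])

lemma leΩ'_trans {p q r : ℕ+ × ℕ+} (h1 : leΩ' p q) (h2 : leΩ' q r) : leΩ' p r :=
  IsTrans.trans _ _ _ h1 h2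

/-- Swapping coordinates turns the order of Ω' into that of Ω; this is what reduces negative indices
to positive ones on the transpose. -/
lemma seqΩ_eq (A : Mat) : seqΩ A = (seqΩ' (matT A)).map Prod.swap := by
  refine List.Perm.eq_of_pairwise (le := leΩ) (fun a b _ _ h1 h2 => Std.Antisymm.antisymm a b h1 h2)
    (Multiset.pairwise_sort _ _) ?_ ?_
  · rw [List.pairwise_map]
    exact (seqΩ'_sorted (matT A)).imp fun h => by
      rcases h with h | ⟨h1, h2⟩
      · exact Or.inl h
      · exact Or.inr ⟨h1, h2⟩
  · rw [← Multiset.coe_eq_coe, seqΩ, Multiset.sort_eq, ← Multiset.map_coe, coe_seqΩ', matT,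
      Multiset.toFinsupp_toMultiset, Multiset.map_map]
    simp

lemma wordI_eq (A : Mat) : wordI A = wordL (matT A) := by
  rw [wordI, seqΩ_eq, List.map_map, wordL]; rfl

lemma wordJ_eq (A : Mat) : wordJ A = wordK (matT A) := by
  rw [wordJ, seqΩ_eq, List.map_map, wordK]; rfl

lemma matOf_apply (u v : List ℕ+) (p : ℕ+ × ℕ+) : matOf u v p = (List.zip u v).count p := by
  rw [matOf, Multiset.toFinsupp_apply, Multiset.coe_count]
  congr!

lemma zip_map_fst_snd {α β : Type*} (s : List (α × β)) :
    List.zip (s.map Prod.fst) (s.map Prod.snd) = s := (List.zip_of_prod rfl rfl).symm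

lemma matOf_seq (s : List (ℕ+ × ℕ+)) (p : ℕ+ × ℕ+) :
    matOf (s.map Prod.fst) (s.map Prod.snd) p = s.count p := by
  rw [matOf_apply, zip_map_fst_snd]

lemma matOf_wordK_wordL (A : Mat) : matOf (wordK A) (wordL A) = A :=
  Finsupp.ext fun p => by rw [wordK, wordL, matOf_seq, count_seqΩ']

lemma matOf_swap (u v : List ℕ+) : matOf u v = matT (matOf v u) := by
  refine mat_ext fun i j => ?_
  rw [matT_apply, matOf_apply, matOf_apply, ← List.zip_swap, show (i, j) = Prod.swap (j, i) from rfl,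
    List.count_map_of_injective _ _ Prod.swap_injective]

lemma tabQ_eq (A : Mat) : tabQ A = tabOf (wordL A) := insertionTableau_reverse _

lemma tabP_eq (A : Mat) : tabP A = tabOf (wordL (matT A)) := by
  rw [tabP, insertionTableau_reverse, wordI_eq]

/-! ### The lowering operators on matrices -/

/-- The lowering operator of index `n > 0` changes `A` to `B`. -/
def MStep (n : ℕ+) (A B : Mat) : Prop :=
  ∃ s₁ k s₂, seqΩ' A = s₁ ++ (k, n) :: s₂ ∧ seqΩ' B = s₁ ++ (k, n + 1) :: s₂ ∧
    ep n (s₂.map Prod.snd) = 0 ∧ ph n (s₁.map Prod.snd) = 0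

namespace MStep

variable {n : ℕ+} {A B : Mat}

lemma fstep (h : MStep n A B) : FStep n (wordL A) (wordL B) := by
  obtain ⟨s₁, k, s₂, h1, h2, h3, h4⟩ := h
  exact ⟨s₁.map Prod.snd, s₂.map Prod.snd, by simp [wordL, h1], by simp [wordL, h2], h3, h4⟩

lemma wordK_eq (h : MStep n A B) : wordK B = wordK A := by
  obtain ⟨s₁, k, s₂, h1, h2, h3, h4⟩ := h
  simp [wordK, h1, h2]

lemma eq_left (h : MStep n A B) : A = matOf (wordK B) (wordL A) := by
  rw [h.wordK_eq, matOf_wordK_wordL]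

lemma eq_right (h : MStep n A B) : B = matOf (wordK A) (wordL B) := by
  rw [← h.wordK_eq, matOf_wordK_wordL]

end MStep

/-- The point is that the biword stays sorted, so that the new word really is the word of the new
matrix. Sortedness could only fail if the preceding letter were an `n` in the same row, but that
would be an uncancelled `n` to the left of the changed one. -/
lemma exists_mstep_of_fstep_left {n : ℕ+} {A : Mat} {w : List ℕ+} (h : FStep n (wordL A) w) :
    MStep n A (matOf (wordK A) w) ∧ wordL (matOf (wordK A) w) = w := by
  obtain ⟨u, v, h1, rfl, h2, h3⟩ := h
  obtain ⟨s₁, s', hs, rfl, h4⟩ := List.map_eq_append_iff.1 h1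
  obtain ⟨⟨k, n'⟩, s₂, rfl, h5, rfl⟩ := List.map_eq_cons_iff.1 h4
  obtain rfl : n' = n := h5
  have hsort := seqΩ'_sorted A
  rw [hs, List.pairwise_append, List.pairwise_cons] at hsort
  have hzip : ∀ p, matOf (wordK A) (s₁.map Prod.snd ++ (n' + 1) :: s₂.map Prod.snd) p =
      (s₁ ++ (k, n' + 1) :: s₂).count p := by
    intro p
    have := matOf_seq (s₁ ++ (k, n' + 1) :: s₂) p
    simpa [wordK, hs] using this
  have hlt := PNat.lt_add_right n' 1
  have hseq : seqΩ' (matOf (wordK A) (s₁.map Prod.snd ++ (n' + 1) :: s₂.map Prod.snd)) =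
      s₁ ++ (k, n' + 1) :: s₂ := by
    refine seqΩ'_eq ?_ fun p => (hzip p).symm
    rw [List.pairwise_append, List.pairwise_cons]
    refine ⟨hsort.1, ⟨fun q hq => leΩ'_trans ?_ (hsort.2.1.1 q hq), hsort.2.1.2⟩, ?_⟩
    · exact Or.inr ⟨rfl, hlt.le⟩
    · have hlast : ∀ q ∈ s₁, leΩ' q (k, n' + 1) := by
        rcases List.eq_nil_or_concat s₁ with rfl | ⟨t, y, rfl⟩
        · simp
        · rw [List.concat_eq_append] at *
          have hy : leΩ' y (k, n' + 1) := by
            rcases hsort.2.2 y (by simp) (k, n') (by simp) with h6 | ⟨h6, h7⟩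
            · exact Or.inl h6
            · refine Or.inr ⟨h6, PNat.add_one_le_iff.2 (lt_of_le_of_ne h7 ?_)⟩
              intro h8
              simp only [List.map_append, List.map_cons, List.map_nil] at h3
              rw [ph_append, ← h8] at h3
              simp [ph_singleton] at h3
          intro q hq
          rcases List.mem_append.1 hq with hq | hq
          · exact leΩ'_trans ((List.pairwise_append.1 hsort.1).2.2 q hq y (by simp)) hy
          · obtain rfl : q = y := by simpa using hq
            exact hy
      intro q hq r hr
      rcases List.mem_cons.1 hr with rfl | hr
      · exact hlast q hq
      · exact hsort.2.2 q hq r (by simp [hr])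
  exact ⟨⟨s₁, k, s₂, hs, hseq, h2, h3⟩, by simp [wordL, hseq]⟩

/-- Mirror image of the preceding lemma: the danger is now an `n + 1` directly after the changed
letter in the same row, which would be an uncancelled `n + 1` to its right. -/
lemma exists_mstep_of_fstep_right {n : ℕ+} {B : Mat} {w : List ℕ+} (h : FStep n w (wordL B)) :
    MStep n (matOf (wordK B) w) B ∧ wordL (matOf (wordK B) w) = w := by
  obtain ⟨u, v, rfl, h1, h2, h3⟩ := h
  obtain ⟨s₁, s', hs, rfl, h4⟩ := List.map_eq_append_iff.1 h1
  obtain ⟨⟨k, n'⟩, s₂, rfl, h5, rfl⟩ := List.map_eq_cons_iff.1 h4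
  obtain rfl : n' = n + 1 := h5
  have hsort := seqΩ'_sorted B
  rw [hs, List.pairwise_append, List.pairwise_cons] at hsort
  have hzip : ∀ p, matOf (wordK B) (s₁.map Prod.snd ++ n :: s₂.map Prod.snd) p =
      (s₁ ++ (k, n) :: s₂).count p := by
    intro p
    have := matOf_seq (s₁ ++ (k, n) :: s₂) p
    simpa [wordK, hs] using this
  have hlt := PNat.lt_add_right n 1
  have hseq : seqΩ' (matOf (wordK B) (s₁.map Prod.snd ++ n :: s₂.map Prod.snd)) =
      s₁ ++ (k, n) :: s₂ := by
    refine seqΩ'_eq ?_ fun p => (hzip p).symm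
    rw [List.pairwise_append, List.pairwise_cons]
    refine ⟨hsort.1, ⟨?_, hsort.2.1.2⟩, ?_⟩
    · rcases s₂ with _ | ⟨y, t⟩
      · simp
      · have hy : leΩ' (k, n) y := by
          rcases hsort.2.1.1 y (by simp) with h6 | ⟨h6, h7⟩
          · exact Or.inl h6
          · refine Or.inr ⟨h6, PNat.lt_add_one_iff.1 (lt_of_le_of_ne h7 ?_)⟩
            intro h8
            simp only [List.map_cons] at h2
            rw [ep_cons, h8] at h2
            simp at h2
        intro q hq
        rcases List.mem_cons.1 hq with rfl | hq
        · exact hy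
        · exact leΩ'_trans hy ((List.pairwise_cons.1 hsort.2.1.2).1 q hq)
    · intro q hq r hr
      rcases List.mem_cons.1 hr with rfl | hr
      · exact leΩ'_trans (hsort.2.2 q hq (k, n + 1) (by simp)) (Or.inr ⟨rfl, hlt.le⟩)
      · exact hsort.2.2 q hq r (by simp [hr])
  exact ⟨⟨s₁, k, s₂, hseq, hs, h2, h3⟩, by simp [wordL, hseq]⟩

lemma wordF_map_iff {C : CrystalData ℕ+} {i : ℤ} {n : ℕ+} (h : IsLetter C i n) (A B : Mat) :
    (wordF C i (wordL A)).map (fun v => matOf (wordK A) v) = some B ↔ MStep n A B := by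
  rw [Option.map_eq_some_iff]
  simp only [h.wordF_eq_some_iff]
  constructor
  · rintro ⟨w, hw, rfl⟩
    exact (exists_mstep_of_fstep_left hw).1
  · exact fun hs => ⟨_, hs.fstep, hs.eq_right.symm⟩

lemma wordE_map_iff {C : CrystalData ℕ+} {i : ℤ} {n : ℕ+} (h : IsLetter C i n) (A B : Mat) :
    (wordE C i (wordL B)).map (fun v => matOf (wordK B) v) = some A ↔ MStep n A B := by
  rw [Option.map_eq_some_iff]
  simp only [h.wordE_eq_some_iff]
  constructor
  · rintro ⟨w, hw, rfl⟩
    exact (exists_mstep_of_fstep_right hw).1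
  · exact fun hs => ⟨_, hs.fstep, hs.eq_left.symm⟩

lemma MStep.exists_of_ph_pos {n : ℕ+} {A : Mat} (h : 0 < ph n (wordL A)) : ∃ B, MStep n A B := by
  obtain ⟨w, hw⟩ := FStep.exists_of_ph_pos h
  exact ⟨_, (exists_mstep_of_fstep_left hw).1⟩

lemma MStep.exists_of_ep_pos {n : ℕ+} {B : Mat} (h : 0 < ep n (wordL B)) : ∃ A, MStep n A B := by
  obtain ⟨w, hw⟩ := FStep.exists_of_ep_pos h
  exact ⟨_, (exists_mstep_of_fstep_right hw).1⟩

lemma MStep.unique {n : ℕ+} {A B B' : Mat} (h : MStep n A B) (h' : MStep n A B') : B = B' := by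
  rw [h.eq_right, h'.eq_right, h.fstep.unique h'.fstep]

/-! ### Row by row description -/

/-- The word of the rows `≥ r`. -/
noncomputable def rowsGe (A : Mat) (r : ℕ+) : List ℕ+ :=
  ((seqΩ' A).filter (fun p => r ≤ p.1)).map Prod.snd

/-- The word of the rows `< r`. -/
noncomputable def rowsLt (A : Mat) (r : ℕ+) : List ℕ+ :=
  ((seqΩ' A).filter (fun p => p.1 < r)).map Prod.snd

/-- The word of the row `r`. -/
noncomputable def matRow (A : Mat) (r : ℕ+) : List ℕ+ :=
  ((seqΩ' A).filter (fun p => p.1 = r)).map Prod.snd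

lemma filter_append_filter {s : List (ℕ+ × ℕ+)} (hs : s.Pairwise leΩ') (r : ℕ+) :
    s = s.filter (fun p => p.1 < r) ++ s.filter (fun p => r ≤ p.1) := by
  induction s with
  | nil => simp
  | cons a s ih =>
    obtain ⟨h1, h2⟩ := List.pairwise_cons.1 hs
    have ih := ih h2
    by_cases ha : a.1 < r
    · simp only [List.filter_cons, ha, decide_true, if_true, not_le.2 ha, decide_false,
        List.cons_append]
      simpa using ih
    · have h3 : ∀ b ∈ a :: s, r ≤ b.1 := by
        intro b hb
        rcases List.mem_cons.1 hb with rfl | hb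
        · exact not_lt.1 ha
        · rcases h1 b hb with h4 | h4
          · exact (not_lt.1 ha).trans h4.le
          · exact h4.1 ▸ not_lt.1 ha
      rw [List.filter_eq_nil_iff.2 (by intro b hb; simpa using h3 b hb), List.nil_append,
        List.filter_eq_self.2 (by intro b hb; simpa using h3 b hb)]

lemma filter_ge_eq {s : List (ℕ+ × ℕ+)} (hs : s.Pairwise leΩ') (r : ℕ+) :
    s.filter (fun p => r ≤ p.1) =
      s.filter (fun p => p.1 = r) ++ s.filter (fun p => r + 1 ≤ p.1) := by
  have h := filter_append_filter (hs.filter (fun p => r ≤ p.1)) (r + 1)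
  rw [List.filter_filter, List.filter_filter] at h
  rw [h]
  congr 2
  · funext p
    simp only [PNat.lt_add_one_iff, ← Bool.decide_and, decide_eq_decide]
    exact ⟨fun h => le_antisymm h.1 h.2, fun h => ⟨h.le, h.ge⟩⟩
  · funext p
    simp only [← Bool.decide_and, decide_eq_decide, and_iff_left_iff_imp]
    exact fun h => (PNat.lt_add_right r 1).le.trans h

lemma rowsGe_eq (A : Mat) (r : ℕ+) : rowsGe A r = matRow A r ++ rowsGe A (r + 1) := by
  rw [rowsGe, filter_ge_eq (seqΩ'_sorted A), List.map_append, matRow, rowsGe]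

lemma rowsLt_succ (A : Mat) (r : ℕ+) : rowsLt A (r + 1) = rowsLt A r ++ matRow A r := by
  have h := filter_append_filter ((seqΩ'_sorted A).filter (fun p => p.1 < r + 1)) r
  rw [List.filter_filter, List.filter_filter] at h
  rw [rowsLt, h, List.map_append, matRow, rowsLt]
  congr 3
  · funext p
    simp only [← Bool.decide_and, decide_eq_decide, and_iff_left_iff_imp]
    exact fun h => h.trans (PNat.lt_add_right r 1)
  · funext p
    simp only [PNat.lt_add_one_iff, ← Bool.decide_and, decide_eq_decide]
    exact ⟨fun h => le_antisymm h.2 h.1, fun h => ⟨h.ge, h.le⟩⟩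

lemma wordL_eq_append (A : Mat) (r : ℕ+) : wordL A = rowsLt A r ++ rowsGe A r := by
  rw [rowsLt, rowsGe, ← List.map_append, ← filter_append_filter (seqΩ'_sorted A), wordL]

lemma rowsLt_one (A : Mat) : rowsLt A 1 = [] := by
  rw [rowsLt, List.map_eq_nil_iff, List.filter_eq_nil_iff]
  intro p _; simp

lemma rowsGe_one (A : Mat) : rowsGe A 1 = wordL A := by
  rw [wordL_eq_append A 1, rowsLt_one, List.nil_append]

lemma matRow_sorted (A : Mat) (r : ℕ+) : (matRow A r).Pairwise (· ≥ ·) := by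
  rw [matRow, List.pairwise_map]
  refine List.Pairwise.imp_of_mem (fun {p q} hp hq h => ?_)
    ((seqΩ'_sorted A).filter (fun p => p.1 = r))
  have h1 : p.1 = r := by simpa using (List.mem_filter.1 hp).2
  have h2 : q.1 = r := by simpa using (List.mem_filter.1 hq).2
  rcases h with h | h
  · rw [h1, h2] at h; exact absurd h (lt_irrefl _)
  · exact h.2

lemma count_matRow (A : Mat) (r n : ℕ+) : (matRow A r).count n = A (r, n) := by
  rw [matRow, ← count_seqΩ', List.count_eq_countP, List.countP_map, List.countP_filter,
    List.count_eq_countP]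
  congr 1; funext p
  rcases p with ⟨a, b⟩
  simp [Prod.ext_iff, beq_eq_decide, Bool.and_comm]

lemma ph_eq_count_of_sorted {r : List ℕ+} (hr : r.Pairwise (· ≥ ·)) (n : ℕ+) :
    ph n r = r.count n := by
  have := ph_add_count n r
  rw [ep_eq_count_of_sorted hr] at this
  omega

lemma ep_matRow (A : Mat) (r n : ℕ+) : ep n (matRow A r) = A (r, n + 1) := by
  rw [ep_eq_count_of_sorted (matRow_sorted A r), count_matRow]

lemma ph_matRow (A : Mat) (r n : ℕ+) : ph n (matRow A r) = A (r, n) := by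
  rw [ph_eq_count_of_sorted (matRow_sorted A r), count_matRow]

/-- `ε_n` of the rows `≥ r`. -/
noncomputable def rowEps (n : ℕ+) (A : Mat) (r : ℕ+) : ℕ := ep n (rowsGe A r)

/-- `φ_n` of the rows `< r`. -/
noncomputable def rowPhi (n : ℕ+) (A : Mat) (r : ℕ+) : ℕ := ph n (rowsLt A r)

lemma rowEps_eq (n : ℕ+) (A : Mat) (r : ℕ+) :
    rowEps n A r = A (r, n + 1) + (rowEps n A (r + 1) - A (r, n)) := by
  rw [rowEps, rowsGe_eq, ep_append, ep_matRow, ph_matRow, rowEps]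

lemma rowPhi_succ (n : ℕ+) (A : Mat) (r : ℕ+) :
    rowPhi n A (r + 1) = A (r, n) + (rowPhi n A r - A (r, n + 1)) := by
  rw [rowPhi, rowsLt_succ, ph_append, ep_matRow, ph_matRow, rowPhi]

lemma rowPhi_one (n : ℕ+) (A : Mat) : rowPhi n A 1 = 0 := by rw [rowPhi, rowsLt_one]; rfl

lemma rowEps_one (n : ℕ+) (A : Mat) : rowEps n A 1 = ep n (wordL A) := by rw [rowEps, rowsGe_one]

lemma exists_rowsGe_eq_nil (A : Mat) : ∃ N, ∀ M, N ≤ M → rowsGe A M = [] := by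
  obtain ⟨N, hN⟩ : ∃ N : ℕ+, ∀ p ∈ seqΩ' A, p.1 < N := by
    induction seqΩ' A with
    | nil => exact ⟨1, by simp⟩
    | cons a s ih =>
      obtain ⟨N, hN⟩ := ih
      refine ⟨N + a.1, fun p hp => ?_⟩
      rcases List.mem_cons.1 hp with rfl | hp
      · exact PNat.lt_add_left _ _
      · exact (hN p hp).trans (PNat.lt_add_right _ _)
  refine ⟨N, fun M hM => ?_⟩
  rw [rowsGe, List.filter_eq_nil_iff.2]
  · rfl
  · intro p hp; simpa using (hN p hp).trans_le hM

lemma rowEps_congr_of_le {n : ℕ+} {A B : Mat} {r r₀ : ℕ+} (hr : r ≤ r₀)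
    (h0 : rowEps n A r₀ = rowEps n B r₀)
    (h : ∀ k, k < r₀ → A (k, n) = B (k, n) ∧ A (k, n + 1) = B (k, n + 1)) :
    rowEps n A r = rowEps n B r := by
  induction r₀ using PNat.recOn with
  | one => rwa [le_antisymm hr one_le]
  | succ k ih =>
    rcases eq_or_lt_of_le hr with rfl | hlt
    · exact h0
    · have hk := h k (PNat.lt_add_right k 1)
      refine ih (PNat.lt_add_one_iff.1 hlt) ?_ fun l h2 => h l (h2.trans (PNat.lt_add_right k 1))
      rw [rowEps_eq, rowEps_eq n B, h0, hk.1, hk.2]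

lemma rowEps_congr {n : ℕ+} {A B : Mat} {r : ℕ+}
    (h : ∀ k, r ≤ k → A (k, n) = B (k, n) ∧ A (k, n + 1) = B (k, n + 1)) :
    rowEps n A r = rowEps n B r := by
  obtain ⟨N, hN⟩ := exists_rowsGe_eq_nil A
  obtain ⟨M, hM⟩ := exists_rowsGe_eq_nil B
  -- Descend from a row `r + (N + M)` beyond both supports. Positive naturals have no 0, so the case
  -- `d = 1` performs the last step down to `r`.
  suffices ∀ d : ℕ+, rowEps n A (r + d) = rowEps n B (r + d) →
      rowEps n A r = rowEps n B r by
    refine this (N + M) ?_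
    rw [rowEps, rowEps, hN, hM]
    · rw [add_comm N M, ← add_assoc, add_right_comm]; exact (PNat.lt_add_left _ _).le
    · rw [add_comm N M, ← add_assoc]; exact (PNat.lt_add_left _ _).le
  intro d
  induction d using PNat.recOn with
  | one =>
    intro h0
    have hk := h r le_rfl
    rw [rowEps_eq, rowEps_eq n B, h0, hk.1, hk.2]
  | succ d ih =>
    intro h0
    have hk := h (r + d) (PNat.lt_add_right r d).le
    refine ih ?_
    rw [← add_assoc] at h0
    rw [rowEps_eq, rowEps_eq n B, h0, hk.1, hk.2]

lemma rowPhi_congr_of_le {n : ℕ+} {A B : Mat} {r r₀ : ℕ+} (hr : r₀ ≤ r)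
    (h0 : rowPhi n A r₀ = rowPhi n B r₀)
    (h : ∀ k, r₀ ≤ k → A (k, n) = B (k, n) ∧ A (k, n + 1) = B (k, n + 1)) :
    rowPhi n A r = rowPhi n B r := by
  induction r using PNat.recOn with
  | one => rwa [← le_antisymm hr one_le]
  | succ k ih =>
    rcases eq_or_lt_of_le hr with rfl | hlt
    · exact h0
    · have hk := PNat.lt_add_one_iff.1 hlt
      have hk' := h k hk
      rw [rowPhi_succ, rowPhi_succ, ih hk, hk'.1, hk'.2]

lemma rowPhi_congr {n : ℕ+} {A B : Mat} {r : ℕ+}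
    (h : ∀ k, k < r → A (k, n) = B (k, n) ∧ A (k, n + 1) = B (k, n + 1)) :
    rowPhi n A r = rowPhi n B r := by
  induction r using PNat.recOn with
  | one => rw [rowPhi_one, rowPhi_one]
  | succ k ih =>
    have hk := PNat.lt_add_right k 1
    rw [rowPhi_succ, rowPhi_succ, ih fun l hl => h l (hl.trans hk), (h k hk).1, (h k hk).2]

/-- The lowering operator of index `n` acts on `A` in the row `k`. -/
def Acts (n : ℕ+) (A : Mat) (k : ℕ+) : Prop :=
  rowEps n A (k + 1) < A (k, n) ∧ rowPhi n A k ≤ A (k, n + 1)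

open Finsupp (single)

/-- The two inequalities are the tensor rule for the factors rows `< k`, row `k`, rows `> k`. The
order of letters inside row `k` is irrelevant: a unit moves from column `n` to column `n + 1`. -/
lemma Acts.exists_mstep {n : ℕ+} {A : Mat} {k : ℕ+} (h : Acts n A k) :
    ∃ B, MStep n A B ∧ B + single (k, n) 1 = A + single (k, n + 1) 1 := by
  obtain ⟨x', hx⟩ : ∃ x', FStep n (matRow A k) x' :=
    FStep.exists_of_ph_pos (by rw [ph_matRow]; exact (Nat.zero_le _).trans_lt h.1)
  have hw : FStep n (wordL A) (rowsLt A k ++ (x' ++ rowsGe A (k + 1))) := by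
    rw [wordL_eq_append A k, rowsGe_eq]
    refine (hx.left ?_).right ?_
    · rw [ph_matRow]; exact h.1
    · rw [ep_append, ep_matRow]; exact h.2.trans (Nat.le_add_right _ _)
  refine ⟨_, (exists_mstep_of_fstep_left hw).1, ?_⟩
  obtain ⟨a, b, h1, rfl, -⟩ := hx
  obtain ⟨X₁, X', hX, rfl, h4⟩ := List.map_eq_append_iff.1 h1
  obtain ⟨⟨k', n'⟩, X₂, rfl, h5, rfl⟩ := List.map_eq_cons_iff.1 h4
  obtain rfl : n' = n := h5
  obtain rfl : k' = k := by
    have : (k', n') ∈ (seqΩ' A).filter (fun p => p.1 = k) := by rw [hX]; simp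
    simpa using (List.mem_filter.1 this).2
  have hs := filter_append_filter (seqΩ'_sorted A) k'
  rw [filter_ge_eq (seqΩ'_sorted A), hX] at hs
  generalize hL : (seqΩ' A).filter (fun p => p.1 < k') = S at hs
  generalize hR : (seqΩ' A).filter (fun p => k' + 1 ≤ p.1) = R at hs
  ext p
  have e1 := matOf_seq (S ++ ((X₁ ++ (k', n' + 1) :: X₂) ++ R)) p
  have e2 := count_seqΩ' A p
  have e3 : (S ++ ((X₁ ++ (k', n' + 1) :: X₂) ++ R)).map Prod.fst = wordK A := by
    rw [wordK, hs]; simp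
  have e4 : (S ++ ((X₁ ++ (k', n' + 1) :: X₂) ++ R)).map Prod.snd = rowsLt A k' ++
      (X₁.map Prod.snd ++ (n' + 1) :: X₂.map Prod.snd ++ rowsGe A (k' + 1)) := by
    rw [rowsLt, rowsGe, hL, hR]; simp
  rw [e3, e4] at e1
  rw [Finsupp.add_apply, Finsupp.add_apply, e1, ← e2, hs]
  simp only [List.count_append, List.count_cons, Finsupp.single_apply, beq_iff_eq]
  omega

/-- At row 1 the partial φ of the rows above is 0, while beyond the support the partial ε of the
rows below is 0 and the partial φ is the full one. So partial ε is overtaken by partial φ between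
some `k` and `k + 1`, and there the operator acts. -/
lemma exists_acts {n : ℕ+} {A : Mat} (h : 0 < ph n (wordL A)) : ∃ k, Acts n A k := by
  obtain ⟨N, hN⟩ := exists_rowsGe_eq_nil A
  have key : ∀ k, rowEps n A k < rowPhi n A k → ∃ k, Acts n A k := by
    intro k
    induction k using PNat.recOn with
    | one => rw [rowPhi_one]; omega
    | succ k ih =>
      intro hk
      by_cases hk' : rowEps n A k < rowPhi n A k
      · exact ih hk'
      · refine ⟨k, ?_⟩
        rw [rowPhi_succ] at hk
        rw [rowEps_eq] at hk'
        constructor <;> omega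
  refine key N ?_
  have := wordL_eq_append A N
  rw [hN N le_rfl, List.append_nil] at this
  rw [rowEps, rowPhi, hN N le_rfl, ← this]
  exact h

lemma MStep.exists_acts {n : ℕ+} {A B : Mat} (h : MStep n A B) :
    ∃ k, Acts n A k ∧ B + single (k, n) 1 = A + single (k, n + 1) 1 := by
  obtain ⟨k, hk⟩ := GlInf.exists_acts (by rw [h.fstep.ph_eq]; omega)
  obtain ⟨B', h1, h2⟩ := hk.exists_mstep
  exact ⟨k, hk, by rwa [h.unique h1]⟩

/-! ### Commutation of row and column operators -/

lemma pnat_eq_one_or_succ_of_lt {k r : ℕ+} (h : k < r) : r = k + 1 ∨ k + 2 ≤ r := by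
  rcases eq_or_lt_of_le (PNat.add_one_le_iff.2 h) with h | h
  · exact Or.inl h.symm
  · refine Or.inr ?_
    have := PNat.add_one_le_iff.2 h
    rwa [add_assoc] at this

/-- `C` is obtained from `A` by moving a unit from `(k, j)` to `(k + 1, j)`. -/
def Moves (k j : ℕ+) (A C : Mat) : Prop :=
  ∀ p q, C (p, q) + (if k = p ∧ j = q then 1 else 0) =
    A (p, q) + (if k + 1 = p ∧ j = q then 1 else 0)

lemma MStep.exists_acts_moves {k : ℕ+} {A C : Mat} (h : MStep k (matT A) (matT C)) :
    ∃ j, Acts k (matT A) j ∧ Moves k j A C := by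
  obtain ⟨j, hj, h1⟩ := h.exists_acts
  refine ⟨j, hj, fun p q => ?_⟩
  have h2 := DFunLike.congr_fun h1 (q, p)
  simp only [Finsupp.add_apply, matT_apply, Finsupp.single_apply, Prod.mk.injEq] at h2
  simpa only [and_comm] using h2

namespace Moves

variable {k j : ℕ+} {A C : Mat}

lemma apply_fst (h : Moves k j A C) : C (k, j) + 1 = A (k, j) := by
  simpa [pnat_ne_add_one] using h k j

lemma apply_snd (h : Moves k j A C) : C (k + 1, j) = A (k + 1, j) + 1 := by
  simpa [pnat_add_one_ne] using h (k + 1) j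

lemma apply_of_row (h : Moves k j A C) {p : ℕ+} (h1 : p ≠ k) (h2 : p ≠ k + 1) (q : ℕ+) :
    C (p, q) = A (p, q) := by
  simpa [h1.symm, h2.symm] using h p q

lemma apply_of_col (h : Moves k j A C) {q : ℕ+} (h1 : q ≠ j) (p : ℕ+) : C (p, q) = A (p, q) := by
  simpa [h1.symm] using h p q

end Moves

/-! ### How a column operator affects the partial ε and φ of the rows. -/

section Invariance

variable {k j n : ℕ+} {A C : Mat}

/-- This and `Acts.le` extract from the acting conditions the comparison of two diagonal entries of
a 2×2 block. It is all that invariance needs to know about where a column operator acts. -/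
lemma Acts.lt (h : Acts k (matT A) n) : A (k + 1, n + 1) < A (k, n) := by
  have := h.1
  rw [rowEps_eq] at this
  simp only [matT_apply] at this
  omega

lemma Acts.le (h : Acts k (matT A) (n + 1)) : A (k, n) ≤ A (k + 1, n + 1) := by
  have := h.2
  rw [rowPhi_succ] at this
  simp only [matT_apply] at this
  omega

/-- A unit moves from row `k` to row `k + 1`, so only the cut between these rows, excluded by `hr`,
can notice. For the cuts above, the two-step recursion through rows `k + 1` and `k` returns the same
value by the diagonal inequality. -/
lemma rowEps_moves (h : Acts k (matT A) j) (h' : Moves k j A C) {r : ℕ+} (hr : r ≠ k + 1) :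
    rowEps n C r = rowEps n A r := by
  by_cases hj : n = j ∨ n + 1 = j
  swap
  · push Not at hj
    exact rowEps_congr fun l _ => ⟨h'.apply_of_col hj.1 l, h'.apply_of_col hj.2 l⟩
  have hfar : ∀ r, k + 2 ≤ r → rowEps n C r = rowEps n A r := by
    intro r hr
    have hk : k + 1 < k + 2 := by
      have := PNat.lt_add_right (k + 1) 1; rwa [add_assoc] at this
    refine rowEps_congr fun l hl => ?_
    have h1 : l ≠ k + 1 := (hk.trans_le (hr.trans hl)).ne'
    have h2 : l ≠ k := ((PNat.lt_add_right k 1).trans (hk.trans_le (hr.trans hl))).ne'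
    exact ⟨h'.apply_of_row h2 h1 _, h'.apply_of_row h2 h1 _⟩
  by_cases hk : r ≤ k
  swap
  · exact hfar r ((pnat_eq_one_or_succ_of_lt (not_le.1 hk)).resolve_left hr)
  refine rowEps_congr_of_le hk ?_ fun l hl =>
    ⟨h'.apply_of_row hl.ne (hl.trans (PNat.lt_add_right k 1)).ne _,
      h'.apply_of_row hl.ne (hl.trans (PNat.lt_add_right k 1)).ne _⟩
  have h3 := hfar (k + 2) le_rfl
  rw [rowEps_eq, rowEps_eq n A, rowEps_eq n C (k + 1), rowEps_eq n A (k + 1), add_assoc,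
    show (1 + 1 : ℕ+) = 2 from rfl, h3]
  have h4 := h'.apply_fst
  have h5 := h'.apply_snd
  rcases hj with rfl | rfl
  · have h6 := h.lt
    rw [h'.apply_of_col (pnat_add_one_ne n), h'.apply_of_col (pnat_add_one_ne n)]
    omega
  · have h6 := h.le
    rw [h'.apply_of_col (pnat_ne_add_one n), h'.apply_of_col (pnat_ne_add_one n)]
    omega

lemma rowPhi_moves (h : Acts k (matT A) j) (h' : Moves k j A C) {r : ℕ+} (hr : r ≠ k + 1) :
    rowPhi n C r = rowPhi n A r := by
  by_cases hj : n = j ∨ n + 1 = j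
  swap
  · push Not at hj
    exact rowPhi_congr fun l _ => ⟨h'.apply_of_col hj.1 l, h'.apply_of_col hj.2 l⟩
  have hnear : ∀ r, r ≤ k → rowPhi n C r = rowPhi n A r := by
    intro r hr
    refine rowPhi_congr fun l hl => ?_
    have h1 : l ≠ k := (hl.trans_le hr).ne
    have h2 : l ≠ k + 1 := ((hl.trans_le hr).trans (PNat.lt_add_right k 1)).ne
    exact ⟨h'.apply_of_row h1 h2 _, h'.apply_of_row h1 h2 _⟩
  by_cases hk : r ≤ k
  · exact hnear r hk
  have hk2 : k + 1 < k + 2 := by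
    have := PNat.lt_add_right (k + 1) 1; rwa [add_assoc] at this
  refine rowPhi_congr_of_le ((pnat_eq_one_or_succ_of_lt (not_le.1 hk)).resolve_left hr) ?_
    fun l hl => ?_
  swap
  · have h1 : l ≠ k + 1 := (hk2.trans_le hl).ne'
    have h2 : l ≠ k := ((PNat.lt_add_right k 1).trans (hk2.trans_le hl)).ne'
    exact ⟨h'.apply_of_row h2 h1 _, h'.apply_of_row h2 h1 _⟩
  have h3 := hnear k le_rfl
  rw [show k + 2 = k + 1 + 1 from (add_assoc k 1 1).symm, rowPhi_succ, rowPhi_succ,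
    rowPhi_succ n A, rowPhi_succ n A, h3]
  have h4 := h'.apply_fst
  have h5 := h'.apply_snd
  rcases hj with rfl | rfl
  · have h6 := h.lt
    rw [h'.apply_of_col (pnat_add_one_ne n), h'.apply_of_col (pnat_add_one_ne n)]
    omega
  · have h6 := h.le
    rw [h'.apply_of_col (pnat_ne_add_one n), h'.apply_of_col (pnat_ne_add_one n)]
    omega

lemma Acts.of_moves (h : Acts k (matT A) j) (h' : Moves k j A C) {r : ℕ+} (hr : Acts n A r)
    (hd : (r ≠ k ∧ r ≠ k + 1) ∨ (n ≠ j ∧ n + 1 ≠ j)) : Acts n C r := by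
  rcases hd with ⟨h1, h2⟩ | ⟨h1, h2⟩
  · rw [Acts, rowEps_moves h h' (by simpa using h1), rowPhi_moves h h' h2,
      h'.apply_of_row h1 h2, h'.apply_of_row h1 h2]
    exact hr
  · have e1 : rowEps n C (r + 1) = rowEps n A (r + 1) :=
      rowEps_congr fun l _ => ⟨h'.apply_of_col h1 l, h'.apply_of_col h2 l⟩
    have e2 : rowPhi n C r = rowPhi n A r :=
      rowPhi_congr fun l _ => ⟨h'.apply_of_col h1 l, h'.apply_of_col h2 l⟩
    rw [Acts, e1, e2, h'.apply_of_col h1, h'.apply_of_col h2]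
    exact hr

end Invariance

/-- `ε_n` is invariant under the column operators. -/
lemma MStep.ep_wordL {n k : ℕ+} {A C : Mat} (h : MStep k (matT A) (matT C)) :
    ep n (wordL C) = ep n (wordL A) := by
  obtain ⟨j, h1, h2⟩ := h.exists_acts_moves
  rw [← rowEps_one, ← rowEps_one, rowEps_moves h1 h2 (PNat.lt_add_left 1 k).ne]

/-- The operators on the rows of `A` commute with those on the columns. -/
lemma MStep.comm {n k : ℕ+} {A B C : Mat} (hB : MStep n A B) (hC : MStep k (matT A) (matT C)) :
    ∃ D, MStep n C D ∧ MStep k (matT B) (matT D) := by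
  obtain ⟨j, hj, mj⟩ := hC.exists_acts_moves
  obtain ⟨r, hr, mr⟩ := (show MStep n (matT (matT A)) (matT (matT B)) by
    simpa using hB).exists_acts_moves
  -- After the column move the row operator acts in row `r'`, and after the row move the column
  -- operator acts in column `j'`. The equation says that the two compositions agree, with the
  -- subtracted units moved to the other side.
  obtain ⟨r', j', hr', hj', hm⟩ : ∃ r' j', Acts n C r' ∧ Acts k (matT B) j' ∧
      A + single (k + 1, j) 1 + single (k, j') 1 + single (r, n) 1 + single (r', n + 1) 1 =
      A + single (r, n + 1) 1 + single (r', n) 1 + single (k, j) 1 + single (k + 1, j') 1 := by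
    by_cases hd : (r ≠ k ∧ r ≠ k + 1) ∨ (n ≠ j ∧ n + 1 ≠ j)
    · refine ⟨r, j, hj.of_moves mj (by simpa using hr) hd, hr.of_moves mr hj ?_, by abel⟩
      rcases hd with ⟨h1, h2⟩ | ⟨h1, h2⟩
      · exact Or.inr ⟨h1.symm, h2.symm⟩
      · exact Or.inl ⟨h1.symm, h2.symm⟩
    · have hrk : r = k ∨ r = k + 1 := by by_contra h; push Not at h; exact hd (Or.inl h)
      have hnj : n = j ∨ n + 1 = j := by by_contra h; push Not at h; exact hd (Or.inr h)
      have c1 := mj.apply_fst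
      have c2 := mj.apply_snd
      have b1 := mr.apply_fst
      have b2 := mr.apply_snd
      simp only [matT_apply] at b1 b2
      have e2 := mj.apply_of_col (q := n)
      have e3 := mj.apply_of_col (q := n + 1)
      have f2 := mr.apply_of_col (q := k)
      have f3 := mr.apply_of_col (q := k + 1)
      simp only [matT_apply] at f2 f3
      have s1 : k ≠ k + 1 := pnat_ne_add_one k
      have s2 : n ≠ n + 1 := pnat_ne_add_one n
      have s3 : k + 2 ≠ k + 1 := by
        have := pnat_add_one_ne (k + 1); rwa [add_assoc] at this
      have s4 : n + 2 ≠ n + 1 := by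
        have := pnat_add_one_ne (n + 1); rwa [add_assoc] at this
      have E1 := rowEps_moves (n := n) hj mj (r := k + 2) s3
      have F1 := rowPhi_moves (n := n) hj mj (r := k) s1
      have E2 := rowEps_moves (n := k) hr mr (r := n + 2) s4
      have F2 := rowPhi_moves (n := k) hr mr (r := n) s2
      have t1 : k + 1 + 1 = k + 2 := add_assoc k 1 1
      have t2 : n + 1 + 1 = n + 2 := add_assoc n 1 1
      rw [matT_matT] at hr
      rcases hrk with rfl | rfl <;> rcases hnj with rfl | rfl
      · have p1 := hr.1
        have p2 := hr.2
        have q1 := hj.1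
        have q2 := hj.2
        have e3 := e3 s2.symm
        have f3 := f3 s1.symm
        rw [rowEps_eq] at p1 q1
        simp only [matT_apply, t1, t2] at p1 q1 q2
        -- Both operators want a unit from the entry `(r, n)`. If it exceeds the diagonal neighbour
        -- by at least 2, both get it; if only by 1, the operator applied second acts one row,
        -- respectively one column, further.
        by_cases h : A (r + 1, n + 1) + 2 ≤ A (r, n)
        · refine ⟨r, n, ?_, ?_, by abel⟩
          · rw [Acts, rowEps_eq, F1, t1, E1, e3, e3]
            omega
          · rw [Acts, rowEps_eq, F2, t2, E2]
            simp only [matT_apply]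
            rw [f3, f3]
            omega
        · refine ⟨r + 1, n + 1, ?_, ?_, by abel⟩
          · rw [Acts, rowPhi_succ, F1, t1, E1, e3, e3]
            omega
          · rw [Acts, rowPhi_succ, F2, t2, E2]
            simp only [matT_apply]
            rw [f3, f3]
            omega
      -- In the two off-diagonal positions the acting conditions demand opposite inequalities
      -- between `A (k, n)` and `A (k + 1, n + 1)`.
      · exfalso
        have p1 := hr.1
        rw [rowEps_eq] at p1
        have := hj.le
        omega
      · exfalso
        have p2 := hr.2
        rw [rowPhi_succ] at p2
        have := hj.lt
        omega
      · have p1 := hr.1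
        have p2 := hr.2
        have q1 := hj.1
        have q2 := hj.2
        rw [rowPhi_succ] at p2 q2
        simp only [matT_apply, t1, t2] at p1 p2 q1 q2
        have e2 := e2 s2
        have f2 := f2 s1
        refine ⟨k + 1, n + 1, ?_, ?_, by abel⟩
        · rw [Acts, rowPhi_succ, F1, t1, E1, e2, e2]
          omega
        · rw [Acts, rowPhi_succ, F2, t2, E2]
          simp only [matT_apply]
          rw [f2, f2]
          omega
  obtain ⟨D, hD, mD⟩ := hr'.exists_mstep
  obtain ⟨D', hD', mD'⟩ := hj'.exists_mstep
  refine ⟨D, hD, ?_⟩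
  suffices D' = matT D by rwa [← this]
  refine mat_ext fun p q => ?_
  have g1 := DFunLike.congr_fun mD (q, p)
  have g2 := DFunLike.congr_fun mD' (p, q)
  have g3 := mj q p
  have g4 := mr p q
  have g5 := DFunLike.congr_fun hm (q, p)
  simp only [Finsupp.add_apply, matT_apply, Finsupp.single_apply, Prod.mk.injEq] at g1 g2 g3 g4 g5
  simp only [matT_apply]
  have sw : ∀ x y : ℕ+, (x = q ∧ y = p) = (y = p ∧ x = q) := fun _ _ => propext and_comm
  simp only [sw] at g1 g2 g3 g4 g5
  omega

/-! ### Highest weight matrices -/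

/-- By induction on the row, the partial ε of index `n` vanishes from row `r` on whenever `r ≤ n`:
the entries that could cancel letters of lower rows lie above the diagonal and have already been
shown to be 0. -/
lemma apply_eq_zero_of_ep_eq_zero {A : Mat} (h : ∀ n, ep n (wordL A) = 0) {r m : ℕ+} (hm : r < m) :
    A (r, m) = 0 := by
  have key : ∀ r n : ℕ+, r ≤ n → rowEps n A r = 0 := by
    intro r
    induction r using PNat.recOn with
    | one => intro n _; rw [rowEps_one, h]
    | succ r ih =>
      intro n hn
      obtain ⟨n', rfl⟩ := PNat.exists_eq_succ_of_ne_one (n := n)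
        (by rintro rfl; exact absurd hn (not_le.2 (PNat.lt_add_left 1 r)))
      have h1 := ih n' (le_of_add_le_add_right hn)
      have h2 := ih (n' + 1) ((PNat.lt_add_right r 1).le.trans hn)
      rw [rowEps_eq] at h1 h2
      omega
  obtain ⟨n, rfl⟩ := PNat.exists_eq_succ_of_ne_one (n := m)
    (by rintro rfl; exact absurd hm (not_lt.2 one_le))
  have := key r n (PNat.lt_add_one_iff.1 hm)
  rw [rowEps_eq] at this
  omega

/-- Only rows `n` and `n + 1` contain letters `n` or `n + 1`, and the `A (n, n)` letters `n` of the
former suffice to cancel the letters `n + 1` of the latter. -/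
lemma ep_wordL_eq_zero {A : Mat} (hd : ∀ i j, i ≠ j → A (i, j) = 0)
    (hA : ∀ i, A (i + 1, i + 1) ≤ A (i, i)) (n : ℕ+) : ep n (wordL A) = 0 := by
  have h0 : rowEps n A (n + 2) = 0 := by
    have hn1 : n + 1 < n + 2 := by
      have := PNat.lt_add_right (n + 1) 1; rwa [add_assoc] at this
    rw [rowEps_congr (B := 0)]
    · simp [rowEps, rowsGe, seqΩ']
    · intro k hk
      rw [hd, hd]
      · simp
      · exact (hn1.trans_le hk).ne'
      · exact ((PNat.lt_add_right n 1).trans (hn1.trans_le hk)).ne'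
  have h1 : rowEps n A n = 0 := by
    rw [rowEps_eq, rowEps_eq, add_assoc, show (1 + 1 : ℕ+) = 2 from rfl, h0,
      hd _ _ (pnat_ne_add_one n)]
    have := hA n
    omega
  rw [← rowEps_one]
  have h2 : rowEps n (0 : Mat) n = 0 := by simp [rowEps, rowsGe, seqΩ']
  rw [rowEps_congr_of_le (B := 0) one_le (h1.trans h2.symm)]
  · simp [rowEps, rowsGe, seqΩ']
  · intro k hk
    rw [hd _ _ hk.ne, hd _ _ (hk.trans (PNat.lt_add_right n 1)).ne]
    simp

/-! ### The map `κ` and the operators with non-zero index -/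

/-- Raising lowers the sum of the letters of `wordL`, so it ends at highest weight. -/
theorem rowStep_induction {P : Mat → Prop} (base : ∀ A, (∀ n, ep n (wordL A) = 0) → P A)
    (step : ∀ n A B, MStep n A B → P A → P B) (A : Mat) : P A := by
  induction h : ((wordL A).map PNat.val).sum using Nat.strong_induction_on generalizing A with
  | _ N ih =>
    by_cases h0 : ∀ n, ep n (wordL A) = 0
    · exact base A h0
    · push Not at h0
      obtain ⟨n, hn⟩ := h0
      obtain ⟨B, hB⟩ := MStep.exists_of_ep_pos (Nat.pos_of_ne_zero hn)
      have := hB.fstep.sum_eq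
      exact step n B A hB (ih _ (by omega) B rfl)

/-- Raise by row operators first, then by column operators. The latter do not disturb the highest
weight condition for rows, since they preserve its ε. -/
theorem step_induction {P : Mat → Prop}
    (base : ∀ A, (∀ n, ep n (wordL A) = 0) → (∀ n, ep n (wordL (matT A)) = 0) → P A)
    (row : ∀ n A B, MStep n A B → P A → P B)
    (col : ∀ n A B, MStep n (matT A) (matT B) → P A → P B) (A : Mat) : P A := by
  refine rowStep_induction (fun A hA => ?_) row A
  suffices ∀ A, (∀ n, ep n (wordL (matT A)) = 0) → P (matT A) by
    simpa using this (matT A) (by simpa using hA)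
  refine rowStep_induction (fun A h1 h2 => base _ h2 (by simpa using h1)) ?_
  intro n A B h hA hB
  have h' : MStep n (matT (matT A)) (matT (matT B)) := by simpa using h
  exact col n _ _ h' (hA fun m => h'.ep_wordL.symm.trans (hB m))

lemma wordL_perm_wordK (A : Mat) : (wordL A).Perm (wordK (matT A)) := by
  rw [← wordJ_eq]
  refine List.Perm.map _ ?_
  rw [← Multiset.coe_eq_coe, coe_seqΩ', seqΩ, Multiset.sort_eq]

lemma MStep.wordL_perm {k : ℕ+} {A C : Mat} (h : MStep k (matT A) (matT C)) :
    (wordL C).Perm (wordL A) := by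
  refine (wordL_perm_wordK C).trans ?_
  rw [h.wordK_eq]
  exact (wordL_perm_wordK A).symm

lemma MStep.ph_wordL {n k : ℕ+} {A C : Mat} (h : MStep k (matT A) (matT C)) :
    ph n (wordL C) = ph n (wordL A) := ph_eq_of_ep_eq_of_perm h.ep_wordL h.wordL_perm

lemma full_tabOf {w : List ℕ+} (h : ∀ n, ep n w = 0) : ∀ c ∈ tabOf w, Full c :=
  (isAntiSST_tabOf w).full fun n => by rw [ep_tabOf, h]

lemma eq_of_readingWord_eq {T U : List (List ℕ+)} (hT : IsAntiSST T) (hU : IsAntiSST U)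
    (h : readingWord T = readingWord U) : T = U := by
  rw [← hT.tabOf_readingWord, h, hU.tabOf_readingWord]

/-- Equality of tableaux propagates along lowering, and in `tabOf_congr_left` along raising, because
both operations are determined by the reading word. -/
lemma tabOf_congr_right {n : ℕ+} {u u' v v' : List ℕ+} (h : FStep n u u') (h' : FStep n v v')
    (he : tabOf u = tabOf v) : tabOf u' = tabOf v' := by
  refine eq_of_readingWord_eq (isAntiSST_tabOf _) (isAntiSST_tabOf _) ?_
  have h1 := h.readingWord_tabOf
  rw [he] at h1
  exact h1.unique h'.readingWord_tabOf

lemma tabOf_congr_left {n : ℕ+} {u u' v v' : List ℕ+} (h : FStep n u u') (h' : FStep n v v')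
    (he : tabOf u' = tabOf v') : tabOf u = tabOf v := by
  refine eq_of_readingWord_eq (isAntiSST_tabOf _) (isAntiSST_tabOf _) ?_
  have h1 := h.readingWord_tabOf
  rw [he] at h1
  exact h1.unique_left h'.readingWord_tabOf

/-- The column operators do not change the recording tableau. -/
lemma MStep.tabOf_wordL {k : ℕ+} {A C : Mat} (h : MStep k (matT A) (matT C)) :
    tabOf (wordL C) = tabOf (wordL A) := by
  revert C
  refine rowStep_induction (P := fun A => ∀ {C}, MStep k (matT A) (matT C) →
    tabOf (wordL C) = tabOf (wordL A)) ?_ ?_ A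
  · intro A hA C h
    -- At row highest weight both tableaux have full columns, and a column operator does not alter
    -- the content of `wordL`; content determines a full tableau.
    refine eq_of_full_of_perm (isAntiSST_tabOf _) (isAntiSST_tabOf _)
      (full_tabOf fun n => h.ep_wordL.trans (hA n)) (full_tabOf hA) ?_
    exact ((tabOf_perm _).symm.trans h.wordL_perm).trans (tabOf_perm _)
  · intro n A B hB ih C h
    have hB' : MStep n (matT (matT A)) (matT (matT B)) := by simpa using hB
    -- The column operator is already defined on `A`, since the row operator leading to `B`
    -- preserves φ of the columns. Commutation then identifies `C` as the row lowering of `X`.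
    obtain ⟨X, hX⟩ : ∃ X, MStep k (matT A) X := by
      refine MStep.exists_of_ph_pos ?_
      rw [← hB'.ph_wordL, h.fstep.ph_eq]; omega
    rw [← matT_matT X] at hX
    obtain ⟨D, hD, hD'⟩ := hB.comm hX
    obtain rfl : D = C := matT_injective (hD'.unique h)
    exact tabOf_congr_right hD.fstep hB.fstep (ih hX)

lemma MStep.tabOf_wordL_matT {n : ℕ+} {A B : Mat} (h : MStep n A B) :
    tabOf (wordL (matT B)) = tabOf (wordL (matT A)) :=
  MStep.tabOf_wordL (k := n) (by simpa using h)

lemma eq_zero_of_ne {A : Mat} (h : ∀ n, ep n (wordL A) = 0) (h' : ∀ n, ep n (wordL (matT A)) = 0)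
    (i j : ℕ+) (hij : i ≠ j) : A (i, j) = 0 := by
  rcases lt_or_gt_of_ne hij with hlt | hlt
  · exact apply_eq_zero_of_ep_eq_zero h hlt
  · simpa using apply_eq_zero_of_ep_eq_zero h' hlt

lemma matT_eq_self {A : Mat} (h : ∀ i j, i ≠ j → A (i, j) = 0) : matT A = A :=
  mat_ext fun i j => by
    rw [matT_apply]
    by_cases hij : i = j
    · rw [hij]
    · rw [h i j hij, h j i (Ne.symm hij)]

lemma count_wordL_of_diag {A : Mat} (h : ∀ i j, i ≠ j → A (i, j) = 0) (j : ℕ+) :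
    (wordL A).count j = A (j, j) := by
  rw [wordL, ← count_seqΩ', List.count_eq_countP, List.countP_map, List.count_eq_countP]
  refine List.countP_congr fun p hp => ?_
  obtain ⟨a, b⟩ := p
  have hab : a = b := by
    by_contra hne
    exact mem_seqΩ'.1 hp (h a b hne)
  simp [hab]

/-- A matrix of highest weight for both families is diagonal, hence symmetric, so its two tableaux
are equal. Each lowering step fixes one tableau and preserves the shape of the other. -/
theorem shape_tabOf_wordL_matT (A : Mat) : shape (tabOf (wordL (matT A))) = shape (tabOf (wordL A)) := by
  refine step_induction (P := fun A => shape (tabOf (wordL (matT A))) = shape (tabOf (wordL A)))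
    ?_ ?_ ?_ A
  · intro A h h'
    rw [matT_eq_self (eq_zero_of_ne h h')]
  · intro n A B h ih
    rw [h.tabOf_wordL_matT, ih, h.fstep.tabOf.2]
  · intro n A B h ih
    rw [h.tabOf_wordL, ← ih, h.fstep.tabOf.2]

/-- Raise `A` to highest weight. Since ε depends only on the tableaux, `B` can be raised in
parallel, and lowering is deterministic. At the end both matrices are diagonal and given by the
content of the tableau. -/
theorem eq_of_tabOf_eq {A B : Mat} (h : tabOf (wordL A) = tabOf (wordL B))
    (h' : tabOf (wordL (matT A)) = tabOf (wordL (matT B))) : A = B := by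
  revert B
  refine step_induction (P := fun A => ∀ {B}, tabOf (wordL A) = tabOf (wordL B) →
    tabOf (wordL (matT A)) = tabOf (wordL (matT B)) → A = B) ?_ ?_ ?_ A
  · intro A hA hA' B h h'
    have hd := eq_zero_of_ne hA hA'
    have hd' := eq_zero_of_ne (A := B) (fun n => by rw [← ep_tabOf, ← h, ep_tabOf, hA])
      (fun n => by rw [← ep_tabOf, ← h', ep_tabOf, hA'])
    refine mat_ext fun i j => ?_
    by_cases hij : i = j
    · subst hij
      rw [← count_wordL_of_diag hd, ← count_wordL_of_diag hd', (tabOf_perm _).count_eq, h,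
        ← (tabOf_perm _).count_eq]
    · rw [hd i j hij, hd' i j hij]
  · intro n A A' hA ih B h h'
    obtain ⟨B₀, hB⟩ : ∃ B₀, MStep n B₀ B := by
      refine MStep.exists_of_ep_pos ?_
      rw [← ep_tabOf, ← h, ep_tabOf, hA.fstep.ep_eq]; omega
    rw [hA.tabOf_wordL_matT, hB.tabOf_wordL_matT] at h'
    obtain rfl := ih (tabOf_congr_left hA.fstep hB.fstep h) h'
    exact hA.unique hB
  · intro n A A' hA ih B h h'
    obtain ⟨B₀, hB⟩ : ∃ B₀, MStep n B₀ (matT B) := by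
      refine MStep.exists_of_ep_pos ?_
      rw [← ep_tabOf, ← h', ep_tabOf, hA.fstep.ep_eq]; omega
    rw [← matT_matT B₀] at hB
    rw [hA.tabOf_wordL, hB.tabOf_wordL] at h
    obtain rfl := ih h (tabOf_congr_left hA.fstep hB.fstep h')
    exact matT_injective (hA.unique hB)

theorem IsAntiSST.induction {P : List (List ℕ+) → Prop}
    (base : ∀ T, IsAntiSST T → (∀ n, ep n T.flatten = 0) → P T)
    (step : ∀ n T U, IsAntiSST T → IsAntiSST U → FStep n (readingWord T) (readingWord U) →
      GlInf.shape T = GlInf.shape U → P T → P U) {T : List (List ℕ+)} (hT : IsAntiSST T) : P T := by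
  induction h : ((readingWord T).map PNat.val).sum using Nat.strong_induction_on generalizing T with
  | _ N ih =>
    by_cases h0 : ∀ n, ep n T.flatten = 0
    · exact base T hT h0
    · push Not at h0
      obtain ⟨n, hn⟩ := h0
      rw [← hT.ep_readingWord] at hn
      obtain ⟨w, hw⟩ := FStep.exists_of_ep_pos (Nat.pos_of_ne_zero hn)
      have h1 := hw.readingWord_tabOf
      have h2 := hw.tabOf.2
      rw [hT.tabOf_readingWord] at h1 h2
      have := h1.sum_eq
      exact step n _ T (isAntiSST_tabOf w) hT h1 h2 (ih _ (by omega) (isAntiSST_tabOf w) rfl)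

lemma exists_tabOf_step {n : ℕ+} {A : Mat} {T U : List (List ℕ+)} (hU : IsAntiSST U)
    (h : FStep n (readingWord T) (readingWord U)) (hA : tabOf (wordL A) = T) :
    ∃ B, MStep n A B ∧ tabOf (wordL B) = U := by
  subst hA
  obtain ⟨B, hB⟩ : ∃ B, MStep n A B := by
    refine MStep.exists_of_ph_pos ?_
    rw [← ph_tabOf, ← (isAntiSST_tabOf _).ph_readingWord, h.ph_eq]; omega
  exact ⟨B, hB, eq_of_readingWord_eq (isAntiSST_tabOf _) hU (hB.fstep.readingWord_tabOf.unique h)⟩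

/-- The preimage of `(T, T)` is the diagonal matrix of the multiplicities of the letters in `T`.
They decrease because every column containing `i + 1` contains `i`, so this matrix is of highest
weight. -/
lemma exists_tabOf_eq_of_full {T : List (List ℕ+)} (hT : IsAntiSST T)
    (h : ∀ n, ep n T.flatten = 0) :
    ∃ A, tabOf (wordL A) = T ∧ tabOf (wordL (matT A)) = T := by
  have hA : ∀ i j, matOf T.flatten T.flatten (i, j) = if i = j then T.flatten.count i else 0 := by
    intro i j
    have := matOf_seq (T.flatten.map fun x => (x, x)) (i, j)
    simp only [List.map_map, Function.comp_def, List.map_id'] at this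
    rw [this, List.count_eq_countP, List.countP_map]
    split_ifs with hij
    · rw [hij, List.count_eq_countP]
      refine List.countP_congr fun p _ => ?_
      simp
    · rw [List.countP_eq_zero]
      rintro p -
      simp only [Function.comp_apply, beq_iff_eq, Prod.mk.injEq, not_and]
      rintro rfl; exact hij
  set A : Mat := matOf T.flatten T.flatten
  have hd : ∀ i j, i ≠ j → A (i, j) = 0 := fun i j hij => by rw [hA, if_neg hij]
  have hfull := hT.full h
  have h0 : ∀ n, ep n (wordL A) = 0 := by
    refine ep_wordL_eq_zero hd fun i => ?_
    rw [hA, hA, if_pos rfl, if_pos rfl, List.count_flatten, List.count_flatten]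
    refine List.sum_le_sum fun c hc => ?_
    have hnd : c.Nodup := (hT.strictCols c hc).imp fun h => h.ne
    by_cases hi : i + 1 ∈ c
    · rw [List.count_eq_one_of_mem hnd hi, List.count_eq_one_of_mem hnd (hfull c hc i hi)]
    · rw [List.count_eq_zero_of_not_mem hi]; exact Nat.zero_le _
  refine ⟨A, ?_⟩
  rw [matT_eq_self hd, and_self]
  refine eq_of_full_of_perm (isAntiSST_tabOf _) hT (full_tabOf h0) hfull ?_
  refine (tabOf_perm _).symm.trans (List.perm_iff_count.2 fun j => ?_)
  rw [count_wordL_of_diag hd, hA, if_pos rfl]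

/-- Raise `T` and then `S` to highest weight. Full tableaux of the same shape coincide, so the
diagonal case applies, and the lowering steps lift to matrices one at a time without touching the
other tableau. -/
theorem exists_tabOf_eq {S T : List (List ℕ+)} (hS : IsAntiSST S) (hT : IsAntiSST T)
    (h : shape S = shape T) : ∃ A, tabOf (wordL (matT A)) = S ∧ tabOf (wordL A) = T := by
  revert S
  refine IsAntiSST.induction (P := fun T => ∀ {S}, IsAntiSST S → shape S = shape T →
    ∃ A, tabOf (wordL (matT A)) = S ∧ tabOf (wordL A) = T) ?_ ?_ hT
  · intro T hT hT0 S hS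
    refine IsAntiSST.induction (P := fun S => shape S = shape T →
      ∃ A, tabOf (wordL (matT A)) = S ∧ tabOf (wordL A) = T) ?_ ?_ hS
    · intro S hS hS0 h
      obtain rfl := eq_of_full_of_shape hS.strictCols hT.strictCols (hS.full hS0) (hT.full hT0) h
      obtain ⟨A, h1, h2⟩ := exists_tabOf_eq_of_full hT hT0
      exact ⟨A, h2, h1⟩
    · intro n S S' _ hS' hs he ih h
      obtain ⟨A, h1, h2⟩ := ih (he.trans h)
      obtain ⟨B, h3, h4⟩ := exists_tabOf_step hS' hs h1
      rw [← matT_matT B] at h3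
      exact ⟨matT B, by rwa [matT_matT], h3.tabOf_wordL.trans h2⟩
  · intro n T T' _ hT' hs he ih S hS h
    obtain ⟨A, h1, h2⟩ := ih hS (h.trans he.symm)
    obtain ⟨B, h3, h4⟩ := exists_tabOf_step hT' hs h2
    exact ⟨B, h3.tabOf_wordL_matT.trans h1, h4⟩

/-! ### Cancellation of signs -/

lemma length_cancel (σ : List Sgn) : (cancel σ).length = σ.length := by
  induction σ with
  | nil => rfl
  | cons s σ ih =>
    cases s
    · simp [cancel, ih]
    · simp only [cancel]; split_ifs <;> simp [ih]
    · simp [cancel, ih]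

lemma count_replace_plus {σ : List Sgn} (h : Sgn.plus ∈ σ) :
    (σ.replace .plus .dot).count .plus + 1 = σ.count .plus ∧
      (σ.replace .plus .dot).count .minus = σ.count .minus := by
  induction σ with
  | nil => simp at h
  | cons s σ ih =>
    cases s
    · simp
    · have := ih (by simpa using h)
      simpa [List.replace_cons, show (Sgn.plus == Sgn.minus) = false from rfl] using this
    · have := ih (by simpa using h)
      simpa [List.replace_cons, show (Sgn.plus == Sgn.dot) = false from rfl] using this

/-- Each cancellation removes one sign of either kind. -/
lemma count_cancel (σ : List Sgn) :
    (cancel σ).count .minus + σ.count .plus = (cancel σ).count .plus + σ.count .minus := by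
  induction σ with
  | nil => rfl
  | cons s σ ih =>
    cases s
    · simp [cancel]; omega
    · simp only [cancel]
      split_ifs with h
      · have := count_replace_plus h
        simp; omega
      · simp; omega
    · simpa [cancel] using ih

/-- Every prefix of `σ` has at most `a` more signs `-` than signs `+`. -/
def Bounded (a : ℕ) (σ : List Sgn) : Prop :=
  ∀ u v, σ = u ++ v → u.count .minus ≤ a + u.count .plus

namespace Bounded

variable {a b : ℕ} {σ τ : List Sgn}

lemma left (h : Bounded a (σ ++ τ)) : Bounded a σ :=
  fun u v e => h u (v ++ τ) (by rw [e, List.append_assoc])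

lemma nil : Bounded a [] := by
  intro u v e
  obtain ⟨rfl, -⟩ := List.append_eq_nil_iff.1 e.symm
  simp

lemma cons {s : Sgn} (h : Bounded b σ)
    (hs : (s = .plus ∧ b ≤ a + 1) ∨ (s = .minus ∧ b + 1 ≤ a) ∨ (s = .dot ∧ b ≤ a)) :
    Bounded a (s :: σ) := by
  intro u v e
  rcases List.cons_eq_append_iff.1 e with ⟨rfl, -⟩ | ⟨u', rfl, rfl⟩
  · simp
  · have := h u' v rfl
    rcases hs with ⟨rfl, hs⟩ | ⟨rfl, hs⟩ | ⟨rfl, hs⟩ <;> simp <;> omega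

lemma count_cancel_le (h : Bounded a σ) : (cancel σ.reverse).count .minus ≤ a := by
  induction σ using List.reverseRecOn with
  | nil => simp [cancel]
  | append_singleton σ s ih =>
    have ih := ih h.left
    have h1 := h (σ ++ [s]) [] (by simp)
    have h2 := count_cancel σ.reverse
    simp only [List.count_reverse, List.count_append] at h1 h2
    rw [List.reverse_append, List.reverse_singleton, List.singleton_append]
    cases s
    · simpa [cancel] using ih
    · simp only [cancel]
      split_ifs with hp
      · have := count_replace_plus hp
        simp; omega
      · rw [List.count_eq_zero_of_not_mem hp] at h2
        simp at h1 ⊢; omega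
    · simpa [cancel] using ih

/-- Here `σ` lists the columns to the left of those of `τ`. Balancedness lets each `-` of `σ` cancel
inside `σ`, so nothing spills over to `τ`. The last clause counts the surviving `+` of `σ` and
exists for the induction. -/
lemma cancel_append (h : Bounded 0 σ) (τ : List Sgn) :
    ∃ X : List Sgn, cancel (τ ++ σ).reverse = X ++ cancel τ.reverse ∧ X.length = σ.length ∧
      Sgn.minus ∉ X ∧ σ.count .plus = X.count .plus + σ.count .minus := by
  induction σ using List.reverseRecOn with
  | nil => exact ⟨[], by simp⟩
  | append_singleton σ s ih =>
    obtain ⟨X, h1, h2, h3, h4⟩ := ih h.left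
    have h5 := h (σ ++ [s]) [] (by simp)
    rw [← List.append_assoc, List.reverse_append, List.reverse_singleton, List.singleton_append]
    cases s
    · refine ⟨.plus :: X, ?_, ?_, ?_, ?_⟩
      · simp only [cancel, h1, List.cons_append]
      · simp [h2]
      · simpa using h3
      · simp; omega
    · have hp : Sgn.plus ∈ X := by
        simp at h5
        exact List.count_pos_iff.1 (by omega)
      have h6 := count_replace_plus hp
      refine ⟨.dot :: X.replace .plus .dot, ?_, ?_, ?_, ?_⟩
      · simp only [cancel, h1]
        rw [if_pos (List.mem_append_left _ hp), List.replace_append_left hp, List.cons_append]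
      · simp [h2]
      · have := h6.2
        rw [List.count_eq_zero_of_not_mem h3, List.count_eq_zero] at this
        simpa using this
      · simp; omega
    · refine ⟨.dot :: X, ?_, ?_, ?_, ?_⟩
      · simp only [cancel, h1, List.cons_append]
      · simp [h2]
      · simpa using h3
      · simpa using h4

end Bounded

/-- A sequence of signs whose reduced form has `a` signs `-` and no sign `+`. -/
def Exhausts (a : ℕ) (σ : List Sgn) : Prop :=
  Bounded a σ ∧ σ.count .minus = a + σ.count .plus

lemma Exhausts.count {a : ℕ} {σ : List Sgn} (h : Exhausts a σ) :
    (cancel σ.reverse).count .minus = a ∧ Sgn.plus ∉ cancel σ.reverse := by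
  have h1 := h.1.count_cancel_le
  have h2 := count_cancel σ.reverse
  have h3 := h.2
  simp only [List.count_reverse] at h2
  rw [← List.count_eq_zero]
  omega

lemma Exhausts.nil : Exhausts 0 [] := ⟨.nil, rfl⟩

lemma Exhausts.cons {a b : ℕ} {s : Sgn} {σ : List Sgn} (h : Exhausts b σ)
    (hs : (s = .plus ∧ b = a + 1) ∨ (s = .minus ∧ a = b + 1) ∨ (s = .dot ∧ b = a)) :
    Exhausts a (s :: σ) := by
  refine ⟨h.1.cons ?_, ?_⟩
  · rcases hs with ⟨rfl, hs⟩ | ⟨rfl, hs⟩ | ⟨rfl, hs⟩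
    · exact Or.inl ⟨rfl, by omega⟩
    · exact Or.inr (Or.inl ⟨rfl, by omega⟩)
    · exact Or.inr (Or.inr ⟨rfl, by omega⟩)
  · have := h.2
    rcases hs with ⟨rfl, hs⟩ | ⟨rfl, hs⟩ | ⟨rfl, hs⟩ <;> simp <;> omega

lemma head?_filter_range {L R : List Sgn} {s : Sgn} (h : s ∉ L) {N : ℕ}
    (hN : N = (L ++ s :: R).length) :
    ((List.range N).filter fun k => (L ++ s :: R)[k]? = some s).head? = some L.length := by
  rw [hN, List.length_append, List.range_add, List.filter_append, List.filter_eq_nil_iff.2,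
    List.nil_append, List.length_cons, List.range_succ_eq_map, List.map_cons, List.filter_cons_of_pos]
  · simp
  · simp
  · intro k hk
    rw [List.mem_range] at hk
    simp only [List.getElem?_append_left hk, decide_eq_true_eq]
    exact fun e => h (List.mem_of_getElem? e)

lemma getLast?_filter_range {L R : List Sgn} {s : Sgn} (h : s ∉ R) {N : ℕ}
    (hN : N = (L ++ s :: R).length) :
    ((List.range N).filter fun k => (L ++ s :: R)[k]? = some s).getLast? = some L.length := by
  have hN' : N = (L.length + 1) + R.length := by rw [hN]; simp; omega
  rw [hN', List.range_add, List.filter_append, List.filter_eq_nil_iff (l := List.map _ _) |>.2,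
    List.append_nil, List.range_succ, List.filter_append]
  · simp
  · intro k hk
    obtain ⟨j, -, rfl⟩ := List.mem_map.1 hk
    rw [List.getElem?_append_right (by omega), show L.length + 1 + j - L.length = j + 1 by omega,
      List.getElem?_cons_succ]
    simp only [decide_eq_true_eq]
    exact fun e => h (List.mem_of_getElem? e)

/-! ### Locating the good signs from a decomposition of the sign sequence. -/

section Signature

variable {p : List (List ℕ+) × List (List ℕ+)} {a : ℕ} {σ τ : List Sgn}

lemma length_signs (p : List (List ℕ+) × List (List ℕ+)) : (signs p).length = p.1.length + 1 := by
  simp [signs]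

/-- To the right of the marked `+` every `+` is cancelled, and to its left every `-`. So the marked
`+` survives, is the right-most one, and the surviving `-` are those of `σ`. -/
lemma zeroSignature_of_plus (h : signs p = σ ++ .plus :: τ) (hσ : Exhausts a σ)
    (hτ : Bounded 0 τ) : (zeroSignature p).count .minus = a ∧ goodPlus p = some σ.length := by
  obtain ⟨X, h1, h2, h3, -⟩ := hτ.cancel_append (σ ++ [.plus])
  obtain ⟨h4, h5⟩ := hσ.count
  have hz : zeroSignature p = (cancel σ.reverse).reverse ++ .plus :: X.reverse := by
    rw [zeroSignature, h, show σ ++ Sgn.plus :: τ = σ ++ [.plus] ++ τ by simp, h1]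
    simp [cancel]
  refine ⟨?_, ?_⟩
  · rw [hz]
    simp [h4, List.count_eq_zero_of_not_mem h3]
  · have hl := length_signs p
    rw [h] at hl
    rw [goodPlus, hz, head?_filter_range (by simpa using h5)]
    · simp [length_cancel]
    · rw [← hl]; simp [length_cancel, h2]

/-- Companion of `zeroSignature_of_plus`: after the marked `+` has become a `-`, it is the left-most
survivor, so `ẽ_0` undoes `f̃_0` in the same column. -/
lemma goodMinus_of_minus (h : signs p = σ ++ .minus :: τ) (hσ : Exhausts a σ)
    (hτ : Bounded 0 τ) : goodMinus p = some σ.length := by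
  obtain ⟨X, h1, h2, h3, -⟩ := hτ.cancel_append (σ ++ [.minus])
  obtain ⟨h4, h5⟩ := hσ.count
  have hz : zeroSignature p = (cancel σ.reverse).reverse ++ .minus :: X.reverse := by
    rw [zeroSignature, h, show σ ++ Sgn.minus :: τ = σ ++ [.minus] ++ τ by simp, h1]
    simp [cancel, h5]
  have hl := length_signs p
  rw [h] at hl
  rw [goodMinus, hz, getLast?_filter_range (by simpa using h3)]
  · simp [length_cancel]
  · rw [← hl]; simp [length_cancel, h2]

lemma goodMinus_eq_none (h : (zeroSignature p).count .minus = 0) : goodMinus p = none := by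
  rw [goodMinus, List.filter_eq_nil_iff.2]
  · rfl
  · intro k _
    rw [List.count_eq_zero] at h
    simp only [decide_eq_true_eq]
    exact fun e => h (List.mem_of_getElem? e)

end Signature

/-! ### Inserting an increasing word column by column -/

/-- Insertion of the letters of `w`, from left to right. -/
def insertWord (w : List ℕ+) (T : List (List ℕ+)) : List (List ℕ+) :=
  w.foldl (fun T a => insertLetter a T) T

@[simp] lemma insertWord_nil (T : List (List ℕ+)) : insertWord [] T = T := rfl

@[simp] lemma insertWord_cons (a : ℕ+) (w : List ℕ+) (T : List (List ℕ+)) :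
    insertWord (a :: w) T = insertWord w (insertLetter a T) := rfl

lemma tabOf_append_eq (u v : List ℕ+) : tabOf (u ++ v) = insertWord u.reverse (tabOf v) := by
  rw [tabOf, List.foldr_append, insertWord, List.foldl_reverse]; rfl

lemma Bump.exists_of_mem {a y : ℕ+} {c : List ℕ+} (hc : Strict c) (hy : y ∈ c) (hya : y ≤ a) :
    ∃ a' c', Bump a c a' c' := by
  rcases insertLetter_cons hc a [] with ⟨h, -⟩ | ⟨a', c', h, -⟩
  · exact absurd (h y hy) (not_lt.2 hya)
  · exact ⟨a', c', h⟩

lemma Bump.insertLetter_eq {a a' : ℕ+} {c c' : List ℕ+} (h : Bump a c a' c') (T : List (List ℕ+)) :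
    insertLetter a (c :: T) = c' :: insertLetter a' T := by
  rcases insertLetter_cons h.strict a T with ⟨h', -⟩ | ⟨b, d, h', e⟩
  · exact absurd (h' a' h.mem) (not_lt.2 h.le)
  · obtain rfl : a' = b := le_antisymm (h'.max _ h.mem h.le) (h.max _ h'.mem h'.le)
    rw [e, Strict.ext h.strict' h'.strict' fun x => by rw [h.mem_iff, h'.mem_iff]]

lemma insertLetter_of_lt {a : ℕ+} {c : List ℕ+} (hc : Strict c) (h : ∀ x ∈ c, a < x)
    (T : List (List ℕ+)) : insertLetter a (c :: T) = (a :: c) :: T := by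
  rcases insertLetter_cons hc a T with ⟨-, e⟩ | ⟨b, d, h', -⟩
  · exact e
  · exact absurd (h b h'.mem) (not_lt.2 h'.le)

lemma one_lt_of_mem {c : List ℕ+} (h1 : 1 ∉ c) {x : ℕ+} (hx : x ∈ c) : 1 < x :=
  lt_of_le_of_ne one_le fun e => h1 (e ▸ hx)

lemma Strict.cons_one {c : List ℕ+} (hc : Strict c) (h1 : 1 ∉ c) : Strict (1 :: c) :=
  List.pairwise_cons.2 ⟨fun _ hx => one_lt_of_mem h1 hx, hc⟩

lemma Bump.cons_one {a a' : ℕ+} {c c' : List ℕ+} (h : Bump a c a' c') (h1 : 1 ∉ c) :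
    Bump a (1 :: c) a' (1 :: c') := by
  have h2 : (1 : ℕ+) < a' := one_lt_of_mem h1 h.mem
  refine ⟨h.strict.cons_one h1, h.strict'.cons_one ?_, List.mem_cons_of_mem _ h.mem, h.le, ?_, ?_,
    by simp [h.length]⟩
  · rw [h.mem_iff]
    rintro (e | ⟨e, -⟩)
    · exact absurd (h2.trans_le h.le) (e ▸ lt_irrefl _)
    · exact h1 e
  · intro x hx hxa
    rcases List.mem_cons.1 hx with rfl | hx
    · exact h2.le
    · exact h.max x hx hxa
  · intro x
    rw [List.mem_cons, List.mem_cons, h.mem_iff]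
    constructor
    · rintro (rfl | h | ⟨h, h'⟩)
      · exact Or.inr ⟨Or.inl rfl, h2.ne⟩
      · exact Or.inl h
      · exact Or.inr ⟨Or.inr h, h'⟩
    · rintro (h | ⟨h | h, h'⟩)
      · exact Or.inr (Or.inl h)
      · exact Or.inl h
      · exact Or.inr (Or.inr ⟨h, h'⟩)

lemma bump_one {c : List ℕ+} (hc : Strict c) (h1 : 1 ∈ c) : Bump 1 c 1 c := by
  refine ⟨hc, hc, h1, le_rfl, fun x _ hx => hx, fun x => ?_, rfl⟩
  by_cases hx : x = 1
  · simp [hx, h1]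
  · simp [hx]

lemma bump_cons_one {a : ℕ+} {c : List ℕ+} (hc : Strict c) (h : ∀ x ∈ c, a < x) :
    Bump a (1 :: c) 1 (a :: c) := by
  have h1 : 1 ∉ c := fun h' => absurd (h 1 h') (not_lt.2 one_le)
  refine ⟨hc.cons_one h1, List.pairwise_cons.2 ⟨h, hc⟩, by simp, one_le, ?_, ?_, rfl⟩
  · intro x hx hxa
    rcases List.mem_cons.1 hx with rfl | hx
    · exact le_rfl
    · exact absurd (h x hx) (not_lt.2 hxa)
  · intro x
    rw [List.mem_cons, List.mem_cons]
    by_cases hx : x = 1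
    · simp [hx, h1]
    · simp [hx]

/-- Insertion of an increasing word into a column in which every letter bumps an entry. -/
lemma exists_insertWord_eq {w : List ℕ+} (hw : w.Pairwise (· ≤ ·)) {c : List ℕ+} (hc : Strict c)
    (h : ∀ x ∈ w.head?, ∃ y ∈ c, y ≤ x) :
    ∃ c' w', Strict c' ∧ c'.length = c.length ∧ w'.length = w.length ∧ w'.Pairwise (· ≤ ·) ∧
      (c ++ w).Perm (c' ++ w') ∧ (∀ T, insertWord w (c :: T) = c' :: insertWord w' T) ∧
      (∀ u ∈ c, (∀ x ∈ w, u ≤ x) → ∀ z ∈ w', u ≤ z) ∧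
      (1 ∉ c → ∀ T, insertWord w ((1 :: c) :: T) = (1 :: c') :: insertWord w' T) := by
  induction w generalizing c with
  | nil => exact ⟨c, [], hc, rfl, rfl, by simp, by simp, by simp, by simp, by simp⟩
  | cons x w ih =>
    obtain ⟨y, hy, hyx⟩ := h x rfl
    obtain ⟨hx, hw⟩ := List.pairwise_cons.1 hw
    obtain ⟨a, d, hb⟩ := Bump.exists_of_mem hc hy hyx
    have hxd : x ∈ d := (hb.mem_iff x).2 (Or.inl rfl)
    obtain ⟨c', w', h1, h2, h3, h4, h5, h6, h7, h8⟩ := ih hw hb.strict'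
      fun z hz => ⟨x, hxd, hx z (List.mem_of_mem_head? hz)⟩
    -- The letter `x` now lies in the column and is at most every later letter, so each of these
    -- bumps an entry at least `x`, hence at least `a`. This makes the bumped word increasing.
    have h9 : ∀ z ∈ w', x ≤ z := h7 x hxd hx
    refine ⟨c', a :: w', h1, h2.trans hb.length, by simp [h3], ?_, ?_, ?_, ?_, ?_⟩
    · exact List.pairwise_cons.2 ⟨fun z hz => hb.le.trans (h9 z hz), h4⟩
    · have e1 : (c ++ x :: w).Perm ((x :: c) ++ w) := List.perm_middle
      have e2 : ((d ++ [a]) ++ w).Perm (a :: (d ++ w)) := by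
        rw [List.append_assoc]; exact List.perm_middle
      have e3 : (a :: (c' ++ w')).Perm (c' ++ a :: w') := List.perm_middle.symm
      exact (e1.trans (hb.perm.append_right w)).trans (e2.trans ((h5.cons a).trans e3))
    · intro T
      rw [insertWord_cons, hb.insertLetter_eq, h6, insertWord_cons]
    · intro u hu hux z hz
      have hua := hb.max u hu (hux x (by simp))
      rcases List.mem_cons.1 hz with rfl | hz
      · exact hua
      · exact (hux x (by simp)).trans (h9 z hz)
    · intro hc1 T
      have hd1 := hb.cons_one hc1
      rw [insertWord_cons, hd1.insertLetter_eq, h8, insertWord_cons]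
      exact fun h' => lt_irrefl _ ((List.pairwise_cons.1 hd1.strict').1 1 h')
/-- The sign of a column `c` that grew out of the column `c₀`. -/
def colSign (c₀ c : List ℕ+) : Sgn :=
  if 1 ∈ c then (if c₀.length < c.length then .minus else .dot)
  else if c₀.length < c.length then .dot else .plus

lemma Strict.count_one {c : List ℕ+} (hc : Strict c) : c.count 1 = if 1 ∈ c then 1 else 0 := by
  split_ifs with h
  · exact List.count_eq_one_of_mem (hc.imp fun h => h.ne) h
  · exact List.count_eq_zero_of_not_mem h

/-- Three cases. If `c` contains 1, every letter bumps, and an extra leading 1 bumps the 1 of `c`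
and passes on. If `c` has no 1 and `w` is empty or its first letter bumps, no 1 is involved and an
extra 1 rests on top, undisturbed by what happens below it. Otherwise the first letter of `w` makes
the column grow; an extra 1 rests there first but is bumped out by that letter and passes on. In
each case the sign compares the numbers of letters 1 entering and leaving the column. -/
lemma exists_column_step {w c : List ℕ+} (hw : w.Pairwise (· ≤ ·)) (hc : Strict c) :
    ∃ c' w', w'.Pairwise (· ≤ ·) ∧ Strict c' ∧ w'.length ≤ w.length ∧
      (c = [] → w ≠ [] → w'.length < w.length) ∧
      (∀ T, insertWord w (c :: T) = c' :: insertWord w' T) ∧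
      ((1 ∉ c' ∧ colSign c c' = .plus ∧ w.count 1 = 0 ∧ w'.count 1 = 0 ∧
          ∀ T, insertWord (1 :: w) (c :: T) = (1 :: c') :: insertWord w' T) ∨
        (((colSign c c' = .plus ∧ w'.count 1 = w.count 1 + 1) ∨
          (colSign c c' = .minus ∧ w.count 1 = w'.count 1 + 1) ∨
          (colSign c c' = .dot ∧ w'.count 1 = w.count 1)) ∧
          ∀ T, insertWord (1 :: w) (c :: T) = c' :: insertWord (1 :: w') T)) := by
  by_cases h1 : 1 ∈ c
  · obtain ⟨c', w', g1, g2, g3, g4, g5, g6, -, -⟩ := exists_insertWord_eq hw hc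
      fun x _ => ⟨1, h1, one_le⟩
    refine ⟨c', w', g4, g1, g3.le, fun h => absurd h1 (by simp [h]), g6, Or.inr ⟨?_, fun T => ?_⟩⟩
    · have := g5.count_eq 1
      rw [List.count_append, List.count_append, hc.count_one, g1.count_one, if_pos h1] at this
      simp only [colSign, g2, lt_irrefl, if_false]
      split_ifs at this ⊢ <;> simp <;> omega
    · rw [insertWord_cons, (bump_one hc h1).insertLetter_eq, g6, insertWord_cons]
  · by_cases h2 : ∀ x ∈ w.head?, ∃ y ∈ c, y ≤ x
    · obtain ⟨c', w', g1, g2, g3, g4, g5, g6, -, g8⟩ := exists_insertWord_eq hw hc h2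
      have h3 : 1 ∉ w := by
        intro h
        rcases w with _ | ⟨x, w⟩
        · simp at h
        · obtain ⟨y, hy, hyx⟩ := h2 x rfl
          have := one_lt_of_mem h1 hy
          rcases List.mem_cons.1 h with rfl | h
          · exact absurd hyx (not_le.2 this)
          · exact absurd (hyx.trans ((List.pairwise_cons.1 hw).1 1 h)) (not_le.2 this)
      have h4 : 1 ∉ c' ++ w' := by rw [← g5.mem_iff]; simp [h1, h3]
      rw [List.mem_append, not_or] at h4
      refine ⟨c', w', g4, g1, g3.le, ?_, g6, Or.inl ⟨h4.1, ?_, List.count_eq_zero_of_not_mem h3,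
        List.count_eq_zero_of_not_mem h4.2, fun T => ?_⟩⟩
      · rintro rfl hw0
        rcases w with _ | ⟨x, w⟩
        · exact absurd rfl hw0
        · obtain ⟨y, hy, -⟩ := h2 x rfl
          simp at hy
      · simp [colSign, h4.1, g2]
      · rw [insertWord_cons, insertLetter_of_lt hc fun x hx => one_lt_of_mem h1 hx, g8 h1]
    · push Not at h2
      obtain ⟨x, hx, hxc⟩ := h2
      obtain ⟨w, rfl⟩ : ∃ w₂, w = x :: w₂ := by
        rcases w with _ | ⟨z, w⟩
        · simp at hx
        · obtain rfl : z = x := by simpa using hx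
          exact ⟨w, rfl⟩
      obtain ⟨hxw, hw⟩ := List.pairwise_cons.1 hw
      have hxc' : Strict (x :: c) := List.pairwise_cons.2 ⟨hxc, hc⟩
      obtain ⟨c', w', g1, g2, g3, g4, g5, g6, -, -⟩ := exists_insertWord_eq hw hxc'
        fun z hz => ⟨x, by simp, hxw z (List.mem_of_mem_head? hz)⟩
      refine ⟨c', w', g4, g1, by simp [g3], fun _ _ => by simp [g3], fun T => ?_,
        Or.inr ⟨?_, fun T => ?_⟩⟩
      · rw [insertWord_cons, insertLetter_of_lt hc hxc, g6]
      · have := (List.perm_middle.trans g5 : (c ++ x :: w).Perm _).count_eq 1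
        rw [List.count_append, List.count_append, List.count_eq_zero_of_not_mem h1,
          g1.count_one] at this
        have hl : c.length < c'.length := by rw [g2]; simp
        simp only [colSign, hl, if_true]
        split_ifs at this ⊢ <;> simp only [false_and, true_and, false_or, or_false] <;>
          omega
      · rw [insertWord_cons, insertWord_cons, insertLetter_of_lt hc fun x hx => one_lt_of_mem h1 hx,
          (bump_cons_one hc hxc).insertLetter_eq, g6, insertWord_cons]

/-- The signs of the columns of `S` and of the first empty column. -/
def colSigns (S₀ S : List (List ℕ+)) : List Sgn :=
  (List.range (S.length + 1)).map fun k => colSign (S₀.getD k []) (S.getD k [])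

lemma colSigns_cons (c₀ c : List ℕ+) (S₀ S : List (List ℕ+)) :
    colSigns (c₀ :: S₀) (c :: S) = colSign c₀ c :: colSigns S₀ S := by
  rw [colSigns, colSigns, List.length_cons, List.range_succ_eq_map, List.map_cons, List.map_map]
  rfl

lemma colSigns_nil_left (S : List (List ℕ+)) : colSigns [[]] S = colSigns [] S := by
  rw [colSigns, colSigns]
  refine List.map_congr_left fun k _ => ?_
  rcases k with _ | k <;> simp

lemma addTop_zero (c : List ℕ+) (T : List (List ℕ+)) : addTop 0 (c :: T) = (1 :: c) :: T := by
  simp [addTop]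

lemma addTop_succ (k : ℕ) (c : List ℕ+) (T : List (List ℕ+)) :
    addTop (k + 1) (c :: T) = c :: addTop k T := by
  simp only [addTop, List.length_cons, add_lt_add_iff_right]
  split_ifs <;> simp

/-- Lets a new column be treated as an empty existing one. For the empty word the two sides differ,
whence the hypothesis. -/
lemma insertWord_nil_eq {w : List ℕ+} (hw : w ≠ []) : insertWord w [] = insertWord w [[]] := by
  rcases w with _ | ⟨x, w⟩
  · exact absurd rfl hw
  · rw [insertWord_cons, insertWord_cons, insertLetter_of_lt (by simp) (by simp)]; rfl

/-- The number of letters 1 still carried starts at `w.count 1`, drops by one at each `-` and rises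
by at most one at each `+`; it is never negative. -/
theorem bounded_colSigns {w : List ℕ+} {S₀ : List (List ℕ+)} (hw : w.Pairwise (· ≤ ·))
    (hS : StrictCols S₀) : Bounded (w.count 1) (colSigns S₀ (insertWord w S₀)) := by
  -- Either a column of `S₀` is used up, or `S₀` is empty and the word loses a letter to the new
  -- column; so the sum decreases.
  induction h : S₀.length + w.length using Nat.strong_induction_on generalizing w S₀ with
  | _ N ih =>
    have key : ∀ (c : List ℕ+) (T : List (List ℕ+)), Strict c → StrictCols T →
        (∀ w' : List ℕ+, w'.length ≤ w.length → (c = [] → w ≠ [] → w'.length < w.length) →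
          T.length + w'.length < N) →
        Bounded (w.count 1) (colSigns (c :: T) (insertWord w (c :: T))) := by
      intro c T hc hT hN
      obtain ⟨c', w', g1, g2, g3, g4, g5, g6⟩ := exists_column_step hw hc
      rw [g5, colSigns_cons]
      refine (ih _ (hN w' g3 g4) g1 hT rfl).cons ?_
      rcases g6 with ⟨-, h1, h2, h3, -⟩ | ⟨⟨h1, h2⟩ | ⟨h1, h2⟩ | ⟨h1, h2⟩, -⟩
      · exact Or.inl ⟨h1, by omega⟩
      · exact Or.inl ⟨h1, by omega⟩
      · exact Or.inr (Or.inl ⟨h1, by omega⟩)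
      · exact Or.inr (Or.inr ⟨h1, by omega⟩)
    rcases S₀ with _ | ⟨c, T⟩
    · by_cases hw0 : w = []
      · subst hw0
        exact (Bounded.nil (a := 0)).cons (Or.inl ⟨rfl, Nat.zero_le _⟩)
      · rw [insertWord_nil_eq hw0, ← colSigns_nil_left]
        refine key [] [] (by simp) (by simp [StrictCols]) fun w' h1 h2 => ?_
        have := h2 rfl hw0
        simp at h ⊢; omega
    · refine key c T (hS c (by simp)) (fun d hd => hS d (by simp [hd])) fun w' h1 _ => ?_
      simp at h; omega

/-- Inserting an additional letter `1` before an increasing word adds a letter `1` on top of the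
column of the right-most uncancelled sign `+`. -/
theorem insertWord_one_cons {w : List ℕ+} {S₀ : List (List ℕ+)} (hw : w.Pairwise (· ≤ ·))
    (hS : StrictCols S₀) :
    ∃ σ τ, colSigns S₀ (insertWord w S₀) = σ ++ .plus :: τ ∧ Exhausts (w.count 1) σ ∧
      Bounded 0 τ ∧ insertWord (1 :: w) S₀ = addTop σ.length (insertWord w S₀) := by
  induction h : S₀.length + w.length using Nat.strong_induction_on generalizing w S₀ with
  | _ N ih =>
    have key : ∀ (c : List ℕ+) (T : List (List ℕ+)), Strict c → StrictCols T →
        (∀ w' : List ℕ+, w'.length ≤ w.length → (c = [] → w ≠ [] → w'.length < w.length) →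
          T.length + w'.length < N) →
        ∃ σ τ, colSigns (c :: T) (insertWord w (c :: T)) = σ ++ .plus :: τ ∧
          Exhausts (w.count 1) σ ∧ Bounded 0 τ ∧
          insertWord (1 :: w) (c :: T) = addTop σ.length (insertWord w (c :: T)) := by
      intro c T hc hT hN
      -- In the first case the extra 1 comes to rest here, no other 1 being carried, and the columns
      -- further left are balanced by `bounded_colSigns`. In the second it moves on to the next
      -- column.
      obtain ⟨c', w', g1, g2, g3, g4, g5, ⟨-, h1, h2, h3, h4⟩ | ⟨h1, h2⟩⟩ := exists_column_step hw hc
      · refine ⟨[], colSigns T (insertWord w' T), ?_, ?_, ?_, ?_⟩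
        · rw [g5, colSigns_cons, h1]; rfl
        · rw [h2]; exact .nil
        · rw [← h3]; exact bounded_colSigns g1 hT
        · rw [h4, g5]; exact (addTop_zero _ _).symm
      · obtain ⟨σ, τ, e1, e2, e3, e4⟩ := ih _ (hN w' g3 g4) g1 hT rfl
        refine ⟨colSign c c' :: σ, τ, ?_, e2.cons ?_, e3, ?_⟩
        · rw [g5, colSigns_cons, e1]; rfl
        · exact h1
        · rw [h2, g5, e4, List.length_cons, addTop_succ]
    rcases S₀ with _ | ⟨c, T⟩
    · by_cases hw0 : w = []
      · subst hw0
        exact ⟨[], [], rfl, .nil, .nil, rfl⟩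
      · rw [insertWord_nil_eq hw0, insertWord_nil_eq (List.cons_ne_nil _ _), ← colSigns_nil_left]
        refine key [] [] (by simp) (by simp [StrictCols]) fun w' h1 h2 => ?_
        have := h2 rfl hw0
        simp at h ⊢; omega
    · refine key c T (hS c (by simp)) (fun d hd => hS d (by simp [hd])) fun w' h1 _ => ?_
      simp at h; omega

/-! ### Removing the letters `1` -/

/-- `T'` arises from `T` by removing the letters `1`. -/
def RemovesOne (T T' : List (List ℕ+)) : Prop :=
  ∀ k, (T.getD k []).filter (1 < ·) = T'.getD k []

lemma removesOne_cons {c c' : List ℕ+} {T T' : List (List ℕ+)} :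
    RemovesOne (c :: T) (c' :: T') ↔ c.filter (1 < ·) = c' ∧ RemovesOne T T' := by
  constructor
  · exact fun h => ⟨by simpa using h 0, fun k => by simpa using h (k + 1)⟩
  · rintro ⟨h1, h2⟩ (_ | k)
    · simpa using h1
    · simpa using h2 k

lemma removesOne_nil_iff {T : List (List ℕ+)} : RemovesOne T [[]] ↔ RemovesOne T [] := by
  refine forall_congr' fun k => ?_
  rcases k with _ | k <;> simp

lemma Strict.filter_eq {c d : List ℕ+} (hc : Strict c) (hd : Strict d)
    (h : ∀ x, x ∈ d ↔ x ∈ c ∧ 1 < x) : c.filter (1 < ·) = d :=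
  Strict.ext (hc.filter _) hd fun x => by rw [h, List.mem_filter, decide_eq_true_iff]

lemma RemovesOne.insertLetter_one {T T' : List (List ℕ+)} (hT : StrictCols T)
    (h : RemovesOne T T') : RemovesOne (insertLetter 1 T) T' := by
  induction T generalizing T' with
  | nil =>
    intro k
    rcases k with _ | k
    · simpa [insertLetter] using h 0
    · simpa [insertLetter] using h (k + 1)
  | cons c T ih =>
    have hc := hT c (by simp)
    have hT' : StrictCols T := fun d hd => hT d (by simp [hd])
    rcases insertLetter_cons hc 1 T with ⟨-, e⟩ | ⟨b, d, hb, e⟩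
    · rw [e]
      intro k
      have := h k
      rcases k with _ | k
      · simpa using this
      · simpa using this
    · obtain rfl : b = 1 := le_antisymm hb.le one_le
      obtain rfl : c = d := Strict.ext hc hb.strict' fun x => by
        rw [hb.mem_iff]
        by_cases hx : x = 1
        · simp [hx, hb.mem]
        · simp [hx]
      rw [e]
      intro k
      rcases k with _ | k
      · simpa using h 0
      · have := ih hT' (T' := T'.tail) (fun k => by
          have := h (k + 1); cases T' <;> simpa using this) k
        cases T' <;> simpa using this

lemma insertLetter_nil_eq (a : ℕ+) : insertLetter a [] = insertLetter a [[]] := by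
  rw [insertLetter_of_lt (by simp) (by simp)]; rfl

/-- Letters greater than 1 are inserted as if the letters 1 were absent. The one difference occurs
when a 1 is bumped: without it the insertion stops there, while in `T` the bumped 1 continues, which
affects only letters 1. -/
lemma RemovesOne.insertLetter {T T' : List (List ℕ+)} (hT : StrictCols T)
    (h : RemovesOne T T') {a : ℕ+} (ha : 1 < a) :
    RemovesOne (insertLetter a T) (insertLetter a T') := by
  induction T generalizing T' a with
  | nil =>
    have h0 : ∀ c₀ T₀, RemovesOne [] (c₀ :: T₀) →
        RemovesOne (GlInf.insertLetter a []) (GlInf.insertLetter a (c₀ :: T₀)) := by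
      intro c₀ T₀ h k
      obtain rfl : c₀ = [] := by simpa using (h 0).symm
      rw [insertLetter_of_lt (by simp) (by simp)]
      rcases k with _ | k
      · simp [GlInf.insertLetter, ha]
      · simpa [GlInf.insertLetter] using h (k + 1)
    rcases T' with _ | ⟨c₀, T₀⟩
    · rw [insertLetter_nil_eq]
      simpa [insertLetter_nil_eq] using h0 [] [] (removesOne_nil_iff.2 h)
    · exact h0 c₀ T₀ h
  | cons c T ih =>
    have hc := hT c (by simp)
    have hT' : StrictCols T := fun d hd => hT d (by simp [hd])
    have key : ∀ c₀ T₀, RemovesOne (c :: T) (c₀ :: T₀) →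
        RemovesOne (GlInf.insertLetter a (c :: T)) (GlInf.insertLetter a (c₀ :: T₀)) := by
      intro c₀ T₀ h
      obtain ⟨rfl, hR⟩ := removesOne_cons.1 h
      have hc₀ : Strict (c.filter (1 < ·)) := hc.filter _
      have hm : ∀ x, x ∈ c.filter (1 < ·) ↔ x ∈ c ∧ 1 < x := fun x => by
        rw [List.mem_filter, decide_eq_true_iff]
      rcases insertLetter_cons hc a T with ⟨hlt, e⟩ | ⟨b, d, hb, e⟩
      · rw [e, insertLetter_of_lt hc₀ fun x hx => hlt x ((hm x).1 hx).1]
        exact removesOne_cons.2 ⟨by simp [ha], hR⟩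
      · rw [e]
        by_cases hb1 : 1 < b
        · obtain ⟨b', d', hb'⟩ := Bump.exists_of_mem hc₀ ((hm b).2 ⟨hb.mem, hb1⟩) hb.le
          have hm' := (hm b').1 hb'.mem
          obtain rfl : b' = b := le_antisymm (hb.max _ hm'.1 hb'.le)
            (hb'.max _ ((hm b).2 ⟨hb.mem, hb1⟩) hb.le)
          rw [hb'.insertLetter_eq]
          refine removesOne_cons.2 ⟨Strict.filter_eq hb.strict' hb'.strict' fun x => ?_, ih hT' hR hb1⟩
          rw [hb.mem_iff, hb'.mem_iff, hm]
          constructor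
          · rintro (rfl | ⟨⟨h1, h2⟩, h3⟩)
            · exact ⟨Or.inl rfl, ha⟩
            · exact ⟨Or.inr ⟨h1, h3⟩, h2⟩
          · rintro ⟨rfl | ⟨h1, h3⟩, h2⟩
            · exact Or.inl rfl
            · exact Or.inr ⟨⟨h1, h2⟩, h3⟩
        · obtain rfl : b = 1 := le_antisymm (not_lt.1 hb1) one_le
          have hlt : ∀ x ∈ c.filter (1 < ·), a < x := by
            intro x hx
            by_contra hxa
            exact absurd (hb.max x ((hm x).1 hx).1 (not_lt.1 hxa)) (not_le.2 ((hm x).1 hx).2)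
          rw [insertLetter_of_lt hc₀ hlt]
          refine removesOne_cons.2 ⟨Strict.filter_eq hb.strict' (List.pairwise_cons.2 ⟨hlt, hc₀⟩)
            fun x => ?_, hR.insertLetter_one hT'⟩
          rw [hb.mem_iff, List.mem_cons, hm]
          constructor
          · rintro (rfl | ⟨h1, h2⟩)
            · exact ⟨Or.inl rfl, ha⟩
            · exact ⟨Or.inr ⟨h1, h2.ne'⟩, h2⟩
          · rintro ⟨rfl | ⟨h1, h3⟩, h2⟩
            · exact Or.inl rfl
            · exact Or.inr ⟨h1, h2⟩
    rcases T' with _ | ⟨c₀, T₀⟩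
    · rw [insertLetter_nil_eq]
      exact key [] [] (removesOne_nil_iff.2 h)
    · exact key c₀ T₀ h

lemma removesOne_tabOf (w : List ℕ+) : RemovesOne (tabOf w) (tabOf (w.filter (1 < ·))) := by
  induction w with
  | nil => intro k; simp
  | cons a w ih =>
    rw [tabOf_cons]
    by_cases ha : 1 < a
    · rw [List.filter_cons_of_pos (by simpa using ha), tabOf_cons]
      exact ih.insertLetter (strictCols_tabOf w) ha
    · rw [List.filter_cons_of_neg (by simpa using ha), le_antisymm (not_lt.1 ha) one_le]
      exact ih.insertLetter_one (strictCols_tabOf w)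

/-- The matrix with the first column removed. -/
noncomputable def delCol (A : Mat) : Mat := A.filter (fun p => 1 < p.2)

lemma count_filter_seq (A : Mat) (P : ℕ+ × ℕ+ → Prop) [DecidablePred P] (p : ℕ+ × ℕ+) :
    ((seqΩ' A).filter P).count p = if P p then A p else 0 := by
  split_ifs with h
  · rw [List.count_filter (by simpa using h), count_seqΩ']
  · exact List.count_eq_zero_of_not_mem fun h' => h (by simpa using (List.mem_filter.1 h').2)

lemma wordL_delCol (A : Mat) : wordL (delCol A) = (wordL A).filter (1 < ·) := by
  rw [wordL, wordL, List.filter_map]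
  congr 1
  refine seqΩ'_eq ((seqΩ'_sorted A).filter _) fun p => ?_
  refine (count_filter_seq A (fun p => 1 < p.2) p).trans ?_
  rw [delCol, Finsupp.filter_apply]

lemma wordL_matT_delCol (A : Mat) : wordL (matT (delCol A)) = rowsGe (matT A) (1 + 1) := by
  rw [wordL, rowsGe]
  congr 1
  refine seqΩ'_eq ((seqΩ'_sorted _).filter _) fun p => ?_
  refine (count_filter_seq (matT A) (fun p => 1 + 1 ≤ p.1) p).trans ?_
  obtain ⟨i, j⟩ := p
  rw [matT_apply, matT_apply, delCol, Finsupp.filter_apply]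
  simp only [PNat.add_one_le_iff]

lemma delCol_add_single (A : Mat) (a : ℕ) : delCol (A + single (1, 1) a) = delCol A := by
  ext p
  simp only [delCol, Finsupp.filter_apply, Finsupp.add_apply, Finsupp.single_apply]
  split_ifs with h1 h2
  · rw [← h2] at h1; exact absurd h1 (lt_irrefl _)
  · rfl
  · rfl

/-- The first column of `A` is the first row of the transpose. It stands first in the word and is
therefore inserted last, as an increasing word. -/
lemma tabOf_wordL_matT_eq (A : Mat) : tabOf (wordL (matT A)) =
    insertWord (matRow (matT A) 1).reverse (tabOf (wordL (matT (delCol A)))) := by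
  rw [← rowsGe_one, rowsGe_eq, tabOf_append_eq, wordL_matT_delCol]

/-- The new 1 ends the decreasing row, so after reversal it is the first letter to be inserted. -/
lemma matRow_add_single (A : Mat) :
    matRow (matT (A + single (1, 1) 1)) 1 = matRow (matT A) 1 ++ [1] := by
  refine List.Perm.eq_of_pairwise (le := (· ≥ ·)) (fun a b _ _ h1 h2 => le_antisymm h2 h1)
    (matRow_sorted _ _) ?_ (List.perm_iff_count.2 fun n => ?_)
  · rw [List.pairwise_append]
    exact ⟨matRow_sorted _ _, by simp, fun a _ b hb => by
      obtain rfl : b = 1 := by simpa using hb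
      exact one_le⟩
  · rw [List.count_append, count_matRow, count_matRow, matT_apply, matT_apply]
    simp only [Finsupp.add_apply, Finsupp.single_apply, Prod.mk.injEq, and_true,
      List.count_singleton, beq_iff_eq]

/-! ### The operators with index zero -/

lemma columnSign_eq {s t : List ℕ+} (hs : Strict s) (ht : Strict t) (h : s.length = t.length) :
    columnSign s t = if 1 ∈ s then (if 1 ∈ t then .minus else .dot)
      else if 1 ∈ t then .dot else .plus := by
  have hmem : ∀ (x : ℕ+) c, Strict (x :: c) → (1 ∈ x :: c ↔ x = 1) := by
    intro x c hc
    refine ⟨fun h => ?_, by rintro rfl; simp⟩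
    rcases List.mem_cons.1 h with h | h
    · exact h.symm
    · exact absurd ((List.pairwise_cons.1 hc).1 1 h) (not_lt.2 one_le)
  rcases s with _ | ⟨a, s⟩ <;> rcases t with _ | ⟨b, t⟩
  · rfl
  · simp at h
  · simp at h
  · rw [if_congr (hmem a s hs) rfl rfl]
    simp only [if_congr (hmem b t ht) rfl rfl, columnSign, List.head?_cons]
    have ha : 1 < a ↔ a ≠ 1 := ⟨fun h => h.ne', fun h => lt_of_le_of_ne one_le h.symm⟩
    have hb : 1 < b ↔ b ≠ 1 := ⟨fun h => h.ne', fun h => lt_of_le_of_ne one_le h.symm⟩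
    simp only [ha, hb]
    by_cases h1 : a = 1 <;> by_cases h2 : b = 1 <;> simp [h1, h2]

lemma strict_getD {T : List (List ℕ+)} (hT : StrictCols T) (k : ℕ) : Strict (T.getD k []) := by
  by_cases h : k < T.length
  · rw [List.getD_eq_getElem _ _ h]; exact hT _ (List.getElem_mem h)
  · rw [List.getD_eq_default _ _ (not_lt.1 h)]; simp

lemma length_getD_of_shape_eq {S T : List (List ℕ+)} (h : shape S = shape T) (k : ℕ) :
    (S.getD k []).length = (T.getD k []).length := by
  have := congrArg (fun l => l.getD k 0) h
  simp only [shape] at this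
  rwa [show (0 : ℕ) = ([] : List ℕ+).length from rfl, List.getD_map, List.getD_map] at this

lemma ext_getD {S T : List (List ℕ+)} (hS : ∀ c ∈ S, c ≠ []) (hT : ∀ c ∈ T, c ≠ [])
    (h : ∀ k, S.getD k [] = T.getD k []) : S = T := by
  induction S generalizing T with
  | nil =>
    rcases T with _ | ⟨d, T⟩
    · rfl
    · exact absurd (by simpa using (h 0).symm) (hT d (by simp))
  | cons c S ih =>
    rcases T with _ | ⟨d, T⟩
    · exact absurd (by simpa using h 0) (hS c (by simp))
    · rw [show c = d by simpa using h 0, ih (fun c hc => hS c (List.mem_cons_of_mem _ hc))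
        (fun c hc => hT c (List.mem_cons_of_mem _ hc)) fun k => by simpa using h (k + 1)]

lemma addTop_getD {m : ℕ} {T : List (List ℕ+)} (h : m ≤ T.length) (k : ℕ) :
    (addTop m T).getD k [] = if k = m then 1 :: T.getD m [] else T.getD k [] := by
  induction T generalizing m k with
  | nil =>
    obtain rfl : m = 0 := by simpa using h
    rcases k with _ | k <;> simp [addTop]
  | cons c T ih =>
    rcases m with _ | m
    · rw [addTop_zero]
      rcases k with _ | k <;> simp
    · rw [addTop_succ]
      rcases k with _ | k
      · simp
      · simpa using ih (by simpa using h) k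

lemma addTop_ne_nil {m : ℕ} {T : List (List ℕ+)} (hT : ∀ c ∈ T, c ≠ []) :
    ∀ c ∈ addTop m T, c ≠ [] := by
  induction T generalizing m with
  | nil => simp [addTop]
  | cons d T ih =>
    have hd := hT d (by simp)
    have hT' : ∀ c ∈ T, c ≠ [] := fun c hc => hT c (by simp [hc])
    rcases m with _ | m
    · rw [addTop_zero]
      intro c hc
      rcases List.mem_cons.1 hc with rfl | hc
      · simp
      · exact hT' c hc
    · rw [addTop_succ]
      intro c hc
      rcases List.mem_cons.1 hc with rfl | hc
      · exact hd
      · exact ih hT' c hc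

lemma length_addTop {m : ℕ} {T : List (List ℕ+)} :
    (addTop m T).length = if m < T.length then T.length else T.length + 1 := by
  rw [addTop]; split_ifs <;> simp

/-- Absence of empty columns in `T` ensures that the filter in `removeTop` discards at most the
column created by `addTop`. -/
lemma removeTop_addTop {m : ℕ} {T : List (List ℕ+)} (hT : ∀ c ∈ T, c ≠ []) (h : m ≤ T.length) :
    removeTop m (addTop m T) = T := by
  induction T generalizing m with
  | nil =>
    obtain rfl : m = 0 := by simpa using h
    simp [addTop, removeTop]
  | cons d T ih =>
    have hd := hT d (by simp)
    have hT' : ∀ c ∈ T, c ≠ [] := fun c hc => hT c (by simp [hc])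
    rcases m with _ | m
    · rw [addTop_zero, removeTop, List.modify_zero_cons, List.tail_cons, List.filter_eq_self]
      intro c hc
      simpa using hT c hc
    · have := ih hT' (m := m) (by simpa using h)
      rw [removeTop] at this
      rw [addTop_succ, removeTop, List.modify_succ_cons, List.filter_cons_of_pos (by simpa using hd),
        this]

/-- Only one sign changes, except that filling the first empty column lengthens the list by the `+`
of the next empty one; hence `τ'` instead of `τ`. -/
lemma signs_addTop {S T : List (List ℕ+)} {σ τ : List Sgn}
    (h : signs (S, T) = σ ++ .plus :: τ) (hτ : Bounded 0 τ)
    (hm : columnSign (1 :: S.getD σ.length []) (1 :: T.getD σ.length []) = .minus)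
    (hl : σ.length ≤ T.length) :
    ∃ τ', signs (addTop σ.length S, addTop σ.length T) = σ ++ .minus :: τ' ∧ Bounded 0 τ' := by
  have hlen := length_signs (S, T)
  rw [h] at hlen
  simp only [List.length_append, List.length_cons] at hlen
  have hr : ∀ (f : ℕ → Sgn) r, (List.range (σ.length + 1 + r)).map f = (List.range σ.length).map f ++
      f σ.length :: (List.range r).map fun i => f (σ.length + 1 + i) := by
    intro f r
    rw [List.range_add, List.range_succ]
    simp
  have hsig : ∀ p : List (List ℕ+) × List (List ℕ+), ∀ r, p.1.length = σ.length + r → signs p =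
      (List.range (σ.length + 1 + r)).map fun k => columnSign (p.1.getD k []) (p.2.getD k []) := by
    intro p r h
    rw [signs, h, show σ.length + r + 1 = σ.length + 1 + r by omega]
  rw [hsig (S, T) τ.length (by simp; omega), hr] at h
  obtain ⟨h1, h2⟩ := List.append_inj h (by simp)
  rw [List.cons.injEq] at h2
  have hS : σ.length ≤ S.length := by omega
  obtain ⟨r, hr1, hr2⟩ : ∃ r, (addTop σ.length S).length = σ.length + r ∧
      (r = τ.length ∨ (S.length = σ.length ∧ r = 1)) := by
    rw [length_addTop]
    split_ifs with h
    · exact ⟨τ.length, by omega, Or.inl rfl⟩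
    · exact ⟨1, by omega, Or.inr ⟨by omega, rfl⟩⟩
  rw [hsig _ r hr1, hr]
  simp only [addTop_getD hS, addTop_getD hl, if_true, hm]
  have e1 : ∀ i ∈ List.range σ.length, i ≠ σ.length := fun i hi => (List.mem_range.1 hi).ne
  have e2 : ∀ i, σ.length + 1 + i ≠ σ.length := fun i => by omega
  refine ⟨_, congrArg₂ _ ?_ rfl, ?_⟩
  · refine Eq.trans (List.map_congr_left fun i hi => ?_) h1
    rw [if_neg (e1 i hi), if_neg (e1 i hi)]
  · simp only [e2, if_false]
    rcases hr2 with rfl | ⟨h3, rfl⟩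
    · rw [h2.2]; exact hτ
    · rw [List.range_one, List.map_singleton, List.getD_eq_default S _ (by omega)]
      exact (Bounded.nil (a := 0)).cons (Or.inl ⟨rfl, Nat.zero_le _⟩)

/-- The index 0 part of the theorem: `S` is controlled by `insertWord_one_cons`, and `T` by its
letters greater than 1 together with the equality of shapes. The claim on `ẽ_0` is stated at `A + E`
to avoid subtraction. -/
theorem zero_operators (A : Mat) :
    (zeroSignature (tabOf (wordL (matT A)), tabOf (wordL A))).count .minus = A (1, 1) ∧
    zeroF (tabOf (wordL (matT A)), tabOf (wordL A)) =
      some (tabOf (wordL (matT (A + single (1, 1) 1))), tabOf (wordL (A + single (1, 1) 1))) ∧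
    zeroE (tabOf (wordL (matT (A + single (1, 1) 1))), tabOf (wordL (A + single (1, 1) 1))) =
      some (tabOf (wordL (matT A)), tabOf (wordL A)) := by
  have hS₁ := tabOf_wordL_matT_eq (A + single (1, 1) 1)
  rw [matRow_add_single, delCol_add_single, List.reverse_append, List.reverse_singleton,
    List.singleton_append] at hS₁
  have hw : (matRow (matT A) 1).reverse.Pairwise (· ≤ ·) := by
    rw [List.pairwise_reverse]; exact matRow_sorted _ _
  obtain ⟨σ, τ, h1, h2, h3, h4⟩ := insertWord_one_cons hw
    (strictCols_tabOf (wordL (matT (delCol A))))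
  rw [← hS₁, ← tabOf_wordL_matT_eq] at h4
  rw [← tabOf_wordL_matT_eq] at h1
  rw [List.count_reverse, count_matRow, matT_apply] at h2
  have hT := removesOne_tabOf (wordL A)
  have hT₁ := removesOne_tabOf (wordL (A + single (1, 1) 1))
  rw [← wordL_delCol] at hT hT₁
  rw [delCol_add_single] at hT₁
  have sh := shape_tabOf_wordL_matT A
  have sh₁ := shape_tabOf_wordL_matT (A + single (1, 1) 1)
  have sh₀ := shape_tabOf_wordL_matT (delCol A)
  have nS := (isAntiSST_tabOf (wordL (matT A))).nonempty
  have nT := (isAntiSST_tabOf (wordL A)).nonempty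
  have nT₁ := (isAntiSST_tabOf (wordL (A + single (1, 1) 1))).nonempty
  have cS := strictCols_tabOf (wordL (matT A))
  have cT := strictCols_tabOf (wordL A)
  have cT₁ := strictCols_tabOf (wordL (A + single (1, 1) 1))
  rw [h4] at sh₁ ⊢
  generalize tabOf (wordL (matT A)) = S at *
  generalize tabOf (wordL A) = T at *
  generalize tabOf (wordL (A + single (1, 1) 1)) = T₁ at *
  generalize tabOf (wordL (matT (delCol A))) = S₀ at *
  generalize tabOf (wordL (delCol A)) = T₀ at *
  have hlen : ∀ c : List ℕ+, Strict c →
      c.length = (c.filter (1 < ·)).length + if 1 ∈ c then 1 else 0 := by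
    intro c hc
    rw [← hc.count_one, List.length_eq_countP_add_countP (fun x => decide (1 < x)),
      List.countP_eq_length_filter, List.count_eq_countP]
    congr 1
    refine List.countP_congr fun x _ => ?_
    simp only [beq_iff_eq, not_lt, decide_eq_true_eq]
    exact ⟨fun h => le_antisymm h one_le, fun h => h.le⟩
  -- Column `k` of `T` without its 1 is column `k` of `T₀`, which is as long as that of `S₀`. So `T`
  -- has a 1 there exactly when `S` has outgrown `S₀`.
  have hST : ∀ k, colSign (S₀.getD k []) (S.getD k []) = columnSign (S.getD k []) (T.getD k []) := by
    intro k
    have g1 := length_getD_of_shape_eq sh k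
    have g2 := length_getD_of_shape_eq sh₀ k
    have g3 := hlen _ (strict_getD cT k)
    rw [hT k] at g3
    have g4 : (S₀.getD k []).length < (S.getD k []).length ↔ 1 ∈ T.getD k [] := by
      split_ifs at g3 with h
      · simp only [h, iff_true]; omega
      · simp only [h, iff_false]; omega
    rw [columnSign_eq (strict_getD cS k) (strict_getD cT k) g1]
    simp only [colSign, g4]
  have hsig : signs (S, T) = σ ++ .plus :: τ := by
    rw [← h1, signs, colSigns]
    exact List.map_congr_left fun k _ => (hST k).symm
  have hlS : σ.length ≤ S.length := by
    have := length_signs (S, T)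
    rw [hsig] at this
    simp only [List.length_append, List.length_cons] at this
    omega
  have hlT : σ.length ≤ T.length := by
    have := congrArg List.length sh
    simp only [shape, List.length_map] at this
    omega
  -- Both tableaux have the same letters greater than 1 in each column, and their column lengths
  -- differ only at `σ.length`, as they do for `S`. So the difference is a single 1.
  have hT₁' : T₁ = addTop σ.length T := by
    refine ext_getD nT₁ (addTop_ne_nil nT) fun k => ?_
    rw [addTop_getD hlT]
    have g1 := length_getD_of_shape_eq sh k
    have g2 := length_getD_of_shape_eq sh₁ k
    have g3 := hlen _ (strict_getD cT k)
    have g4 := hlen _ (strict_getD cT₁ k)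
    rw [addTop_getD hlS] at g2
    rw [hT k] at g3
    rw [hT₁ k] at g4
    have hmem : ∀ x, 1 < x → (x ∈ T₁.getD k [] ↔ x ∈ T.getD k []) := by
      intro x hx
      have := (hT₁ k).trans (hT k).symm
      have := congrArg (fun l => x ∈ l) this
      simpa [List.mem_filter, hx] using this
    split_ifs at g2 ⊢ with hk
    · subst hk
      rw [List.length_cons] at g2
      have m1 : 1 ∈ T₁.getD σ.length [] := by
        by_contra h; rw [if_neg h] at g4; omega
      have m2 : 1 ∉ T.getD σ.length [] := by
        intro h; rw [if_pos h] at g3; split_ifs at g4; omega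
      refine Strict.ext (strict_getD cT₁ _) ((strict_getD cT _).cons_one m2) fun x => ?_
      rcases eq_or_lt_of_le (one_le (a := x)) with rfl | hx
      · simp only [m1, List.mem_cons, true_or]
      · rw [hmem x hx, List.mem_cons, or_iff_right hx.ne']
    · refine Strict.ext (strict_getD cT₁ _) (strict_getD cT _) fun x => ?_
      rcases eq_or_lt_of_le (one_le (a := x)) with rfl | hx
      · split_ifs at g3 g4 with a b b <;> first | omega | simp only [a, b]
      · exact hmem x hx
  subst hT₁'
  obtain ⟨k1, k2⟩ := zeroSignature_of_plus hsig h2 h3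
  obtain ⟨τ', k3, k4⟩ := signs_addTop hsig h3 (by simp [columnSign]) hlT
  refine ⟨k1, ?_, ?_⟩
  · rw [zeroF, k2]; rfl
  · rw [zeroE, goodMinus_of_minus k3 h2 k4, Option.map_some, removeTop_addTop nS hlS,
      removeTop_addTop nT hlT]

lemma zeroE_eq_none {A : Mat} (h : A (1, 1) = 0) :
    zeroE (tabOf (wordL (matT A)), tabOf (wordL A)) = none := by
  rw [zeroE, goodMinus_eq_none ((zero_operators A).1.trans h)]; rfl

/-! ### Weights -/

lemma matWt_add (A B : Mat) : matWt (A + B) = matWt A + matWt B := by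
  rw [matWt, Finsupp.sum_add_index']
  · rfl
  · simp
  · intro p a b; rw [add_smul]

lemma matWt_single (p : ℕ+ × ℕ+) (a : ℕ) :
    matWt (single p a) = a • (negLetter.wt p.1 + posLetter.wt p.2) := by
  rw [matWt, Finsupp.sum_single_index (by simp)]

lemma wordWt_perm {C : CrystalData ℕ+} {u v : List ℕ+} (h : u.Perm v) : wordWt C u = wordWt C v :=
  (h.map _).sum_eq

/-- Splits the weight into its two halves, each depending only on the content of one word, so that
operators and insertion can be treated on one side at a time. -/
lemma matWt_eq (A : Mat) : matWt A = wordWt negLetter (wordL (matT A)) + wordWt posLetter (wordL A) := by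
  have h1 : matWt A =
      ((Finsupp.toMultiset A).map fun p => negLetter.wt p.1 + posLetter.wt p.2).sum := by
    induction A using Finsupp.induction_linear with
    | zero => simp [matWt]
    | add f g hf hg => rw [matWt_add, hf, hg, map_add, Multiset.map_add, Multiset.sum_add]
    | single p a =>
      rw [matWt_single, Finsupp.toMultiset_single, Multiset.map_nsmul, Multiset.map_singleton,
        Multiset.sum_nsmul, Multiset.sum_singleton]
  have h2 := (wordL_perm_wordK (matT A))
  rw [matT_matT] at h2
  rw [h1, ← coe_seqΩ', Multiset.map_coe, Multiset.sum_coe, List.sum_map_add, wordWt_perm h2,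
    wordWt, wordWt, wordK, wordL, List.map_map, List.map_map]
  rfl

lemma pairing_sub (μ ν : Weight) (i : ℤ) : pairing (μ - ν) i = pairing μ i - pairing ν i := by
  rw [eq_sub_iff_add_eq, ← pairing_add, sub_add_cancel]

lemma pairing_simpleRoot (i : ℤ) : pairing (simpleRoot i) i = 2 := by
  have h : leftIdx i ≠ rightIdx i := by
    rw [leftIdx, rightIdx]
    split_ifs <;> simp only [ne_eq, Subtype.mk.injEq] <;> omega
  simp [pairing, simpleRoot, eps, h, h.symm]

lemma pairing_wordWt_eq_zero {C : CrystalData ℕ+} {i : ℤ} (h : ∀ a, pairing (C.wt a) i = 0)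
    (w : List ℕ+) : pairing (wordWt C w) i = 0 := by
  induction w with
  | nil => simp [wordWt]
  | cons a w ih =>
    rw [wordWt, List.map_cons, List.sum_cons, pairing_add, ← wordWt, ih, h, add_zero]

lemma pairing_negLetter (n a : ℕ+) : pairing (negLetter.wt a) (n : ℕ) = 0 := by
  have hn := n.pos
  have ha := a.pos
  have h0 : ¬ ((n : ℕ) : ℤ) < 0 := by omega
  have h1 : ¬ -((a : ℕ) : ℤ) = (n : ℕ) := by omega
  have h2 : ¬ -((a : ℕ) : ℤ) = (n : ℕ) + 1 := by omega
  simp only [pairing, negLetter, eps, leftIdx, rightIdx, dif_neg h0, dif_pos (Int.natCast_pos.2 hn)]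
  simp [h2]

lemma pairing_posLetter (n a : ℕ+) : pairing (posLetter.wt a) (-((n : ℕ) : ℤ)) = 0 := by
  have hn := n.pos
  have ha := a.pos
  have h0 : ¬ 0 < -((n : ℕ) : ℤ) := by omega
  have h1 : ¬ ((a : ℕ) : ℤ) = -((n : ℕ) : ℤ) := by omega
  have h2 : ¬ ((a : ℕ) : ℤ) = -((n : ℕ) : ℤ) - 1 := by omega
  simp only [pairing, posLetter, eps, leftIdx, rightIdx, dif_neg h0,
    dif_pos (show -((n : ℕ) : ℤ) < 0 by omega)]
  simp [h2]

lemma FStep.wordWt_eq {C : CrystalData ℕ+} {n : ℕ+} {i : ℤ} {w w' : List ℕ+} (h : FStep n w w')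
    (hC : C.wt (n + 1) = C.wt n - simpleRoot i) : wordWt C w' = wordWt C w - simpleRoot i := by
  obtain ⟨u, v, rfl, rfl, -⟩ := h
  simp only [wordWt, List.map_append, List.map_cons, List.sum_append, List.sum_cons, hC]
  abel

lemma posLetter_wt_succ (n : ℕ+) :
    posLetter.wt (n + 1) = posLetter.wt n - simpleRoot (n : ℕ) := by
  have hn := n.pos
  have h0 : ¬ ((n : ℕ) : ℤ) < 0 := by omega
  simp only [posLetter, simpleRoot, leftIdx, rightIdx, dif_neg h0, dif_pos (Int.natCast_pos.2 hn)]
  simp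

lemma negLetter_wt_succ (n : ℕ+) :
    negLetter.wt (n + 1) = negLetter.wt n - simpleRoot (-((n : ℕ) : ℤ)) := by
  have hn := n.pos
  have h0 : ¬ 0 < -((n : ℕ) : ℤ) := by omega
  have h1 : -((n : ℕ) : ℤ) - 1 = -(((n + 1 : ℕ+) : ℕ) : ℤ) := by push_cast; ring
  simp only [negLetter, simpleRoot, leftIdx, rightIdx, dif_neg h0,
    dif_pos (show -((n : ℕ) : ℤ) < 0 by omega), h1]
  abel

/-! ### The crystal axioms -/

/-- For finite ε it suffices to describe lowering by a relation of which `ẽ` is the inverse, and to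
give the changes of ε and wt. The change of φ follows from `⟨α_i, h_i⟩ = 2`, and the axiom for `-∞`
is vacuous. -/
theorem isCrystal_of_spec {B : Type*} {C : CrystalData B}
    (h : ∀ i, ∃ (ε : B → ℤ) (F : B → B → Prop), (∀ b, C.ε i b = ((ε b : ℤ) : WithBot ℤ)) ∧
      (∀ b, C.φ i b = ((pairing (C.wt b) i + ε b : ℤ) : WithBot ℤ)) ∧
      (∀ b b', C.f i b = some b' ↔ F b b') ∧ (∀ b b', C.e i b' = some b ↔ F b b') ∧
      ∀ b b', F b b' → ε b' = ε b + 1 ∧ C.wt b' = C.wt b - simpleRoot i) : IsCrystal C := by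
  choose ε F h1 h2 h3 h4 h5 using h
  refine ⟨fun i b => ?_, fun i b b' he => ?_, fun i b b' hf => ?_, fun i b b' => ?_,
    fun i b hb => ?_⟩
  · rw [h1, h2, WithBot.coe_add]
  · obtain ⟨e1, e2⟩ := h5 i _ _ ((h4 i _ _).1 he)
    rw [h1, h1, h2, h2, e1, e2, pairing_sub, pairing_simpleRoot, ← WithBot.coe_add,
      ← WithBot.coe_add, WithBot.coe_inj, WithBot.coe_inj]
    exact ⟨by ring, by ring, by abel⟩
  · obtain ⟨e1, e2⟩ := h5 i _ _ ((h3 i _ _).1 hf)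
    rw [h1, h1, h2, h2, e1, e2, pairing_sub, pairing_simpleRoot, ← WithBot.coe_add,
      ← WithBot.coe_add, WithBot.coe_inj, WithBot.coe_inj]
    exact ⟨by ring, by ring, rfl⟩
  · rw [h3, h4]
  · rw [h2] at hb
    exact absurd hb (WithBot.coe_ne_bot)

lemma int_cases (i : ℤ) : (∃ n : ℕ+, i = -((n : ℕ) : ℤ)) ∨ i = 0 ∨ ∃ n : ℕ+, i = ((n : ℕ) : ℤ) := by
  rcases lt_trichotomy i 0 with h | h | h
  · exact Or.inl ⟨⟨i.natAbs, by omega⟩, by rw [PNat.mk_coe]; omega⟩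
  · exact Or.inr (Or.inl h)
  · exact Or.inr (Or.inr ⟨⟨i.natAbs, by omega⟩, by rw [PNat.mk_coe]; omega⟩)

section Branches

variable (n : ℕ+) {α : Sort*} (x y z : α)

lemma ite_neg_index :
    (if -((n : ℕ) : ℤ) < 0 then x else if -((n : ℕ) : ℤ) = 0 then y else z) = x :=
  if_pos (by have := n.pos; omega)

lemma ite_pos_index :
    (if ((n : ℕ) : ℤ) < 0 then x else if ((n : ℕ) : ℤ) = 0 then y else z) = z := by
  have := n.pos
  rw [if_neg (by omega), if_neg (by omega)]

end Branches

lemma matCrystal_f_pos (n : ℕ+) (A B : Mat) :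
    matCrystal.f (n : ℕ) A = some B ↔ MStep n A B := by
  simp only [matCrystal, ite_pos_index]
  exact wordF_map_iff (isLetter_pos n) A B

lemma matCrystal_e_pos (n : ℕ+) (A B : Mat) :
    matCrystal.e (n : ℕ) B = some A ↔ MStep n A B := by
  simp only [matCrystal, ite_pos_index]
  exact wordE_map_iff (isLetter_pos n) A B

lemma map_matOf_iff (o : Option (List ℕ+)) (v : List ℕ+) (B : Mat) :
    o.map (fun u => matOf u v) = some B ↔ o.map (fun u => matOf v u) = some (matT B) := by
  simp only [Option.map_eq_some_iff]
  refine exists_congr fun u => and_congr_right fun _ => ?_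
  rw [matOf_swap]
  constructor
  · rintro rfl; rw [matT_matT]
  · intro h; rw [h, matT_matT]

lemma matCrystal_f_neg (n : ℕ+) (A B : Mat) :
    matCrystal.f (-((n : ℕ) : ℤ)) A = some B ↔ MStep n (matT A) (matT B) := by
  simp only [matCrystal, ite_neg_index]
  rw [map_matOf_iff, wordI_eq, wordJ_eq]
  exact wordF_map_iff (isLetter_neg n) _ _

lemma matCrystal_e_neg (n : ℕ+) (A B : Mat) :
    matCrystal.e (-((n : ℕ) : ℤ)) B = some A ↔ MStep n (matT A) (matT B) := by
  simp only [matCrystal, ite_neg_index]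
  rw [map_matOf_iff, wordI_eq, wordJ_eq]
  exact wordE_map_iff (isLetter_neg n) _ _

lemma matCrystal_f_zero (A : Mat) : matCrystal.f 0 A = some (A + single (1, 1) 1) := by
  simp [matCrystal]

lemma matCrystal_e_zero (A : Mat) : matCrystal.e 0 A =
    if A (1, 1) ≠ 0 then some (A - single (1, 1) 1) else none := by
  simp [matCrystal]

lemma exists_eq_add_single {A : Mat} (h : A (1, 1) ≠ 0) : ∃ A', A = A' + single (1, 1) 1 :=
  ⟨A - single (1, 1) 1, (tsub_add_cancel_of_le (by
    rw [Finsupp.single_le_iff]; omega)).symm⟩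

lemma matWt_pairing_pos (n : ℕ+) (A : Mat) :
    pairing (matWt A) (n : ℕ) + ep n (wordL A) = ph n (wordL A) := by
  rw [matWt_eq, pairing_add, pairing_wordWt_eq_zero (pairing_negLetter n),
    (isLetter_pos n).pairing_wordWt]
  have := ph_add_count n (wordL A)
  omega

lemma matWt_pairing_neg (n : ℕ+) (A : Mat) :
    pairing (matWt A) (-((n : ℕ) : ℤ)) + ep n (wordL (matT A)) = ph n (wordL (matT A)) := by
  rw [matWt_eq, pairing_add, pairing_wordWt_eq_zero (pairing_posLetter n),
    (isLetter_neg n).pairing_wordWt]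
  have := ph_add_count n (wordL (matT A))
  omega

theorem isCrystal_matCrystal : IsCrystal matCrystal := by
  refine isCrystal_of_spec fun i => ?_
  rcases int_cases i with ⟨n, rfl⟩ | rfl | ⟨n, rfl⟩
  · refine ⟨fun A => ep n (wordL (matT A)), fun A B => MStep n (matT A) (matT B), fun A => ?_,
      fun A => ?_, matCrystal_f_neg n, matCrystal_e_neg n, fun A B h => ⟨?_, ?_⟩⟩
    · simp only [matCrystal, ite_neg_index]
      rw [wordI_eq, (isLetter_neg n).wordEps_eq]
    · refine Eq.trans ?_ (congrArg _ (matWt_pairing_neg n A).symm)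
      simp only [matCrystal, ite_neg_index]
      rw [wordI_eq, (isLetter_neg n).wordPhi_eq]
    · simp only [h.fstep.ep_eq, Nat.cast_add, Nat.cast_one]
    · simp only [matCrystal]
      rw [matWt_eq, matWt_eq A, h.fstep.wordWt_eq (negLetter_wt_succ n), wordWt_perm h.wordL_perm]
      abel
  · refine ⟨fun A => A (1, 1), fun A B => B = A + single (1, 1) 1, fun A => ?_, fun A => ?_,
      fun A B => ?_, fun A B => ?_, fun A B h => ⟨?_, ?_⟩⟩
    · simp [matCrystal]
    · simp [matCrystal]
    · rw [matCrystal_f_zero, Option.some_inj, eq_comm]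
    · rw [matCrystal_e_zero]
      constructor
      · intro h
        split_ifs at h with h1
        · obtain ⟨A', rfl⟩ := exists_eq_add_single h1
          rw [add_tsub_cancel_right, Option.some_inj] at h
          rw [h]
      · rintro rfl
        rw [if_pos (by simp), add_tsub_cancel_right]
    · rw [h]; simp
    · simp only [matCrystal]
      rw [h, matWt_add, matWt_single, one_smul, sub_eq_add_neg]
      congr 1
      -- The unit at `(1, 1)` has weight `-ε_{-1} + ε_1 = -α_0`.
      simp [negLetter, posLetter, simpleRoot, leftIdx, rightIdx]
      abel
  · refine ⟨fun A => ep n (wordL A), fun A B => MStep n A B, fun A => ?_,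
      fun A => ?_, matCrystal_f_pos n, matCrystal_e_pos n, fun A B h => ⟨?_, ?_⟩⟩
    · simp only [matCrystal, ite_pos_index]
      rw [(isLetter_pos n).wordEps_eq]
    · refine Eq.trans ?_ (congrArg _ (matWt_pairing_pos n A).symm)
      simp only [matCrystal, ite_pos_index]
      rw [(isLetter_pos n).wordPhi_eq]
    · simp only [h.fstep.ep_eq, Nat.cast_add, Nat.cast_one]
    · simp only [matCrystal]
      have h' : MStep n (matT (matT A)) (matT (matT B)) := by simpa using h
      rw [matWt_eq, matWt_eq A, h.fstep.wordWt_eq (posLetter_wt_succ n), wordWt_perm h'.wordL_perm]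
      abel

/-! ### The isomorphism -/

/-- The map `κ`. -/
noncomputable def kappa (A : Mat) : Bitableau :=
  ⟨(tabOf (wordL (matT A)), tabOf (wordL A)), isAntiSST_tabOf _, isAntiSST_tabOf _,
    shape_tabOf_wordL_matT A⟩

lemma kappa_bijective : Function.Bijective kappa := by
  constructor
  · intro A B h
    have h' := congrArg Subtype.val h
    exact eq_of_tabOf_eq (congrArg Prod.snd h') (congrArg Prod.fst h')
  · rintro ⟨⟨S, T⟩, hS, hT, h⟩
    obtain ⟨A, h1, h2⟩ := exists_tabOf_eq hS hT h
    exact ⟨A, Subtype.ext (Prod.ext h1 h2)⟩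

lemma readings_injective : Function.Injective readings := by
  rintro ⟨⟨S, T⟩, hS, hT, h⟩ ⟨⟨S', T'⟩, hS', hT', h'⟩ e
  simp only [readings, Prod.mk.injEq] at e
  exact Subtype.ext (Prod.ext (eq_of_readingWord_eq hS hS' e.2.1)
    (eq_of_readingWord_eq hT hT' e.2.2))

/-- Injectivity makes the choice in `induced` irrelevant. -/
lemma induced_eq_some {X Y : Type*} {j : X → Y} (hj : Function.Injective j) {op : Y → Option Y}
    {x x' : X} (h : op (j x) = some (j x')) : induced j op x = some x' := by
  have h' : ∃ x', op (j x) = some (j x') := ⟨x', h⟩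
  rw [induced, dif_pos h', Option.some_inj]
  exact hj (Option.some_inj.1 (h'.choose_spec.symm.trans h))

lemma induced_eq_none {X Y : Type*} {j : X → Y} {op : Y → Option Y} {x : X}
    (h : op (j x) = none) : induced j op x = none := by
  rw [induced, dif_neg]
  rintro ⟨x', h'⟩
  simp [h] at h'

/-- An injection that intertwines operators commutes with the induced operator. -/
lemma induced_eq_map {X Y Z : Type*} {j : X → Y} (hj : Function.Injective j) {op : Y → Option Y}
    {κ : Z → X} {g : Z → Option Z} {z : Z} (h1 : ∀ z', g z = some z' → op (j (κ z)) = some (j (κ z')))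
    (h2 : g z = none → op (j (κ z)) = none) : induced j op (κ z) = (g z).map κ := by
  rcases hz : g z with _ | z'
  · exact induced_eq_none (h2 hz)
  · exact induced_eq_some hj (h1 z' hz)

lemma ep_readingWord_tabOf (n : ℕ+) (w : List ℕ+) : ep n (readingWord (tabOf w)) = ep n w := by
  rw [(isAntiSST_tabOf w).ep_readingWord, ep_tabOf]

lemma ph_readingWord_tabOf (n : ℕ+) (w : List ℕ+) : ph n (readingWord (tabOf w)) = ph n w := by
  rw [(isAntiSST_tabOf w).ph_readingWord, ph_tabOf]

lemma readingWord_tabOf_perm (w : List ℕ+) : (readingWord (tabOf w)).Perm w :=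
  (isAntiSST_tabOf w).readingWord_perm.trans (tabOf_perm w).symm

lemma bitabWt_kappa (A : Mat) : bitabWt (kappa A) = matWt A := by
  rw [bitabWt, matWt_eq]
  exact congrArg₂ _ (wordWt_perm (readingWord_tabOf_perm _)) (wordWt_perm (readingWord_tabOf_perm _))

lemma bitabCrystal_ε (i : ℤ) (A : Mat) : bitabCrystal.ε i (kappa A) = matCrystal.ε i A := by
  rcases int_cases i with ⟨n, rfl⟩ | rfl | ⟨n, rfl⟩
  · simp only [bitabCrystal, matCrystal, ite_neg_index, kappa]
    rw [wordI_eq, (isLetter_neg n).wordEps_eq, (isLetter_neg n).wordEps_eq, ep_readingWord_tabOf]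
  · simp only [bitabCrystal, matCrystal, lt_irrefl, if_false, if_true, bitabEps0, kappa]
    rw [(zero_operators A).1]
  · simp only [bitabCrystal, matCrystal, ite_pos_index, kappa]
    rw [(isLetter_pos n).wordEps_eq, (isLetter_pos n).wordEps_eq, ep_readingWord_tabOf]

lemma bitabCrystal_φ (i : ℤ) (A : Mat) : bitabCrystal.φ i (kappa A) = matCrystal.φ i A := by
  rcases int_cases i with ⟨n, rfl⟩ | rfl | ⟨n, rfl⟩
  · simp only [bitabCrystal, matCrystal, ite_neg_index, kappa]
    rw [wordI_eq, (isLetter_neg n).wordPhi_eq, (isLetter_neg n).wordPhi_eq, ph_readingWord_tabOf]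
  · simp only [bitabCrystal, matCrystal, lt_irrefl, if_false, if_true, bitabWt_kappa, bitabEps0]
    simp only [kappa]
    rw [(zero_operators A).1]
  · simp only [bitabCrystal, matCrystal, ite_pos_index, kappa]
    rw [(isLetter_pos n).wordPhi_eq, (isLetter_pos n).wordPhi_eq, ph_readingWord_tabOf]

namespace IsLetter

variable {C : CrystalData ℕ+} {i : ℤ} {n : ℕ+} (h : IsLetter C i n) {A : Mat}
include h

/-- Whether the operator is defined is read off from φ, which agrees for the word of the matrix and
the reading word of its tableau. -/
lemma wordF_readingWord_eq_none (hA : ∀ B, ¬ MStep n A B) :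
    wordF C i (readingWord (tabOf (wordL A))) = none := by
  rw [Option.eq_none_iff_forall_ne_some]
  intro w hw
  have := ((h.wordF_eq_some_iff _ _).1 hw).ph_eq
  rw [ph_readingWord_tabOf] at this
  obtain ⟨B, hB⟩ := MStep.exists_of_ph_pos (by omega : 0 < ph n (wordL A))
  exact hA B hB

lemma wordE_readingWord_eq_none (hA : ∀ B, ¬ MStep n B A) :
    wordE C i (readingWord (tabOf (wordL A))) = none := by
  rw [Option.eq_none_iff_forall_ne_some]
  intro w hw
  have := ((h.wordE_eq_some_iff _ _).1 hw).ep_eq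
  rw [ep_readingWord_tabOf] at this
  obtain ⟨B, hB⟩ := MStep.exists_of_ep_pos (by omega : 0 < ep n (wordL A))
  exact hA B hB

end IsLetter

lemma bitabCrystal_f (i : ℤ) (A : Mat) :
    bitabCrystal.f i (kappa A) = (matCrystal.f i A).map kappa := by
  rcases int_cases i with ⟨n, rfl⟩ | rfl | ⟨n, rfl⟩
  · simp only [bitabCrystal, ite_neg_index]
    refine induced_eq_map (g := matCrystal.f (-((n : ℕ) : ℤ))) readings_injective
      (fun B hB => ?_) fun hA => ?_
    · rw [matCrystal_f_neg] at hB
      simp only [readings, kappa]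
      rw [((isLetter_neg n).wordF_eq_some_iff _ _).2 hB.fstep.readingWord_tabOf, hB.tabOf_wordL,
        hB.fstep.tabOf.2]
      rfl
    · simp only [readings, kappa]
      rw [(isLetter_neg n).wordF_readingWord_eq_none]
      · rfl
      · intro B hB
        rw [← matT_matT B, ← matCrystal_f_neg, hA] at hB
        simp at hB
  · simp only [bitabCrystal, lt_irrefl, if_false, if_true]
    rw [matCrystal_f_zero]
    exact induced_eq_some Subtype.val_injective (zero_operators A).2.1
  · simp only [bitabCrystal, ite_pos_index]
    refine induced_eq_map (g := matCrystal.f ((n : ℕ) : ℤ)) readings_injective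
      (fun B hB => ?_) fun hA => ?_
    · rw [matCrystal_f_pos] at hB
      simp only [readings, kappa]
      rw [((isLetter_pos n).wordF_eq_some_iff _ _).2 hB.fstep.readingWord_tabOf,
        hB.tabOf_wordL_matT]
      rfl
    · simp only [readings, kappa]
      rw [(isLetter_pos n).wordF_readingWord_eq_none]
      · rfl
      · intro B hB
        rw [← matCrystal_f_pos, hA] at hB
        simp at hB

lemma bitabCrystal_e (i : ℤ) (A : Mat) :
    bitabCrystal.e i (kappa A) = (matCrystal.e i A).map kappa := by
  rcases int_cases i with ⟨n, rfl⟩ | rfl | ⟨n, rfl⟩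
  · simp only [bitabCrystal, ite_neg_index]
    refine induced_eq_map (g := matCrystal.e (-((n : ℕ) : ℤ))) readings_injective
      (fun B hB => ?_) fun hA => ?_
    · rw [matCrystal_e_neg] at hB
      simp only [readings, kappa]
      rw [((isLetter_neg n).wordE_eq_some_iff _ _).2 hB.fstep.readingWord_tabOf, hB.tabOf_wordL,
        hB.fstep.tabOf.2]
      rfl
    · simp only [readings, kappa]
      rw [(isLetter_neg n).wordE_readingWord_eq_none]
      · rfl
      · intro B hB
        rw [← matT_matT B, ← matCrystal_e_neg, hA] at hB
        simp at hB
  · simp only [bitabCrystal, lt_irrefl, if_false, if_true]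
    rw [matCrystal_e_zero]
    split_ifs with h
    · obtain ⟨A', rfl⟩ := exists_eq_add_single h
      rw [add_tsub_cancel_right]
      exact induced_eq_some Subtype.val_injective (zero_operators A').2.2
    · exact induced_eq_none (zeroE_eq_none (not_not.1 h))
  · simp only [bitabCrystal, ite_pos_index]
    refine induced_eq_map (g := matCrystal.e ((n : ℕ) : ℤ)) readings_injective
      (fun B hB => ?_) fun hA => ?_
    · rw [matCrystal_e_pos] at hB
      simp only [readings, kappa]
      rw [((isLetter_pos n).wordE_eq_some_iff _ _).2 hB.fstep.readingWord_tabOf,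
        hB.tabOf_wordL_matT]
      rfl
    · simp only [readings, kappa]
      rw [(isLetter_pos n).wordE_readingWord_eq_none]
      · rfl
      · intro B hB
        rw [← matCrystal_e_pos, hA] at hB
        simp at hB

/-- All axioms for `C₂` are pulled back along the bijection. For bitableaux this yields crystal
axioms that are not evident from the definition, such as `ẽ_0` and `f̃_0` being mutually inverse. -/
theorem isCrystal_of_bijective {B₁ B₂ : Type*} {C₁ : CrystalData B₁} {C₂ : CrystalData B₂}
    {κ : B₁ → B₂} (hκ : Function.Bijective κ) (hwt : ∀ b, C₂.wt (κ b) = C₁.wt b)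
    (hε : ∀ i b, C₂.ε i (κ b) = C₁.ε i b) (hφ : ∀ i b, C₂.φ i (κ b) = C₁.φ i b)
    (he : ∀ i b, C₂.e i (κ b) = (C₁.e i b).map κ) (hf : ∀ i b, C₂.f i (κ b) = (C₁.f i b).map κ)
    (h : IsCrystal C₁) : IsCrystal C₂ ∧ IsIsomorphism C₁ C₂ (Option.map κ) := by
  have hmap : ∀ (o : Option B₁) b, o.map κ = some (κ b) ↔ o = some b := fun o b => by
    rw [← Option.map_some, (Option.map_injective hκ.1).eq_iff]
  refine ⟨⟨?_, ?_, ?_, ?_, ?_⟩, ⟨⟨rfl, ?_, ?_, ?_⟩, ?_, ?_⟩⟩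
  · intro i b
    obtain ⟨b, rfl⟩ := hκ.2 b
    rw [hφ, hwt, hε]; exact h.phi_eq i b
  · intro i b b' hb
    obtain ⟨b, rfl⟩ := hκ.2 b
    obtain ⟨b', rfl⟩ := hκ.2 b'
    rw [he, hmap] at hb
    simp only [hφ, hwt, hε]; exact h.e_spec i b b' hb
  · intro i b b' hb
    obtain ⟨b, rfl⟩ := hκ.2 b
    obtain ⟨b', rfl⟩ := hκ.2 b'
    rw [hf, hmap] at hb
    simp only [hφ, hwt, hε]; exact h.f_spec i b b' hb
  · intro i b b'
    obtain ⟨b, rfl⟩ := hκ.2 b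
    obtain ⟨b', rfl⟩ := hκ.2 b'
    rw [hf, he, hmap, hmap]; exact h.f_iff_e i b b'
  · intro i b hb
    obtain ⟨b, rfl⟩ := hκ.2 b
    rw [hφ] at hb
    rw [hf, he, (h.bot i b hb).1, (h.bot i b hb).2]
    exact ⟨rfl, rfl⟩
  · intro b b' hb
    obtain rfl : κ b = b' := by simpa using hb
    exact ⟨hwt b, fun i => ⟨hε i b, hφ i b⟩⟩
  · intro i b _ _
    rw [Option.map_some, Option.bind_some, he]
  · intro i b _ _
    rw [Option.map_some, Option.bind_some, hf]
  · rintro i (_ | b)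
    · exact ⟨rfl, rfl⟩
    · simp only [Option.map_some, Option.bind_some, he, hf, and_self]
  · refine ⟨Option.map_injective hκ.1, ?_⟩
    rintro (_ | b)
    · exact ⟨none, rfl⟩
    · obtain ⟨b, rfl⟩ := hκ.2 b
      exact ⟨some b, rfl⟩

end GlInf

theorem mainTheorem1 :
    GlInf.IsCrystal GlInf.matCrystal ∧
    GlInf.IsCrystal GlInf.bitabCrystal ∧
    ∃ κ : GlInf.Mat → GlInf.Bitableau,
      (∀ A : GlInf.Mat, (κ A).val = (GlInf.tabP A, GlInf.tabQ A)) ∧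
      GlInf.IsIsomorphism GlInf.matCrystal GlInf.bitabCrystal (Option.map κ) := by
  have h := GlInf.isCrystal_of_bijective GlInf.kappa_bijective GlInf.bitabWt_kappa
    GlInf.bitabCrystal_ε GlInf.bitabCrystal_φ GlInf.bitabCrystal_e GlInf.bitabCrystal_f
    GlInf.isCrystal_matCrystal
  refine ⟨GlInf.isCrystal_matCrystal, h.1, GlInf.kappa, fun A => ?_, h.2⟩
  rw [GlInf.tabP_eq, GlInf.tabQ_eq]
  rfl
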